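/- **Theorem (Thermal Goldstone theorem).** Let $s\ge 3$, write points of $\mathbb R^{1+s}$ as $(x_0,\vec x)$, and call two sets totally space-like if $|x_0-y_0|<|\vec x-\vec y|$ for all $x$ in the first and $y$ in the second. A *region* is a bounded, contractible, open subset of $\mathbb R^{1+s}$; test functions are real-valued and in $C_0^\infty$. *Framework.* Let $\mathcal A_S$ be a unital $C^*$-algebra with (i) an inclusion-preserving net $\mathcal O\mapsto\mathcal A_S(\mathcal O)$ of $C^*$-subalgebras containing the common unit, indexed by regions, such that $\mathcal A_L=\bigcup_{\mathcal O}\mathcal A_S(\mathcal O)$ is norm dense in $\mathcal A_S$, and a group $(\alpha_a)_{a\in\mathbb R^{1+s}}$ of $*$-automorphisms of $\mathcal A_S$ (space-time translations) such that $t\mapsto\tau_t(A):=\alpha_{(t,\vec 0)}(A)$ is norm continuous for every $A\in\mathcal A_S$; put $\sigma_{\vec x}:=\alpha_{(0,\vec x)}$; (ii) a set $\mathcal S$ of states on $\mathcal A_S$ (the physical states) with complex linear span $\Sigma$; let $\Sigma(\mathcal O)$ be the space of restrictions of elements of $\Sigma$ to $\mathcal A_S(\mathcal O)$; (iii) for every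 region $\mathcal O$, the dual space $\Sigma(\mathcal O)^*$ is a $W^*$-algebra into which $\mathcal A_S(\mathcal O)$ is canonically mapped by a unital $*$-homomorphism with weakly dense range; (iv) $[A,B]=0$ whenever $A\in\mathcal A_S(\mathcal O_1)$, $B\in\mathcal A_S(\mathcal O_2)$ and $\mathcal O_1,\mathcal O_2$ are totally space-like. *State.* Let $\omega\in\mathcal S$ have GNS triple $(\mathcal H_\omega,\pi_\omega,\Omega_\omega)$, and assume: (A1) $\omega$ is a factor state: $\pi_\omega(\mathcal A_S)''\cap\pi_\omega(\mathcal A_S)'=\mathbb C 1$; (A2) for some $\beta>0$, $\omega$ is a $\beta$-KMS state for $\tau$: for all $A,B\in\mathcal A_S$ there is a function $F$, continuous on $0\le\Im z\le\beta$, analytic and bounded on $0<\Im z<\beta$, with $F(t)=\omega(A\tau_t(B))$ and $F(t+i\beta)=\omega(\tau_t(B)A)$ for all $t\in\mathbb R$; (A3) $\omega\circ\sigma_{\vec x}=\omega$ for all $\vec x\in\mathbb R^s$. Then $\omega$ is invariant under all $\alpha_a$; let $T(a)$ be the unitary on $\mathcal H_\omega$ with $T(a)\pi_\omega(A)\Omega_\omega=\pi_\omega(\alpha_a(A))\Omega_\omega$.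 Let $\mathcal R(\mathcal O)=\pi_\omega(\mathcal A_S(\mathcal O))''$. *Current.* For $\mu=0,\dots,s$ and every test function $f$ on $\mathbb R^{1+s}$ let $J_\mu(f)$ be a (possibly unbounded) self-adjoint operator on $\mathcal H_\omega$ such that (A4) $\Omega_\omega$ lies in the domain of every $J_\mu(f)$, and $f\mapsto J_\mu(f)\Omega_\omega$ is real linear; (A5) $T(a)J_\mu(f)T(a)^{-1}=J_\mu(f_a)$, where $f_a(x)=f(x-a)$; (A6) $\sum_{\mu=0}^s J_\mu(\partial f/\partial x_\mu)=0$ on the intersection of the domains of the summands; (A7) (a) $(\Omega_\omega,[J_\mu(f),A]\Omega_\omega):=(J_\mu(f)\Omega_\omega,\pi_\omega(A)\Omega_\omega)-(\pi_\omega(A^*)\Omega_\omega,J_\mu(f)\Omega_\omega)=0$ if $A\in\mathcal A_S(\mathcal O)$ and $\operatorname{supp}f$ is totally space-like to $\mathcal O$; (b) $(J_0(f)\Omega_\omega,J_k(g)\Omega_\omega)-(J_k(g)\Omega_\omega,J_0(f)\Omega_\omega)=0$ for $k=1,\dots,s$ if $\operatorname{supp}f$ and $\operatorname{supp}g$ are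 totally space-like; (A8) every $J_0(f)$ is affiliated to $\mathcal R(\mathcal O)$ for some region $\mathcal O\supseteq\operatorname{supp}f$. *Symmetry breaking.* Assume that there are $d>0$, $0<\varepsilon<1$, test functions $f_d$ on $\mathbb R$ and $g$ on $\mathbb R^s$ with $\int f_d=1$, $f_d(x_0)=0$ for $|x_0|\ge d$, $g(\vec x)=1$ for $|\vec x|\le1$, $g(\vec x)=0$ for $|\vec x|>1+\varepsilon$, and some $A_0\in\mathcal A_L$ such that, with $g_R(\vec x)=g(\vec x/R)$, $$\lim_{R\to\infty}(\Omega_\omega,[J_0(f_d\otimes g_R),A_0]\Omega_\omega)=c\neq0 .$$ Let $\delta\in\mathbb R$ be a rate of space-like clustering of $\omega$, i.e. for all $A,B\in\mathcal A_L$ $$\omega(A\,\sigma_{\vec x}(B))-\omega(A)\omega(B)=O(|\vec x|^{-\delta})\qquad(|\vec x|\to\infty),$$ where the implied constant may depend on $A,B$. Then $\delta\le s-2$. -/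

import Mathlib

open scoped ComplexOrder InnerProductSpace Distributions LineDeriv Topology
open TopologicalSpace

universe u

noncomputable section

namespace ThermalQFT

/-! ### Minkowski space and test functions -/

/-- Space `ℝ^s` with its Euclidean norm. -/
abbrev Space (s : ℕ) : Type := EuclideanSpace ℝ (Fin s)

/-- Minkowski space `ℝ^{1+s}`, points written `(x₀, x)` (time, space). -/
abbrev Spacetime (s : ℕ) : Type := ℝ × Space s

/-- The coordinate vector `e_μ`; `μ = 0` is time, `μ = k + 1` is the `k`-th space direction. -/
def coordVec {s : ℕ} : Fin (s + 1) → Spacetime s :=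
  Fin.cases (1, 0) (fun k => (0, EuclideanSpace.single k 1))

/-- Every point of `X` is space-like to every point of `Y`. -/
def TotallySpacelike {s : ℕ} (X Y : Set (Spacetime s)) : Prop :=
  ∀ x ∈ X, ∀ y ∈ Y, |x.1 - y.1| < ‖x.2 - y.2‖

/-- Finite (bounded), contractible, open regions of Minkowski space. -/
structure Region (s : ℕ) where
  carrier : Set (Spacetime s)
  isOpen : IsOpen carrier
  isBounded : Bornology.IsBounded carrier
  contractible : ContractibleSpace carrier

/-- Real test functions `C_0^∞(E)`. -/
abbrev TestFn (E : Type*) [NormedAddCommGroup E] [NormedSpace ℝ E] : Type _ :=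
  𝓓((⊤ : Opens E), ℝ)

/-- The translate `f_a(x) = f(x - a)`. -/
def translate {E : Type*} [NormedAddCommGroup E] [NormedSpace ℝ E] (a : E) (f : TestFn E) :
    TestFn E where
  toFun x := f (x - a)
  contDiff' := f.contDiff.comp (contDiff_id.sub contDiff_const)
  hasCompactSupport' := by
    simpa [sub_eq_add_neg, Function.comp_def] using
      f.hasCompactSupport.comp_homeomorph (Homeomorph.addRight (-a))
  tsupport_subset' := fun _ _ => trivial

/-- The dilate `g_R(x) = g(x / R)`, for `R ≠ 0`. -/
def dilate {E : Type*} [NormedAddCommGroup E] [NormedSpace ℝ E] (R : ℝ) (g : TestFn E) :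
    TestFn E :=
  if hR : R = 0 then 0 else
  { toFun := fun x => g (R⁻¹ • x)
    contDiff' := g.contDiff.comp (contDiff_id.const_smul R⁻¹)
    hasCompactSupport' := g.hasCompactSupport.comp_smul (inv_ne_zero hR)
    tsupport_subset' := fun _ _ => trivial }

/-- The tensor product `(f ⊗ g)(x₀, x) = f(x₀) g(x)`. -/
def tensor {s : ℕ} (f : TestFn ℝ) (g : TestFn (Space s)) : TestFn (Spacetime s) where
  toFun x := f x.1 * g x.2
  contDiff' := (f.contDiff.comp contDiff_fst).mul (g.contDiff.comp contDiff_snd)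
  hasCompactSupport' := by
    refine HasCompactSupport.intro (f.hasCompactSupport.isCompact.prod
      g.hasCompactSupport.isCompact) fun x hx => ?_
    rcases not_and_or.1 hx with h | h
    · simp [image_eq_zero_of_notMem_tsupport h]
    · simp [image_eq_zero_of_notMem_tsupport h]
  tsupport_subset' := fun _ _ => trivial

/-! ### Nets of local algebras -/

section Algebra

variable {A : Type u} [CStarAlgebra A] [PartialOrder A] [StarOrderedRing A] {s : ℕ}

/-- A net of local `C*`-algebras inside the total algebra `A`, together with the group of
space-time translations and the set of physical states. -/
structure LocalNet (s : ℕ) (A : Type u) [CStarAlgebra A] [PartialOrder A]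
    [StarOrderedRing A] where
  /-- The local algebras; they share the unit of `A`. -/
  alg : Region s → StarSubalgebra ℂ A
  /-- The space-time translation automorphisms. -/
  trans : Spacetime s → (A ≃⋆ₐ[ℂ] A)
  /-- The physical states. -/
  physical : Set (A →ₚ[ℂ] ℂ)
  isClosed_alg : ∀ O, IsClosed (alg O : Set A)
  isotony : ∀ O₁ O₂ : Region s, O₁.carrier ⊆ O₂.carrier → alg O₁ ≤ alg O₂
  /-- `A` is the norm completion of the union of the local algebras. -/
  dense_iUnion : Dense (⋃ O, (alg O : Set A))
  trans_zero : ∀ a, trans 0 a = a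
  trans_add : ∀ x y a, trans (x + y) a = trans x (trans y a)
  /-- Norm continuity of the time evolution. -/
  continuous_time : ∀ a, Continuous fun t : ℝ => trans (t, 0) a
  /-- Local commutativity. -/
  local_comm : ∀ O₁ O₂ : Region s, TotallySpacelike O₁.carrier O₂.carrier →
    ∀ a ∈ alg O₁, ∀ b ∈ alg O₂, a * b = b * a
  physical_one : ∀ φ ∈ physical, φ 1 = 1

namespace LocalNet

variable (N : LocalNet s A)

/-- Time translations `τ_t`. -/
def time (t : ℝ) : A ≃⋆ₐ[ℂ] A := N.trans (t, 0)

/-- Space translations `σ_x`. -/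
def space (x : Space s) : A ≃⋆ₐ[ℂ] A := N.trans (0, x)

/-- The strictly local algebra `A_L`. -/
def localAlg : Set A := ⋃ O, (N.alg O : Set A)

/-- `Σ(O)`: the restrictions to `A(O)` of the elements of the complex span of the physical
states. -/
def localFunctionals (O : Region s) : Submodule ℂ (StrongDual ℂ (N.alg O)) :=
  Submodule.span ℂ {ψ | ∃ φ ∈ N.physical, ∀ a : N.alg O, ψ a = φ (a : A)}

set_option maxSynthPendingDepth 5 in
/-- For every region `O` the dual of `Σ(O)` is a `W*`-algebra into which `A(O)` maps canonically
by a unital `*`-homomorphism with weakly dense range. -/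
def HasLocalWStar : Prop :=
  ∀ O : Region s, ∃ (M : Type u) (_ : CStarAlgebra M)
    (e : M ≃ₗᵢ[ℂ] StrongDual ℂ (N.localFunctionals O)) (ι : N.alg O →⋆ₐ[ℂ] M),
    (∀ (a : N.alg O) (φ : N.localFunctionals O),
      e (ι a) φ = (φ : StrongDual ℂ (N.alg O)) a) ∧
    DenseRange fun a : N.alg O => StrongDual.toWeakDual (e (ι a))

/-- `ω` is a KMS state at inverse temperature `β` for the time evolution. -/
def IsKMS (ω : A →ₚ[ℂ] ℂ) (β : ℝ) : Prop :=
  ∀ a b : A, ∃ F : ℂ → ℂ,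
    ContinuousOn F {z | 0 ≤ z.im ∧ z.im ≤ β} ∧
    DifferentiableOn ℂ F {z | 0 < z.im ∧ z.im < β} ∧
    (∃ C : ℝ, ∀ z : ℂ, 0 < z.im → z.im < β → ‖F z‖ ≤ C) ∧
    ∀ t : ℝ, F t = ω (a * N.time t b) ∧ F (t + Complex.I * β) = ω (N.time t b * a)

/-- Space-like clustering of `ω` with rate `δ`: for all local `a`, `b`,
`ω(a σ_x(b)) - ω(a) ω(b) = O(|x|^{-δ})` as `|x| → ∞`. -/
def ClustersWithRate (ω : A →ₚ[ℂ] ℂ) (δ : ℝ) : Prop :=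
  ∀ a ∈ N.localAlg, ∀ b ∈ N.localAlg,
    (fun x : Space s => ω (a * N.space x b) - ω a * ω b)
      =O[Bornology.cobounded (Space s)] fun x => ‖x‖ ^ (-δ)

end LocalNet

/-! ### GNS representation -/

section GNS

variable (ω : A →ₚ[ℂ] ℂ)

/-- The cyclic vector `Ω_ω` of the GNS representation. -/
def gnsVec : ω.GNS := ((ω.toPreGNS 1 : ω.PreGNS) : ω.GNS)

/-- The isometry of the pre-GNS space induced by an endomorphism that leaves `ω` invariant. -/
def preGNSMap (α : A →⋆ₐ[ℂ] A) (h : ∀ a, ω (α a) = ω a) : ω.PreGNS →ₗᵢ[ℂ] ω.PreGNS where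
  toLinearMap := ω.toPreGNS.toLinearMap ∘ₗ α.toAlgHom.toLinearMap ∘ₗ ω.ofPreGNS.toLinearMap
  norm_map' x := by
    have := h (star (ω.ofPreGNS x) * ω.ofPreGNS x)
    simp only [map_mul, map_star] at this
    simp [PositiveLinearMap.preGNS_norm_def, this]

/-- The unitary on the GNS space that implements an automorphism `α` with `ω ∘ α = ω`; it is
determined by `U π_ω(a) Ω_ω = π_ω(α(a)) Ω_ω`. -/
def gnsUnitary (α : A ≃⋆ₐ[ℂ] A) (h : ∀ a, ω (α a) = ω a) : ω.GNS ≃ₗᵢ[ℂ] ω.GNS where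
  toFun := (preGNSMap ω (α : A →⋆ₐ[ℂ] A) h).toContinuousLinearMap.completion
  invFun := (preGNSMap ω (α.symm : A →⋆ₐ[ℂ] A)
    (fun a => by simpa using (h (α.symm a)).symm)).toContinuousLinearMap.completion
  map_add' := map_add _
  map_smul' := map_smul _
  left_inv x := by
    induction x using UniformSpace.Completion.induction_on with
    | hp => exact isClosed_eq (by fun_prop) (by fun_prop)
    | ih x => simp [preGNSMap]
  right_inv x := by
    induction x using UniformSpace.Completion.induction_on with
    | hp => exact isClosed_eq (by fun_prop) (by fun_prop)
    | ih x => simp [preGNSMap]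
  norm_map' x := by
    induction x using UniformSpace.Completion.induction_on with
    | hp => exact isClosed_eq (ContinuousLinearMap.continuous _).norm continuous_norm
    | ih x => simp

theorem gnsUnitary_apply (α : A ≃⋆ₐ[ℂ] A) (h : ∀ a, ω (α a) = ω a) (a : A) :
    gnsUnitary ω α h (ω.gnsStarAlgHom a (gnsVec ω)) = ω.gnsStarAlgHom (α a) (gnsVec ω) := by
  simp [gnsUnitary, gnsVec, preGNSMap]

/-- The von Neumann algebra `π_ω(B)''` generated by a `*`-subalgebra `B` in the GNS
representation. -/
def gnsClosure (B : StarSubalgebra ℂ A) : VonNeumannAlgebra ω.GNS where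
  toStarSubalgebra := StarSubalgebra.centralizer ℂ
    (StarSubalgebra.centralizer ℂ (ω.gnsStarAlgHom '' (B : Set A)) : Set (ω.GNS →L[ℂ] ω.GNS))
  centralizer_centralizer' := by
    change Set.centralizer (Set.centralizer (Set.centralizer _)) = Set.centralizer _
    simp

/-- `ω` is a factor (primary) state: the centre of `π_ω(A)''` is trivial. -/
def IsFactorState : Prop :=
  ∀ T ∈ gnsClosure ω ⊤, T ∈ (gnsClosure ω ⊤).commutant → ∃ c : ℂ, T = c • 1

end GNS

/-- A closed operator `T` is affiliated to the von Neumann algebra `M`: every `B ∈ M'` maps the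
domain of `T` into itself and `T B ⊇ B T`. -/
def Affiliated {H : Type*} [NormedAddCommGroup H] [InnerProductSpace ℂ H] [CompleteSpace H]
    (T : H →ₗ.[ℂ] H) (M : VonNeumannAlgebra H) : Prop :=
  T.IsClosed ∧ ∀ B ∈ M.commutant, ∀ x : T.domain, ∃ h : B x ∈ T.domain, T ⟨B x, h⟩ = B (T x)

/-! ### Currents -/

/-- A family of self-adjoint operators `J_μ(f)` on the GNS space, with `Ω_ω` in all their
domains. -/
structure Current (s : ℕ) (ω : A →ₚ[ℂ] ℂ) where
  op : Fin (s + 1) → TestFn (Spacetime s) → (ω.GNS →ₗ.[ℂ] ω.GNS)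
  selfAdjoint : ∀ μ f, IsSelfAdjoint (op μ f)
  vec_mem : ∀ μ f, gnsVec ω ∈ (op μ f).domain

namespace Current

variable {ω : A →ₚ[ℂ] ℂ} (J : Current s ω)

/-- The vector `J_μ(f) Ω_ω`. -/
def vec (μ : Fin (s + 1)) (f : TestFn (Spacetime s)) : ω.GNS :=
  J.op μ f ⟨gnsVec ω, J.vec_mem μ f⟩

/-- `(Ω_ω, [J_μ(f), a] Ω_ω) := (J_μ(f) Ω_ω, π_ω(a) Ω_ω) - (π_ω(a*) Ω_ω, J_μ(f) Ω_ω)`. -/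
def comm (μ : Fin (s + 1)) (f : TestFn (Spacetime s)) (a : A) : ℂ :=
  ⟪J.vec μ f, ω.gnsStarAlgHom a (gnsVec ω)⟫_ℂ
    - ⟪ω.gnsStarAlgHom (star a) (gnsVec ω), J.vec μ f⟫_ℂ

/-- `(Ω_ω, [J_μ(f), J_ν(g)] Ω_ω) := (J_μ(f) Ω_ω, J_ν(g) Ω_ω) - (J_ν(g) Ω_ω, J_μ(f) Ω_ω)`. -/
def commCurrent (μ ν : Fin (s + 1)) (f g : TestFn (Spacetime s)) : ℂ :=
  ⟪J.vec μ f, J.vec ν g⟫_ℂ - ⟪J.vec ν g, J.vec μ f⟫_ℂ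

/-- `J` is a locally conserved, local, covariant current, affiliated to the local von Neumann
algebras `R(O)`; on the GNS space `R(O)` is the weak closure `π_ω(A(O))''`. -/
structure IsLocallyConserved (N : LocalNet s A) : Prop where
  /-- `J_μ(f) Ω_ω` is real linear in the test function. -/
  linear : ∀ μ (c : ℝ) f g, J.vec μ (c • f + g) = (c : ℂ) • J.vec μ f + J.vec μ g
  /-- `T(a) J_μ(f) T(a)⁻¹ = J_μ(f_a)` (equality of operators including their domains), where
  `T(a)` is the unitary implementing the space-time translation by `a`, under which `ω` is
  invariant. -/
  covariant : ∀ (a : Spacetime s) (h : ∀ b, ω (N.trans a b) = ω b) μ f (x y : ω.GNS),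
    (x, y) ∈ (J.op μ f).graph ↔
      (gnsUnitary ω (N.trans a) h x, gnsUnitary ω (N.trans a) h y)
        ∈ (J.op μ (translate a f)).graph
  /-- `∑_μ J_μ(∂f/∂x_μ) = 0` on the domain of the sum. -/
  conserved : ∀ (f : TestFn (Spacetime s)) (x : ω.GNS)
    (hx : ∀ μ, x ∈ (J.op μ (∂_{(coordVec μ : Spacetime s)} f)).domain),
    ∑ μ, J.op μ (∂_{(coordVec μ : Spacetime s)} f) ⟨x, hx μ⟩ = 0
  /-- Locality of the current relative to the local algebras. -/
  local_alg : ∀ μ (f : TestFn (Spacetime s)) (O : Region s), TotallySpacelike (tsupport f) O.carrier →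
    ∀ a ∈ N.alg O, J.comm μ f a = 0
  /-- Locality of the charge density relative to the spatial components. -/
  local_current : ∀ (k : Fin s) (f g : TestFn (Spacetime s)),
    TotallySpacelike (tsupport f) (tsupport g) → J.commCurrent 0 k.succ f g = 0
  /-- `J_0(f)` is affiliated to `R(O)` for some region `O` containing the support of `f`. -/
  affiliated : ∀ f : TestFn (Spacetime s), ∃ O : Region s,
    tsupport f ⊆ O.carrier ∧ Affiliated (J.op 0 f) (gnsClosure ω (N.alg O))

/-- Spontaneous symmetry breaking: `lim_{R → ∞} (Ω_ω, [J_0(f_d ⊗ g_R), A₀] Ω_ω) = c ≠ 0` for some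
local `A₀` and admissible `f_d`, `g`. -/
def IsBroken (N : LocalNet s A) : Prop :=
  ∃ (d ε : ℝ) (f : TestFn ℝ) (g : TestFn (Space s)), 0 < ε ∧ ε < 1 ∧
    (∫ t, f t) = 1 ∧ (∀ t, d ≤ |t| → f t = 0) ∧
    (∀ x, ‖x‖ ≤ 1 → g x = 1) ∧ (∀ x, 1 + ε < ‖x‖ → g x = 0) ∧
    ∃ a₀ ∈ N.localAlg, ∃ c : ℂ, c ≠ 0 ∧
      Filter.Tendsto (fun R : ℝ => J.comm 0 (tensor f (dilate R g)) a₀) Filter.atTop (𝓝 c)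

end Current

end Algebra

end ThermalQFT

end

noncomputable section

namespace ThermalQFT

open Complex MeasureTheory Filter Set
open scoped ComplexConjugate

/-! ### Bounded analytic functions on a strip -/

/-! The engine is the Bogoliubov inequality for KMS states. If `B` has time derivative `B'`, then
for every ε > 0 |ω([B, A*])| ≤ ½ (ε β ω(A*A + AA*) + ε⁻¹ |ω([B, B'*])|). It follows from
Cauchy–Schwarz for the Duhamel two-point function r ↦ ω(A* τ_{ir}(B')), 0 ≤ r ≤ β, whose integral is
a commutator (`IsOrbit.bogoliubov`, `LocalNet.IsKMS.bogoliubov`).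

For A take the average of the order parameter, with its mean subtracted, over the lattice translates
in a box of size n. For B take the charge with a Lipschitz cutoff at scale 2n, averaged over a unit
of time so that B' is a difference of two time translates. Three facts compete. (1) By locality and
current conservation the commutator on the left is exactly c for all large n
(`Current.IsLocallyConserved.vecComm_timeAverage_boxAverage`). (2) Clustering with a rate γ < s
makes the fluctuations of the average O(n^(-γ)) (`re_apply_star_boxAverage_mul_le`). (3) The
commutator of the charge with its time derivative is a quadratic form in the cutoff. Its kernel on
ℤ^s has finite range and, by conservation and reflection antisymmetry, total mass zero
(`Current.IsLocallyConserved.exists_range`). Such a form only sees squared differences of the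
cutoff, hence is O(n^(s-2)) instead of O(n^s) (`abs_sum_cutoff_kernel_le`). Thus |c| ≤ ε D n^(-γ) +
ε⁻¹ E n^(s-2). If γ > s - 2, optimizing ε and letting n → ∞ forces c = 0.

The charges are unbounded, but the inequality involves them only through the vectors J_0(f)Ω.
Affiliation makes these limits of vectors π(b)Ω with b self-adjoint and local
(`mem_closure_of_affiliated`). Self-adjointness is essential: it ensures that b*Ω converges along
with bΩ, so commutators pass to the limit. -/

theorem eq_zero_on_strip_of_eq_zero_on_real {f : ℂ → ℂ} {β : ℝ} (hβ : 0 < β)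
    (hc : ContinuousOn f {z | 0 ≤ z.im ∧ z.im ≤ β})
    (hd : DifferentiableOn ℂ f {z | 0 < z.im ∧ z.im < β})
    (hb : ∃ C : ℝ, ∀ z : ℂ, 0 < z.im → z.im < β → ‖f z‖ ≤ C)
    (h0 : ∀ t : ℝ, f t = 0) {z : ℂ} (hz : 0 ≤ z.im) (hz' : z.im ≤ β) : f z = 0 := by
  obtain ⟨C, hC⟩ := hb
  have hcl : closure (HadamardThreeLines.verticalStrip 0 β)
      = HadamardThreeLines.verticalClosedStrip 0 β := by
    rw [HadamardThreeLines.verticalStrip, HadamardThreeLines.verticalClosedStrip,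
      Complex.closure_preimage_re, closure_Ioo hβ.ne]
  set g : ℂ → ℂ := fun w => f (I * w) with hg
  have hgc : ContinuousOn g (HadamardThreeLines.verticalClosedStrip 0 β) :=
    hc.comp (by fun_prop) fun w hw => by
      simpa [HadamardThreeLines.verticalClosedStrip] using hw
  have hgd : DifferentiableOn ℂ g (HadamardThreeLines.verticalStrip 0 β) :=
    hd.comp (by fun_prop) fun w hw => by
      simpa [HadamardThreeLines.verticalStrip] using hw
  have hgb : ∀ w ∈ HadamardThreeLines.verticalStrip 0 β, ‖g w‖ ≤ C := fun w hw => by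
    simp only [HadamardThreeLines.verticalStrip, mem_preimage, mem_Ioo] at hw
    exact hC _ (by simpa using hw.1) (by simpa using hw.2)
  have hgb' : ∀ w ∈ HadamardThreeLines.verticalClosedStrip 0 β, ‖g w‖ ≤ C := fun w hw =>
    le_on_closure (f := fun w => ‖g w‖) (g := fun _ => C) hgb (by rw [hcl]; exact hgc.norm)
      continuousOn_const (by rwa [hcl])
  have hzero : ∀ w ∈ HadamardThreeLines.verticalStrip 0 β, g w = 0 := fun w hw => by
    have hw' : 0 < w.re ∧ w.re < β := by
      simpa [HadamardThreeLines.verticalStrip] using hw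
    -- Three lines theorem with bound 0 on one edge: the interpolated bound 0^(1-θ) C^θ vanishes for
    -- θ < 1. The edge θ = 1 is then reached by continuity.
    have key := HadamardThreeLines.norm_le_interp_of_mem_verticalClosedStrip' (f := g) (z := w)
      (a := 0) (b := C) hβ (by rw [← hcl]; exact subset_closure hw)
      ⟨hgd, by rw [hcl]; exact hgc⟩ ⟨C, by rintro _ ⟨w, hw, rfl⟩; exact hgb' w hw⟩
      (fun v hv => by
        have : I * v = ((-v.im : ℝ) : ℂ) := by
          apply Complex.ext <;> simp_all
        simpa [hg, this] using h0 (-v.im)) (fun v hv => hgb' v (by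
          simp only [mem_preimage, mem_singleton_iff] at hv
          simp [HadamardThreeLines.verticalClosedStrip, hv, hβ.le]))
    have hne : 1 - (w.re - 0) / (β - 0) ≠ 0 := by
      rw [sub_zero, sub_zero, sub_ne_zero]
      exact ((div_lt_one hβ).2 hw'.2).ne'
    rw [Real.zero_rpow hne, zero_mul] at key
    exact norm_le_zero_iff.1 key
  have hfin : g (-I * z) = 0 := by
    have hE : EqOn g (fun _ => 0) (HadamardThreeLines.verticalStrip 0 β) := hzero
    refine hE.of_subset_closure hgc continuousOn_const
      (by rw [← hcl]; exact subset_closure) hcl.ge ?_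
    simpa [HadamardThreeLines.verticalClosedStrip] using ⟨hz, hz'⟩
  simpa [hg, ← mul_assoc] using hfin

/-! ### KMS states on entire orbits -/

section Dynamics

variable {A : Type u} [CStarAlgebra A] [PartialOrder A] [StarOrderedRing A] {s : ℕ}
  (N : LocalNet s A)

theorem LocalNet.time_zero (a : A) : N.time 0 a = a := N.trans_zero a

theorem LocalNet.time_add (t r : ℝ) (a : A) : N.time (t + r) a = N.time t (N.time r a) := by
  simpa [LocalNet.time] using N.trans_add (t, 0) (r, 0) a

theorem LocalNet.continuous_time_apply (a : A) : Continuous fun t => N.time t a :=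
  N.continuous_time a

theorem LocalNet.norm_time (t : ℝ) (a : A) : ‖N.time t a‖ = ‖a‖ := StarAlgEquiv.norm_map _ a

/-- An entire extension `z ↦ τ_z(a)` of the time orbit of `a = x 0`. -/
structure IsOrbit (x : ℂ → A) : Prop where
  differentiable : Differentiable ℂ x
  time_apply : ∀ (t : ℝ) (z : ℂ), N.time t (x z) = x (z + t)

variable {N} {x y : ℂ → A} {ω : A →ₚ[ℂ] ℂ} {β : ℝ}

namespace IsOrbit

/-- Real time translations are isometric, so only a compact segment of the imaginary axis matters.
-/
theorem bounded (hx : IsOrbit N x) (r : ℝ) : ∃ C : ℝ, ∀ z : ℂ, |z.im| ≤ r → ‖x z‖ ≤ C := by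
  have hc : Continuous fun t : ℝ => x (t * I) := hx.differentiable.continuous.comp (by fun_prop)
  obtain ⟨C, hC⟩ := (isCompact_Icc (a := -r) (b := r)).exists_bound_of_continuousOn
    hc.continuousOn
  refine ⟨C, fun z hz => ?_⟩
  have : x z = N.time z.re (x (z.im * I)) := by
    rw [hx.time_apply, add_comm, Complex.re_add_im]
  rw [this, N.norm_time]
  exact hC _ (abs_le.1 hz)

theorem shift (hx : IsOrbit N x) (w : ℂ) : IsOrbit N fun z => x (z + w) where
  differentiable := hx.differentiable.comp (by fun_prop)
  time_apply t z := by rw [hx.time_apply, add_right_comm]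

theorem star_conj (hx : IsOrbit N x) : IsOrbit N fun z => star (x (conj z)) where
  differentiable z := by
    have := (hx.differentiable (conj z)).star_conj
    simpa [Function.comp_def] using this
  time_apply t z := by rw [map_star, hx.time_apply]; simp

theorem hasDerivAt_add (hx : IsOrbit N x) (z w : ℂ) :
    HasDerivAt (fun v => x (v + w)) (deriv x (z + w)) z := by
  simpa using (hx.differentiable (z + w)).hasDerivAt.comp_add_const z w

theorem deriv (hx : IsOrbit N x) : IsOrbit N (deriv x) where
  differentiable := by
    have := (hx.differentiable.differentiableOn (s := univ)).deriv isOpen_univ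
    exact differentiableOn_univ.1 this
  time_apply t z := by
    have h1 := hx.hasDerivAt_add z t
    let L : A →L[ℂ] A := ⟨(N.time t : A ≃⋆ₐ[ℂ] A).toAlgEquiv.toLinearEquiv.toLinearMap,
      (StarAlgEquiv.isometry (N.time t)).continuous⟩
    have h2 : HasDerivAt (fun v => N.time t (x v)) (N.time t (_root_.deriv x z)) z :=
      L.hasFDerivAt.comp_hasDerivAt z (hx.differentiable z).hasDerivAt
    simp_rw [hx.time_apply] at h2
    exact h2.unique h1

end IsOrbit

theorem differentiable_apply (ω : A →ₚ[ℂ] ℂ) {f : ℂ → A} (hf : Differentiable ℂ f) :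
    Differentiable ℂ fun z => ω (f z) := by
  let L : A →L[ℂ] ℂ := ⟨ω.toLinearMap, map_continuous ω⟩
  exact L.differentiable.comp hf

/-- The KMS condition for entire orbits. -/
theorem IsOrbit.kms (hβ : 0 < β) (hK : N.IsKMS ω β) (hx : IsOrbit N x) (a : A) :
    ω (a * x (I * β)) = ω (x 0 * a) := by
  obtain ⟨F, hFc, hFd, ⟨C, hC⟩, hF⟩ := hK a (x 0)
  have hG : Differentiable ℂ fun z => ω (a * x z) :=
    differentiable_apply ω ((differentiable_const a).mul hx.differentiable)
  obtain ⟨D, hD⟩ := hx.bounded β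
  obtain ⟨K, hKω⟩ := ω.exists_norm_apply_le
  -- The KMS function and the entire function z ↦ ω(a x(z)) agree on the real axis, hence on the
  -- whole strip.
  have key := eq_zero_on_strip_of_eq_zero_on_real (f := fun z => F z - ω (a * x z)) hβ
    (hFc.sub hG.continuous.continuousOn) (hFd.sub hG.differentiableOn)
    ⟨C + K * (‖a‖ * D), fun z h1 h2 => by
      refine (norm_sub_le _ _).trans (add_le_add (hC z h1 h2) ((hKω _).trans ?_))
      gcongr
      refine (norm_mul_le _ _).trans ?_
      gcongr
      exact hD z (by rw [abs_of_pos h1]; exact h2.le)⟩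
    (fun t => by
      have := (hF t).1
      rw [hx.time_apply, zero_add] at this
      simp [this]) (z := I * β) (by simpa using hβ.le) (by simp)
  have h2 := (hF 0).2
  rw [N.time_zero] at h2
  simp only [ofReal_zero, zero_add] at h2
  rw [← h2]
  exact (sub_eq_zero.1 key).symm

/-- KMS against the unit makes z ↦ ω(x(z)) periodic with period iβ. Being bounded on strips it is
bounded on ℂ, and Liouville applies. This also contains the time invariance of ω. -/
theorem IsOrbit.apply_eq (hβ : 0 < β) (hK : N.IsKMS ω β) (hx : IsOrbit N x) (z w : ℂ) :
    ω (x z) = ω (x w) := by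
  have hper : ∀ z, ω (x (z + I * β)) = ω (x z) := fun z => by
    have := (hx.shift z).kms hβ hK 1
    simpa [add_comm] using this
  have hG := differentiable_apply ω hx.differentiable
  have hperi : Function.Periodic (fun z => ω (x z)) (I * β) := hper
  obtain ⟨D, hD⟩ := hx.bounded β
  obtain ⟨K, hKω⟩ := ω.exists_norm_apply_le
  refine hG.apply_eq_apply_of_bounded ?_ z w
  refine isBounded_iff_forall_norm_le.2 ⟨K * D, ?_⟩
  rintro _ ⟨v, rfl⟩
  have h1 : ω (x (v - ⌊v.im / β⌋ • (I * (β : ℂ)))) = ω (x v) := hperi.sub_zsmul_eq _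
  change ‖ω (x v)‖ ≤ _
  rw [← h1]
  refine (hKω _).trans ?_
  gcongr
  apply hD
  have h3 : (v - ⌊v.im / β⌋ • (I * (β : ℂ))).im = v.im - ⌊v.im / β⌋ * β := by simp
  rw [h3]
  have h4 := Int.floor_le (v.im / β)
  have h5 := Int.lt_floor_add_one (v.im / β)
  rw [le_div_iff₀ hβ] at h4
  rw [div_lt_iff₀ hβ] at h5
  rw [abs_le]
  constructor <;> nlinarith

/-- Splitting an imaginary time translation symmetrically. -/
theorem IsOrbit.apply_star_mul (hβ : 0 < β) (hK : N.IsKMS ω β) (hx : IsOrbit N x)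
    (hy : IsOrbit N y) (r : ℝ) :
    ω (star (x 0) * y (I * r)) = ω (star (x (I * (r / 2 : ℝ))) * y (I * (r / 2 : ℝ))) := by
  -- The inner conjugation keeps the product analytic, so it is an orbit with constant expectation.
  -- The points z = 0 and z = -ir/2 give the two sides.
  have ho : IsOrbit N fun z => star (x (conj z)) * y (z + I * r) :=
    { differentiable := hx.star_conj.differentiable.mul (hy.shift _).differentiable
      time_apply := fun t z => by
        rw [map_mul, hx.star_conj.time_apply, hy.time_apply, add_right_comm] }
  have := ho.apply_eq hβ hK 0 (-(I * (r / 2 : ℝ)))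
  simp only [map_zero, zero_add] at this
  rw [this]
  congr 4
  · simp [-ofReal_div]
  · push_cast; ring

/-- Cauchy–Schwarz with the product split by a weight. The additive form can be integrated in
imaginary time, and the free weight is chosen only at the very end. -/
theorem norm_apply_star_mul_le (ω : A →ₚ[ℂ] ℂ) (a b : A) {ε : ℝ} (hε : 0 < ε) :
    ‖ω (star a * b)‖ ≤ (ε * (ω (star a * a)).re + ε⁻¹ * (ω (star b * b)).re) / 2 := by
  have h1 := norm_inner_le_norm (𝕜 := ℂ) (ω.toPreGNS a) (ω.toPreGNS b)
  have h2 : ∀ c : A, ‖ω.toPreGNS c‖ ^ 2 = (ω (star c * c)).re := fun c => by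
    have := ω.preGNS_norm_sq (ω.toPreGNS c)
    rw [ω.ofPreGNS_toPreGNS] at this
    rw [← this]
    norm_cast
  rw [ω.preGNS_inner_def, ω.ofPreGNS_toPreGNS, ω.ofPreGNS_toPreGNS] at h1
  rw [← h2, ← h2]
  refine h1.trans ?_
  set u := ‖ω.toPreGNS a‖
  set v := ‖ω.toPreGNS b‖
  have h3 : 0 ≤ ε⁻¹ * (ε * u - v) ^ 2 := by positivity
  have h4 : ε⁻¹ * (ε * u - v) ^ 2 = ε * u ^ 2 + ε⁻¹ * v ^ 2 - 2 * (u * v) := by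
    field_simp
    ring
  linarith

theorem re_apply_star_mul_self_nonneg (ω : A →ₚ[ℂ] ℂ) (a : A) : 0 ≤ (ω (star a * a)).re :=
  (Complex.le_def.1 (ω.map_nonneg (star_mul_self_nonneg a))).1

theorem re_apply_mul_star_self_nonneg (ω : A →ₚ[ℂ] ℂ) (a : A) : 0 ≤ (ω (a * star a)).re := by
  simpa using re_apply_star_mul_self_nonneg ω (star a)

/-- Along the imaginary axis the two-point function is bounded by its boundary values. -/
theorem IsOrbit.norm_apply_star_mul_self_le (hβ : 0 < β) (hK : N.IsKMS ω β) (hx : IsOrbit N x)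
    {r : ℝ} (hr : 0 ≤ r) (hr' : r ≤ β) :
    ‖ω (star (x 0) * x (I * r))‖ ≤ (ω (star (x 0) * x 0)).re + (ω (x 0 * star (x 0))).re := by
  have hmul : ∀ t : ℝ, ω (star (x t) * x t) = ω (star (x 0) * x 0) ∧
      ω (x t * star (x t)) = ω (x 0 * star (x 0)) := fun t => by
    have h1 : IsOrbit N fun z => star (x (conj z)) * x z :=
      ⟨hx.star_conj.differentiable.mul hx.differentiable, fun t z => by
        rw [map_mul, hx.star_conj.time_apply, hx.time_apply]⟩
    have h2 : IsOrbit N fun z => x z * star (x (conj z)) :=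
      ⟨hx.differentiable.mul hx.star_conj.differentiable, fun t z => by
        rw [map_mul, hx.star_conj.time_apply, hx.time_apply]⟩
    have e1 := h1.apply_eq hβ hK t 0
    have e2 := h2.apply_eq hβ hK t 0
    simp only [conj_ofReal, map_zero] at e1 e2
    exact ⟨e1, e2⟩
  set p := (ω (star (x 0) * x 0)).re with hp
  set q := (ω (x 0 * star (x 0))).re with hq
  have hp0 : 0 ≤ p := re_apply_star_mul_self_nonneg ω _
  have hq0 : 0 ≤ q := re_apply_mul_star_self_nonneg ω _
  have hD : Differentiable ℂ fun w => ω (star (x 0) * x (I * w)) :=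
    differentiable_apply ω ((differentiable_const _).mul (hx.differentiable.comp (by fun_prop)))
  obtain ⟨D, hDb⟩ := hx.bounded β
  obtain ⟨K, hKω⟩ := ω.exists_norm_apply_le
  -- Interpolation gives p^(1-θ) q^θ with θ = r/β, and the weighted mean inequality bounds this by p
  -- + q.
  have key := HadamardThreeLines.norm_le_interp_of_mem_verticalClosedStrip'
    (f := fun w => ω (star (x 0) * x (I * w))) (z := (r : ℂ)) (a := p) (b := q) hβ
    (by simp [HadamardThreeLines.verticalClosedStrip, hr, hr'])
    hD.diffContOnCl
    ⟨K * (‖x 0‖ * D), by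
      rintro _ ⟨w, hw, rfl⟩
      simp only [HadamardThreeLines.verticalClosedStrip, mem_preimage, mem_Icc] at hw
      refine (hKω _).trans ?_
      gcongr
      refine (norm_mul_le _ _).trans ?_
      rw [norm_star]
      gcongr
      refine hDb _ ?_
      simpa [abs_of_nonneg hw.1] using hw.2⟩
    (fun w hw => by
      have : I * w = ((-w.im : ℝ) : ℂ) := by apply Complex.ext <;> simp_all
      rw [this]
      have := norm_apply_star_mul_le ω (x 0) (x (-w.im : ℝ)) one_pos
      rw [(hmul _).1] at this
      linarith)
    (fun w hw => by
      have h1 : I * w = I * β + ((-w.im : ℝ) : ℂ) := by apply Complex.ext <;> simp_all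
      -- On the far edge KMS reverses the two factors, which is where the other ordering ω(x x*)
      -- comes from.
      have h2 := (hx.shift (-w.im : ℝ)).kms hβ hK (star (x 0))
      rw [h1, h2, zero_add]
      have := norm_apply_star_mul_le ω (star (x (-w.im : ℝ))) (star (x 0)) one_pos
      simp only [star_star] at this
      rw [(hmul _).2] at this
      linarith)
  refine key.trans ?_
  simp only [ofReal_re, sub_zero]
  have h1 : r / β ≤ 1 := (div_le_one hβ).2 hr'
  have h0 : 0 ≤ r / β := by positivity
  refine (Real.geom_mean_le_arith_mean2_weighted (by linarith) h0 hp0 hq0 (by ring)).trans ?_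
  nlinarith

/-- The Duhamel two-point function against a time derivative is a commutator. -/
theorem IsOrbit.integral_apply_mul_deriv (hβ : 0 < β) (hK : N.IsKMS ω β) (hy : IsOrbit N y)
    (a : A) :
    ∫ r in (0 : ℝ)..β, ω (a * _root_.deriv y (I * r)) = -I * (ω (y 0 * a) - ω (a * y 0)) := by
  -- An explicit primitive; at r = β the KMS condition reverses its factors, so the boundary terms
  -- form a commutator.
  have hder : ∀ r : ℝ, HasDerivAt (fun r : ℝ => -I * ω (a * y (I * r)))
      (ω (a * _root_.deriv y (I * r))) r := fun r => by
    let L : A →L[ℂ] ℂ := (⟨ω.toLinearMap, map_continuous ω⟩ : A →L[ℂ] ℂ) ∘L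
      ContinuousLinearMap.mul ℂ A a
    have h1 : HasDerivAt (fun z : ℂ => y (I * z)) (I • _root_.deriv y (I * r)) (r : ℂ) := by
      have h0 : HasDerivAt (fun z : ℂ => I * z) I (r : ℂ) := by
        simpa using (hasDerivAt_id (r : ℂ)).const_mul I
      exact (hy.differentiable (I * r)).hasDerivAt.scomp (r : ℂ) h0
    have h2 : HasDerivAt (fun z : ℂ => ω (a * y (I * z))) (L (I • _root_.deriv y (I * r))) (r : ℂ) :=
      L.hasFDerivAt.comp_hasDerivAt (r : ℂ) h1
    have h3 := (h2.comp_ofReal).const_mul (-I)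
    have h4 : -I * L (I • _root_.deriv y (I * r)) = ω (a * _root_.deriv y (I * r)) := by
      rw [map_smul, smul_eq_mul, ← mul_assoc]
      simp [L]
    rwa [h4] at h3
  have hcont : Continuous fun r : ℝ => ω (a * _root_.deriv y (I * r)) := by
    have := hy.deriv.differentiable.continuous
    have hω : Continuous ω := map_continuous ω
    fun_prop
  rw [intervalIntegral.integral_eq_sub_of_hasDerivAt (fun r _ => hder r)
    (hcont.intervalIntegrable _ _), hy.kms hβ hK]
  simp
  ring

/-- The Bogoliubov inequality for entire orbits. -/
theorem IsOrbit.bogoliubov (hβ : 0 < β) (hK : N.IsKMS ω β) (hx : IsOrbit N x)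
    (hy : IsOrbit N y) {ε : ℝ} (hε : 0 < ε) :
    ‖ω (y 0 * star (x 0)) - ω (star (x 0) * y 0)‖ ≤
      (ε * β * ((ω (star (x 0) * x 0)).re + (ω (x 0 * star (x 0))).re)
        + ε⁻¹ * ‖ω (y 0 * star (_root_.deriv y 0)) - ω (star (_root_.deriv y 0) * y 0)‖) / 2 := by
  set dy := _root_.deriv y with hdy
  have ho : IsOrbit N dy := hy.deriv
  have hω : Continuous ω := map_continuous ω
  have hxc := hx.differentiable.continuous
  have hdc := ho.differentiable.continuous
  -- The same identity with x* and with (y')*: the first integral is the commutator to be estimated,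
  -- the second is the Duhamel square of y'.
  have e1 := hy.integral_apply_mul_deriv hβ hK (star (x 0))
  have e2 := hy.integral_apply_mul_deriv hβ hK (star (dy 0))
  rw [← hdy] at e1 e2
  have n1 : ‖ω (y 0 * star (x 0)) - ω (star (x 0) * y 0)‖
      = ‖∫ r in (0 : ℝ)..β, ω (star (x 0) * dy (I * r))‖ := by rw [e1]; simp
  have n2 : ‖ω (y 0 * star (dy 0)) - ω (star (dy 0) * y 0)‖
      = ‖∫ r in (0 : ℝ)..β, ω (star (dy 0) * dy (I * r))‖ := by rw [e2]; simp
  have n3 : ∫ r in (0 : ℝ)..β, (ω (star (dy 0) * dy (I * r))).re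
      ≤ ‖∫ r in (0 : ℝ)..β, ω (star (dy 0) * dy (I * r))‖ := by
    refine le_trans (le_of_eq ?_) (Complex.re_le_norm _)
    have hintg : IntervalIntegrable (fun r : ℝ => ω (star (dy 0) * dy (I * r))) volume 0 β :=
      Continuous.intervalIntegrable (by fun_prop) _ _
    exact Complex.reCLM.intervalIntegral_comp_comm hintg
  rw [n1, n2]
  have hpt : ∀ r ∈ Icc (0 : ℝ) β, ‖ω (star (x 0) * dy (I * r))‖ ≤
      (ε * ((ω (star (x 0) * x 0)).re + (ω (x 0 * star (x 0))).re)
        + ε⁻¹ * (ω (star (dy 0) * dy (I * r))).re) / 2 := fun r hr => by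
    -- With half of the imaginary time on each factor, Cauchy–Schwarz yields two diagonal terms.
    -- Undoing the split in each brings them back to imaginary time r.
    rw [hx.apply_star_mul hβ hK ho]
    refine (norm_apply_star_mul_le ω _ _ hε).trans ?_
    rw [← hx.apply_star_mul hβ hK hx, ← ho.apply_star_mul hβ hK ho]
    gcongr
    exact (Complex.re_le_norm _).trans (hx.norm_apply_star_mul_self_le hβ hK hr.1 hr.2)
  have hI : IntervalIntegrable (fun r : ℝ => (ω (star (dy 0) * dy (I * r))).re) volume 0 β :=
    Continuous.intervalIntegrable (by fun_prop) _ _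
  calc ‖∫ r in (0 : ℝ)..β, ω (star (x 0) * dy (I * r))‖
      ≤ ∫ r in (0 : ℝ)..β, ‖ω (star (x 0) * dy (I * r))‖ :=
        intervalIntegral.norm_integral_le_integral_norm hβ.le
    _ ≤ ∫ r in (0 : ℝ)..β, (ε * ((ω (star (x 0) * x 0)).re + (ω (x 0 * star (x 0))).re)
        + ε⁻¹ * (ω (star (dy 0) * dy (I * r))).re) / 2 :=
        intervalIntegral.integral_mono_on hβ.le (Continuous.intervalIntegrable (by fun_prop) _ _)
          (Continuous.intervalIntegrable (by fun_prop) _ _) hpt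
    _ = (ε * β * ((ω (star (x 0) * x 0)).re + (ω (x 0 * star (x 0))).re)
        + ε⁻¹ * ∫ r in (0 : ℝ)..β, (ω (star (dy 0) * dy (I * r))).re) / 2 := by
        rw [intervalIntegral.integral_div, intervalIntegral.integral_add (by simp)
          (hI.const_mul _), intervalIntegral.integral_const_mul]
        simp
        ring
    _ ≤ _ := by gcongr

end Dynamics

end ThermalQFT

namespace ThermalQFT

open Complex MeasureTheory Filter Set
open scoped ComplexConjugate

/-! ### Gaussian regularization -/

theorem hasDerivAt_gaussian (t : ℝ) (w : ℂ) :
    HasDerivAt (fun w : ℂ => cexp (-Real.pi * (t - w) ^ 2))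
      (2 * Real.pi * (t - w) * cexp (-Real.pi * (t - w) ^ 2)) w := by
  have h1 : HasDerivAt (fun w : ℂ => (t : ℂ) - w) (-1) w := by
    simpa using (hasDerivAt_id w).const_sub (t : ℂ)
  have h2 := (((h1.pow 2).const_mul (-Real.pi : ℂ)).cexp)
  convert! h2 using 1
  simp
  ring

theorem norm_gaussian_le {t m : ℝ} {w : ℂ} (hw : ‖w‖ ≤ m) :
    ‖cexp (-Real.pi * (t - w) ^ 2)‖ ≤ Real.exp (2 * Real.pi * m ^ 2) *
      Real.exp (-(Real.pi / 2) * t ^ 2) := by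
  rw [Complex.norm_exp, ← Real.exp_add]
  have hre : (-(Real.pi : ℂ) * (t - w) ^ 2).re = -Real.pi * ((t - w.re) ^ 2 - w.im ^ 2) := by
    simp [pow_two]
  rw [hre]
  refine Real.exp_le_exp.2 ?_
  have h1 : w.re ^ 2 + w.im ^ 2 ≤ m ^ 2 := by
    have := Complex.sq_norm w
    rw [Complex.normSq_apply] at this
    nlinarith [norm_nonneg w]
  have h2 : t ^ 2 / 2 - 2 * m ^ 2 ≤ (t - w.re) ^ 2 - w.im ^ 2 := by
    nlinarith [sq_nonneg (t - 2 * w.re), sq_nonneg w.im]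
  nlinarith [Real.pi_pos]

theorem integrable_gaussian_smul {E : Type*} [NormedAddCommGroup E] [NormedSpace ℂ E]
    {v : ℝ → E} (hv : Continuous v) {C : ℝ} (hC : ∀ t, ‖v t‖ ≤ C) (w : ℂ) :
    Integrable fun t : ℝ => cexp (-Real.pi * (t - w) ^ 2) • v t := by
  have hb : Integrable fun t : ℝ => Real.exp (2 * Real.pi * ‖w‖ ^ 2) *
      Real.exp (-(Real.pi / 2) * t ^ 2) * C :=
    ((integrable_exp_neg_mul_sq (by positivity)).const_mul _).mul_const _
  refine hb.mono' (Continuous.aestronglyMeasurable (by fun_prop)) (.of_forall fun t => ?_)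
  rw [norm_smul]
  exact mul_le_mul (norm_gaussian_le le_rfl) (hC t) (norm_nonneg _) (by positivity)

theorem differentiable_gaussian_convolution {E : Type*} [NormedAddCommGroup E]
    [NormedSpace ℂ E] {v : ℝ → E} (hv : Continuous v) {C : ℝ}
    (hC : ∀ t, ‖v t‖ ≤ C) :
    Differentiable ℂ fun w : ℂ => ∫ t : ℝ, cexp (-Real.pi * (t - w) ^ 2) • v t := by
  intro w₀
  set m := ‖w₀‖ + 1 with hm
  have hm0 : 0 ≤ m := by positivity
  -- The complex shift costs half of the Gaussian rate and the linear factor of the derivative is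
  -- absorbed in exp(t²). What remains is integrable because π/2 > 1.
  have hπ : 0 < Real.pi / 2 - 1 := by linarith [Real.pi_gt_three]
  set K := 2 * Real.pi * (1 + m) * Real.exp (2 * Real.pi * m ^ 2) with hK
  refine (hasDerivAt_integral_of_dominated_loc_of_deriv_le (𝕜 := ℂ)
    (F := fun w t => cexp (-Real.pi * (t - w) ^ 2) • v t)
    (F' := fun w t => (2 * Real.pi * (t - w) * cexp (-Real.pi * (t - w) ^ 2)) • v t)
    (bound := fun t => K * Real.exp (-(Real.pi / 2 - 1) * t ^ 2) * C)
    (Metric.ball_mem_nhds w₀ one_pos)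
    (.of_forall fun w => (integrable_gaussian_smul hv hC w).aestronglyMeasurable)
    (integrable_gaussian_smul hv hC w₀)
    (Continuous.aestronglyMeasurable (by fun_prop))
    (.of_forall fun t w hw => ?_)
    (((integrable_exp_neg_mul_sq hπ).const_mul _).mul_const _)
    (.of_forall fun t w _ => (hasDerivAt_gaussian t w).smul_const _)).2.differentiableAt
  have hwm : ‖w‖ ≤ m := by
    have := norm_le_norm_add_norm_sub w₀ w
    rw [mem_ball_iff_norm'] at hw
    linarith
  have h1 : ‖(t : ℂ) - w‖ ≤ (1 + m) * Real.exp (t ^ 2) := by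
    have h2 : ‖(t : ℂ) - w‖ ≤ |t| + m :=
      (norm_sub_le _ _).trans (add_le_add (by simp) hwm)
    have h3 : t ^ 2 + 1 ≤ Real.exp (t ^ 2) := Real.add_one_le_exp _
    have h4 : |t| ≤ t ^ 2 + 1 := by
      rw [← sq_abs]; nlinarith [sq_nonneg (|t| - 1), abs_nonneg t]
    nlinarith [sq_nonneg t]
  rw [norm_smul, norm_mul, norm_mul]
  have h2π : ‖(2 * Real.pi : ℂ)‖ = 2 * Real.pi := by
    rw [norm_mul, Complex.norm_two, Complex.norm_of_nonneg Real.pi_pos.le]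
  rw [h2π]
  have hC0 : 0 ≤ C := (norm_nonneg _).trans (hC t)
  calc 2 * Real.pi * ‖(t : ℂ) - w‖ * ‖cexp (-Real.pi * (t - w) ^ 2)‖ * ‖v t‖
      ≤ 2 * Real.pi * ((1 + m) * Real.exp (t ^ 2)) * (Real.exp (2 * Real.pi * m ^ 2) *
          Real.exp (-(Real.pi / 2) * t ^ 2)) * C := by
        gcongr
        · exact norm_gaussian_le hwm
        · exact hC t
    _ = K * (Real.exp (t ^ 2) * Real.exp (-(Real.pi / 2) * t ^ 2)) * C := by rw [hK]; ring
    _ = K * Real.exp (-(Real.pi / 2 - 1) * t ^ 2) * C := by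
        rw [← Real.exp_add]; ring_nf

/-! ### Gaussian means and the passage from entire orbits to all observables -/

section Dynamics

variable {A : Type u} [CStarAlgebra A] [PartialOrder A] [StarOrderedRing A] {s : ℕ}
  (N : LocalNet s A)

/-- The entire orbit through the Gaussian average of `t ↦ τ_t(a)` at scale `r`. -/
def gaussianOrbit (r : ℝ) (a : A) (z : ℂ) : A :=
  ∫ t : ℝ, cexp (-Real.pi * (t - z / r) ^ 2) • N.time (r * t) a

/-- Time evolution as a continuous linear map. -/
def timeCLM (t : ℝ) : A →L[ℂ] A :=
  ⟨(N.time t : A ≃⋆ₐ[ℂ] A).toAlgEquiv.toLinearEquiv.toLinearMap,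
      (StarAlgEquiv.isometry (N.time t)).continuous⟩

theorem timeCLM_apply (t : ℝ) (a : A) : timeCLM N t a = N.time t a := rfl

theorem integrable_gaussianOrbit (r : ℝ) (a : A) (z : ℂ) :
    Integrable fun t : ℝ => cexp (-Real.pi * (t - z / r) ^ 2) • N.time (r * t) a :=
  integrable_gaussian_smul ((N.continuous_time_apply a).comp (by fun_prop))
    (fun _ => (N.norm_time _ a).le) _

theorem isOrbit_gaussianOrbit {r : ℝ} (hr : r ≠ 0) (a : A) :
    IsOrbit N (gaussianOrbit N r a) where
  differentiable :=
    (differentiable_gaussian_convolution (v := fun t => N.time (r * t) a)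
      ((N.continuous_time_apply a).comp (by fun_prop)) (fun _ => (N.norm_time _ a).le)).comp
      (g := fun w : ℂ => ∫ t : ℝ, cexp (-Real.pi * (t - w) ^ 2) • N.time (r * t) a)
      (f := fun z : ℂ => z / r) (by fun_prop)
  time_apply t z := by
    have h1 := (timeCLM N t).integral_comp_comm (integrable_gaussianOrbit N r a z)
    simp only [map_smul, timeCLM_apply] at h1
    rw [gaussianOrbit, ← h1, gaussianOrbit]
    -- The substitution u ↦ u - t/r turns the automorphism under the integral into a shift of the
    -- Gaussian centre from z/r to (z + t)/r.
    rw [← integral_sub_right_eq_self _ (t / r)]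
    refine integral_congr_ae (.of_forall fun u => ?_)
    simp only
    rw [← N.time_add]
    have hr' : (r : ℂ) ≠ 0 := by exact_mod_cast hr
    congr 2
    · push_cast
      field_simp
      ring_nf
    · congr 1
      field_simp
      ring

theorem norm_gaussianOrbit_zero_le (r : ℝ) (a : A) : ‖gaussianOrbit N r a 0‖ ≤ 1 * ‖a‖ := by
  have hg := integral_gaussian Real.pi
  rw [div_self Real.pi_ne_zero, Real.sqrt_one] at hg
  rw [← hg, ← integral_mul_const]
  refine norm_integral_le_of_norm_le ((integrable_exp_neg_mul_sq Real.pi_pos).mul_const _)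
    (.of_forall fun t => ?_)
  rw [norm_smul, N.norm_time, Complex.norm_exp]
  refine le_of_eq ?_
  congr 2
  simp [pow_two]

/-- Gaussian averaging of the time evolution as a continuous linear map. -/
def gaussianMean (r : ℝ) : A →L[ℂ] A :=
  LinearMap.mkContinuous
    { toFun := fun a => gaussianOrbit N r a 0
      map_add' := fun a b => by
        rw [gaussianOrbit, gaussianOrbit, gaussianOrbit,
          ← integral_add (integrable_gaussianOrbit N r a 0) (integrable_gaussianOrbit N r b 0)]
        simp
      map_smul' := fun c a => by
        rw [gaussianOrbit, gaussianOrbit, RingHom.id_apply, ← integral_smul]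
        simp only [map_smul, smul_comm c] } 1
    (norm_gaussianOrbit_zero_le N r)

theorem gaussianMean_apply (r : ℝ) (a : A) : gaussianMean N r a = gaussianOrbit N r a 0 := rfl

/-- The scale sits in the time argument and the kernel is fixed with integral 1, so norm continuity
and dominated convergence suffice. -/
theorem tendsto_gaussianMean (a : A) :
    Tendsto (fun r => gaussianMean N r a) (𝓝[≠] 0) (𝓝 a) := by
  have hg : ∫ t : ℝ, cexp (-Real.pi * (t - (0 : ℂ)) ^ 2) • a = a := by
    rw [integral_smul_const]
    have h1 := integral_gaussian_complex (b := (Real.pi : ℂ)) (by simpa using Real.pi_pos)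
    rw [div_self (by exact_mod_cast Real.pi_ne_zero), one_cpow] at h1
    simp only [sub_zero, h1, one_smul]
  have h2 : Tendsto (fun r : ℝ => ∫ t : ℝ, cexp (-Real.pi * (t - (0 : ℂ)) ^ 2) •
      N.time (r * t) a) (𝓝[≠] 0) (𝓝 (∫ t : ℝ, cexp (-Real.pi * (t - (0 : ℂ)) ^ 2) • a)) := by
    refine tendsto_integral_filter_of_dominated_convergence
      (fun t => ‖cexp (-Real.pi * (t - (0 : ℂ)) ^ 2) • a‖) ?_ ?_ ?_ ?_
    · refine .of_forall fun r => Continuous.aestronglyMeasurable ?_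
      have := (N.continuous_time_apply a).comp (continuous_const_mul r)
      simp only [Function.comp_def] at this
      fun_prop
    · refine .of_forall fun r => .of_forall fun t => ?_
      rw [norm_smul, norm_smul, N.norm_time]
    · exact (integrable_gaussian_smul (v := fun _ : ℝ => a) continuous_const
        (fun _ => le_rfl) 0).norm
    · refine .of_forall fun t => ?_
      have h3 : Tendsto (fun r : ℝ => N.time (r * t) a) (𝓝 0) (𝓝 (N.time (0 * t) a)) :=
        ((N.continuous_time_apply a).comp (continuous_mul_const t)).tendsto 0
      rw [zero_mul, N.time_zero] at h3
      exact (h3.mono_left nhdsWithin_le_nhds).const_smul _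
  rw [hg] at h2
  refine h2.congr fun r => ?_
  rw [gaussianMean_apply, gaussianOrbit]
  simp

variable {N} {ω : A →ₚ[ℂ] ℂ} {β : ℝ}

/-- A KMS state is invariant under the time evolution. -/
theorem LocalNet.IsKMS.apply_time (hβ : 0 < β) (hK : N.IsKMS ω β) (t : ℝ) (a : A) :
    ω (N.time t a) = ω a := by
  have hω : Continuous ω := map_continuous ω
  have h1 : Tendsto (fun r => ω (gaussianMean N r a)) (𝓝[≠] 0) (𝓝 (ω a)) :=
    (hω.tendsto _).comp (tendsto_gaussianMean N a)
  have h2 : Tendsto (fun r => ω (N.time t (gaussianMean N r a))) (𝓝[≠] 0)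
      (𝓝 (ω (N.time t a))) :=
    ((hω.comp (timeCLM N t).continuous).tendsto _).comp (tendsto_gaussianMean N a)
  refine tendsto_nhds_unique (h2.congr' ?_) h1
  filter_upwards [self_mem_nhdsWithin] with r hr
  have ho := isOrbit_gaussianOrbit N (r := r) hr a
  rw [gaussianMean_apply, ho.time_apply]
  exact ho.apply_eq hβ hK _ _

/-- Averaging commutes with the time evolution, hence with differentiation. So b and its derivative
can be regularized at the same scale. -/
theorem deriv_gaussianOrbit {r : ℝ} (hr : r ≠ 0) {b b' : A}
    (hb : HasDerivAt (fun t : ℝ => N.time t b) b' 0) :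
    deriv (gaussianOrbit N r b) 0 = gaussianMean N r b' := by
  have ho := isOrbit_gaussianOrbit N hr b
  have h1 : HasDerivAt (fun t : ℝ => gaussianOrbit N r b t) (deriv (gaussianOrbit N r b) 0) 0 := by
    have := (ho.differentiable ((0 : ℝ) : ℂ)).hasDerivAt.scomp (0 : ℝ) Complex.ofRealCLM.hasDerivAt
    simpa [Function.comp_def] using this
  have h2 : HasDerivAt (fun t : ℝ => gaussianMean N r (N.time t b)) (gaussianMean N r b') 0 :=
    ((gaussianMean N r).restrictScalars ℝ).hasFDerivAt.comp_hasDerivAt 0 hb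
  refine h1.unique (h2.congr_of_eventuallyEq (.of_forall fun t => ?_))
  simp only
  rw [← zero_add (t : ℂ), ← ho.time_apply, gaussianMean_apply, gaussianOrbit, gaussianOrbit,
    ← timeCLM_apply, ← (timeCLM N t).integral_comp_comm (integrable_gaussianOrbit N r b 0)]
  refine integral_congr_ae (.of_forall fun u => ?_)
  simp only [map_smul, timeCLM_apply]
  rw [← N.time_add, ← N.time_add, add_comm]

/-- The Bogoliubov inequality for an observable `b` with a given time derivative. -/
theorem LocalNet.IsKMS.bogoliubov (hβ : 0 < β) (hK : N.IsKMS ω β) {b b' : A}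
    (hb : HasDerivAt (fun t : ℝ => N.time t b) b' 0) (a : A) {ε : ℝ} (hε : 0 < ε) :
    ‖ω (b * star a) - ω (star a * b)‖ ≤
      (ε * β * ((ω (star a * a)).re + (ω (a * star a)).re)
        + ε⁻¹ * ‖ω (b * star b') - ω (star b' * b)‖) / 2 := by
  have hω : Continuous ω := map_continuous ω
  set Φ : A × A × A → ℝ := fun p => ‖ω (p.2.1 * star p.1) - ω (star p.1 * p.2.1)‖
  set Ψ : A × A × A → ℝ := fun p => (ε * β * ((ω (star p.1 * p.1)).re + (ω (p.1 * star p.1)).re)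
        + ε⁻¹ * ‖ω (p.2.1 * star p.2.2) - ω (star p.2.2 * p.2.1)‖) / 2
  have hΦ : Continuous Φ := by fun_prop
  have hΨ : Continuous Ψ := by fun_prop
  -- Both sides of the inequality are norm continuous in the triple (a, b, b'), which is
  -- approximated by triples from entire orbits.
  have ht : Tendsto (fun r => (gaussianMean N r a, gaussianMean N r b, gaussianMean N r b'))
      (𝓝[≠] 0) (𝓝 (a, b, b')) :=
    (tendsto_gaussianMean N a).prodMk_nhds
      ((tendsto_gaussianMean N b).prodMk_nhds (tendsto_gaussianMean N b'))
  refine le_of_tendsto_of_tendsto ((hΦ.tendsto (a, b, b')).comp ht)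
    ((hΨ.tendsto (a, b, b')).comp ht) ?_
  filter_upwards [self_mem_nhdsWithin] with r hr
  have := (isOrbit_gaussianOrbit N hr a).bogoliubov hβ hK (isOrbit_gaussianOrbit N hr b) hε
  rw [deriv_gaussianOrbit hr hb] at this
  exact this

end Dynamics

end ThermalQFT

namespace ThermalQFT

open Complex MeasureTheory Filter Set
open scoped ComplexConjugate

/-! ### Self-adjoint operators affiliated to a von Neumann algebra -/

section Affiliated

variable {H : Type*} [NormedAddCommGroup H] [InnerProductSpace ℂ H] [CompleteSpace H]
  {T : H →ₗ.[ℂ] H}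

theorem inner_graph_symm (hT : IsSelfAdjoint T) {p q : H × H} (hp : p ∈ T.graph)
    (hq : q ∈ T.graph) : ⟪p.2, q.1⟫_ℂ = ⟪p.1, q.2⟫_ℂ := by
  have h1 : T.IsFormalAdjoint T := by
    have := LinearPMap.adjoint_isFormalAdjoint (T := T) hT.dense_domain
    rwa [LinearPMap.isSelfAdjoint_def.1 hT] at this
  rw [LinearPMap.mem_graph_iff] at hp hq
  obtain ⟨x, hx, hx'⟩ := hp
  obtain ⟨y, hy, hy'⟩ := hq
  rw [← hx, ← hx', ← hy, ← hy']
  exact h1 x y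

/-- The number ⟪Tx, x⟫ is real, so the cross term with ic x has no real part. This gives
injectivity, closed range and the norm of the resolvent. -/
theorem norm_sq_add_smul_graph (hT : IsSelfAdjoint T) {p : H × H} (hp : p ∈ T.graph) (c : ℝ) :
    ‖p.2 + (I * c) • p.1‖ ^ 2 = ‖p.2‖ ^ 2 + c ^ 2 * ‖p.1‖ ^ 2 := by
  have h1 := inner_graph_symm hT hp hp
  have h2 : (⟪p.2, p.1⟫_ℂ).im = 0 := by
    have h3 : (starRingEnd ℂ) ⟪p.2, p.1⟫_ℂ = ⟪p.2, p.1⟫_ℂ := by rw [inner_conj_symm, h1]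
    exact Complex.conj_eq_iff_im.1 h3
  have h4 := norm_add_sq (𝕜 := ℂ) p.2 ((I * c) • p.1)
  rw [h4, inner_smul_right, norm_smul]
  have h5 : RCLike.re ((I * c) * ⟪p.2, p.1⟫_ℂ) = 0 := by simp [h2]
  rw [h5]
  simp [mul_pow]

theorem eq_zero_of_graph_eigen (hT : IsSelfAdjoint T) {c : ℝ} (hc : c ≠ 0) {x : H}
    (hx : (x, -((I * c) • x)) ∈ T.graph) : x = 0 := by
  have h1 := norm_sq_add_smul_graph hT hx c
  simp only [neg_add_cancel, norm_zero, norm_neg] at h1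
  have h2 : 0 < c ^ 2 := by positivity
  have h3 : ‖x‖ ^ 2 = 0 := by
    nlinarith [sq_nonneg ‖x‖, sq_nonneg ‖(I * c) • x‖]
  simpa using h3

/-- The resolvent of a self-adjoint operator at a non-zero imaginary point. -/
theorem exists_resolvent (hT : IsSelfAdjoint T) {c : ℝ} (hc : c ≠ 0) :
    ∃ R : H →L[ℂ] H, (∀ y, (R y, y - (I * c) • R y) ∈ T.graph) ∧
      ∀ y, ‖R y‖ ≤ |c|⁻¹ * ‖y‖ := by
  have hcl : IsClosed (T.graph : Set (H × H)) := hT.isClosed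
  have : CompleteSpace T.graph := hcl.completeSpace_coe
  -- T + ic, viewed as a bounded operator on the complete space `T.graph`.
  let Φ : T.graph →L[ℂ] H :=
    (ContinuousLinearMap.snd ℂ H H + (I * c) • ContinuousLinearMap.fst ℂ H H) ∘L T.graph.subtypeL
  have hΦ : ∀ p : T.graph, Φ p = (p : H × H).2 + (I * c) • (p : H × H).1 := fun p => rfl
  have hnorm : ∀ p : T.graph, ‖Φ p‖ ^ 2 = ‖(p : H × H).2‖ ^ 2 + c ^ 2 * ‖(p : H × H).1‖ ^ 2 :=
    fun p => by rw [hΦ]; exact norm_sq_add_smul_graph hT p.2 c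
  have hfst : ∀ p : T.graph, ‖(p : H × H).1‖ ≤ |c|⁻¹ * ‖Φ p‖ := fun p => by
    rw [inv_mul_eq_div, le_div_iff₀ (by positivity)]
    refine (sq_le_sq₀ (by positivity) (norm_nonneg _)).1 ?_
    rw [hnorm, mul_pow, sq_abs]
    nlinarith [sq_nonneg ‖(p : H × H).2‖]
  have hsnd : ∀ p : T.graph, ‖(p : H × H).2‖ ≤ ‖Φ p‖ := fun p => by
    refine (sq_le_sq₀ (norm_nonneg _) (norm_nonneg _)).1 ?_
    rw [hnorm]
    nlinarith [sq_nonneg (c * ‖(p : H × H).1‖)]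
  have hanti : AntilipschitzWith (Real.toNNReal (|c|⁻¹ + 1)) Φ := by
    refine Φ.antilipschitz_of_bound fun p => ?_
    rw [Real.coe_toNNReal _ (by positivity)]
    rw [Submodule.coe_norm, Prod.norm_def]
    have := hfst p
    have h2 := hsnd p
    have h3 : 0 ≤ |c|⁻¹ * ‖Φ p‖ := by positivity
    refine max_le ?_ ?_ <;> linarith [norm_nonneg (Φ p)]
  have hrc : IsClosed (Φ.range : Set H) := by
    exact hanti.isClosed_range Φ.uniformContinuous
  have hrange : Φ.range = ⊤ := by
    have : CompleteSpace Φ.range := hrc.completeSpace_coe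
    rw [← Submodule.orthogonal_eq_bot_iff, eq_bot_iff]
    intro z hz
    rw [Submodule.mem_orthogonal] at hz
    -- A vector orthogonal to the range is an eigenvector of T* = T with eigenvalue ic, hence zero.
    have h1 : (z, (I * c) • z) ∈ T.graph := by
      have hz' : ∀ x : T.domain, ⟪(I * c) • z, (x : H)⟫_ℂ = ⟪z, T x⟫_ℂ := fun x => by
        have h2 := hz (Φ ⟨((x : H), T x), T.mem_graph x⟩) ⟨_, rfl⟩
        rw [hΦ, ← inner_conj_symm, map_eq_zero, inner_add_right, inner_smul_right] at h2
        rw [inner_smul_left]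
        simp only [map_mul, conj_I, conj_ofReal]
        linear_combination -h2
      have hm := LinearPMap.mem_adjoint_domain_of_exists (T := T) z ⟨_, hz'⟩
      have he := LinearPMap.adjoint_apply_eq hT.dense_domain ⟨z, hm⟩ hz'
      have hg : (z, (I * c) • z) ∈ T.adjoint.graph := by
        rw [← he]
        exact T.adjoint.mem_graph ⟨z, hm⟩
      rwa [LinearPMap.isSelfAdjoint_def.1 hT] at hg
    refine eq_zero_of_graph_eigen hT (neg_ne_zero.2 hc) (x := z) ?_
    simpa using h1
  let e : T.graph ≃ₗ[ℂ] H := LinearEquiv.ofBijective Φ.toLinearMap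
    ⟨hanti.injective, by
      rw [← LinearMap.range_eq_top]; exact hrange⟩
  have he : ∀ y, Φ (e.symm y) = y := fun y => e.apply_symm_apply y
  refine ⟨LinearMap.mkContinuous (LinearMap.fst ℂ H H ∘ₗ T.graph.subtype ∘ₗ e.symm.toLinearMap)
    |c|⁻¹ (fun y => ?_), fun y => ?_, fun y => ?_⟩
  · simpa [he] using hfst (e.symm y)
  · have h1 := he y
    rw [hΦ] at h1
    have h2 : y - (I * c) • (e.symm y : H × H).1 = (e.symm y : H × H).2 := by
      exact (eq_sub_of_add_eq h1).symm
    simp only [LinearMap.mkContinuous_apply, LinearMap.coe_comp, Function.comp_apply,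
      LinearEquiv.coe_coe, Submodule.subtype_apply, LinearMap.fst_apply]
    rw [h2]
    exact (e.symm y).2
  · simpa [he] using hfst (e.symm y)

theorem resolvent_apply_eq (hT : IsSelfAdjoint T) {c : ℝ} (hc : c ≠ 0) {R : H →L[ℂ] H}
    (hR : ∀ y, (R y, y - (I * c) • R y) ∈ T.graph) {x z y : H} (hx : (x, z) ∈ T.graph)
    (hy : z + (I * c) • x = y) : R y = x := by
  have h1 := T.graph.sub_mem (hR y) hx
  rw [← sub_eq_zero]
  refine eq_zero_of_graph_eigen hT hc ?_
  convert h1 using 1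
  rw [← hy, Prod.mk_sub_mk, smul_sub]
  congr 1
  abel

/-- On the domain, ic R(c)u = u - R(c)Tu with R(c) = O(1/|c|). The operators ic R(c) are
contractions, so convergence extends from the dense domain. -/
theorem tendsto_smul_resolvent (hT : IsSelfAdjoint T) {R : ℝ → H →L[ℂ] H}
    (hR : ∀ c, c ≠ 0 → ∀ y, (R c y, y - (I * c) • R c y) ∈ T.graph)
    (hb : ∀ c, c ≠ 0 → ∀ y, ‖R c y‖ ≤ |c|⁻¹ * ‖y‖) {l : Filter ℝ} (hl : Tendsto abs l atTop)
    (v : H) : Tendsto (fun c : ℝ => (I * c) • R c v) l (𝓝 v) := by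
  rw [Metric.tendsto_nhds]
  intro ε hε
  obtain ⟨u, hu, huv⟩ := Metric.mem_closure_iff.1 (hT.dense_domain v) (ε / 4) (by positivity)
  set w := T ⟨u, hu⟩
  have hg : (u, w) ∈ T.graph := T.mem_graph ⟨u, hu⟩
  filter_upwards [hl.eventually_gt_atTop (4 * ‖w‖ / ε), hl.eventually_gt_atTop 0] with c hc hc0
  have hcne : c ≠ 0 := abs_pos.1 hc0
  have h1 : (I * c) • R c u = u - R c w := by
    have := resolvent_apply_eq hT hcne (hR c hcne) hg rfl
    rw [map_add, map_smul] at this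
    exact eq_sub_of_add_eq' this
  have h2 : (I * c) • R c v - v = (I * c) • R c (v - u) - R c w - (v - u) := by
    rw [map_sub, smul_sub, h1]; abel
  have hIc : ‖(I * c : ℂ)‖ = |c| := by simp
  have h3 : ‖(I * c) • R c (v - u)‖ ≤ ‖v - u‖ := by
    rw [norm_smul, hIc]
    calc |c| * ‖R c (v - u)‖ ≤ |c| * (|c|⁻¹ * ‖v - u‖) := by gcongr; exact hb c hcne _
      _ = ‖v - u‖ := by field_simp
  have h4 : ‖R c w‖ ≤ ε / 4 := by
    refine (hb c hcne w).trans ?_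
    rw [inv_mul_le_iff₀ hc0]
    rw [div_lt_iff₀ hε] at hc
    linarith
  rw [dist_eq_norm] at huv ⊢
  rw [h2]
  have h5 := norm_sub_le ((I * c) • R c (v - u) - R c w) (v - u)
  have h6 := norm_sub_le ((I * c) • R c (v - u)) (R c w)
  linarith

/-- A self-adjoint operator is approximated on its domain by bounded symmetric operators commuting
with everything that commutes with it. -/
theorem exists_bounded_approximation (hT : IsSelfAdjoint T) {x v : H} (hx : (x, v) ∈ T.graph) :
    ∃ S : ℕ → H →L[ℂ] H, (∀ n y z, ⟪S n y, z⟫_ℂ = ⟪y, S n z⟫_ℂ) ∧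
      (∀ n (B : H →L[ℂ] H), (∀ p ∈ T.graph, (B p.1, B p.2) ∈ T.graph) →
        S n * B = B * S n) ∧ Tendsto (fun n => S n x) atTop (𝓝 v) := by
  have hex : ∀ c : ℝ, ∃ R : H →L[ℂ] H, c ≠ 0 → (∀ y, (R y, y - (I * c) • R y) ∈ T.graph) ∧
      ∀ y, ‖R y‖ ≤ |c|⁻¹ * ‖y‖ := fun c => by
    by_cases hc : c = 0
    · exact ⟨0, fun h => absurd hc h⟩
    · obtain ⟨R, h⟩ := exists_resolvent hT hc
      exact ⟨R, fun _ => h⟩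
  choose R hR using hex
  have hgr := fun c hc => (hR c hc).1
  have hbd := fun c hc => (hR c hc).2
  have hadj : ∀ c, c ≠ 0 → ∀ y z, ⟪R c y, z⟫_ℂ = ⟪y, R (-c) z⟫_ℂ := fun c hc y z => by
    have h1 := inner_graph_symm hT (hgr c hc y) (hgr (-c) (neg_ne_zero.2 hc) z)
    simp only [inner_sub_left, inner_sub_right, inner_smul_left, inner_smul_right, map_mul,
      conj_I, conj_ofReal, ofReal_neg] at h1
    linear_combination -h1
  have hcomm : ∀ c, c ≠ 0 → ∀ B : H →L[ℂ] H, (∀ p ∈ T.graph, (B p.1, B p.2) ∈ T.graph) →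
      R c * B = B * R c := fun c hc B hB => by
    ext y
    refine resolvent_apply_eq hT hc (hgr c hc) (hB _ (hgr c hc y)) ?_
    simp
  let k : ℕ → ℝ := fun n => n + 1
  have hk : ∀ n, k n ≠ 0 := fun n => by positivity
  -- With R(k) = (T + ik)⁻¹ this is k² T (T² + k²)⁻¹: symmetric, because R(k)* = R(-k), and tending
  -- to T as k → ∞.
  refine ⟨fun n => ((k n ^ 2 / 2 : ℝ) : ℂ) • (R (k n) + R (-k n)), fun n y z => ?_,
    fun n B hB => ?_, ?_⟩
  · have h1 := hadj _ (hk n) y z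
    have h2 := hadj _ (neg_ne_zero.2 (hk n)) y z
    rw [neg_neg] at h2
    simp only [smul_apply, add_apply, inner_smul_left,
      inner_smul_right, inner_add_left, inner_add_right, h1, h2, conj_ofReal]
    ring
  · rw [smul_mul_assoc, mul_smul_comm, add_mul, mul_add, hcomm _ (hk n) B hB,
      hcomm _ (neg_ne_zero.2 (hk n)) B hB]
  · have hkt : Tendsto k atTop atTop := tendsto_atTop_add_const_right _ _ tendsto_natCast_atTop_atTop
    have t1 : Tendsto (fun n => (I * k n) • R (k n) v) atTop (𝓝 v) :=
      (tendsto_smul_resolvent hT hgr hbd tendsto_abs_atTop_atTop v).comp hkt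
    have t2 : Tendsto (fun n => (I * (-k n : ℝ)) • R (-k n) v) atTop (𝓝 v) :=
      (tendsto_smul_resolvent hT hgr hbd tendsto_abs_atBot_atTop v).comp
        (tendsto_neg_atTop_atBot.comp hkt)
    have t3 := (t1.add t2).const_smul ((1 / 2 : ℂ))
    have hv : (1 / 2 : ℂ) • (v + v) = v := by
      rw [← two_smul ℂ v, smul_smul]; norm_num
    rw [hv] at t3
    refine t3.congr fun n => ?_
    have e1 : R (k n) v = x - (I * k n) • R (k n) x := by
      have := resolvent_apply_eq hT (hk n) (hgr _ (hk n)) hx rfl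
      rw [map_add, map_smul] at this
      exact eq_sub_of_add_eq this
    have e2 : R (-k n) v = x - (I * (-k n : ℝ)) • R (-k n) x := by
      have := resolvent_apply_eq hT (neg_ne_zero.2 (hk n)) (hgr _ (neg_ne_zero.2 (hk n))) hx rfl
      rw [map_add, map_smul] at this
      exact eq_sub_of_add_eq this
    rw [e1, e2]
    simp only [smul_apply, add_apply, smul_sub, smul_add,
      smul_smul]
    have i1 : (1 / 2 : ℂ) * (I * k n * (I * k n)) = -((k n ^ 2 / 2 : ℝ) : ℂ) := by
      push_cast; linear_combination (1 / 2 : ℂ) * k n ^ 2 * I_mul_I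
    have i2 : (1 / 2 : ℂ) * (I * (-k n : ℝ) * (I * (-k n : ℝ))) = -((k n ^ 2 / 2 : ℝ) : ℂ) := by
      push_cast; linear_combination (1 / 2 : ℂ) * k n ^ 2 * I_mul_I
    have i3 : (1 / 2 : ℂ) * (I * (-k n : ℝ)) = -((1 / 2 : ℂ) * (I * k n)) := by push_cast; ring
    rw [i1, i2, i3]
    simp only [neg_smul]
    abel

end Affiliated

end ThermalQFT

namespace ThermalQFT

open Complex MeasureTheory Filter Set
open scoped ComplexConjugate

/-! ### The bicommutant argument on H ⊕ H -/

section Affiliated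

variable {H : Type*} [NormedAddCommGroup H] [InnerProductSpace ℂ H] [CompleteSpace H]
  {T : H →ₗ.[ℂ] H}

/-- The diagonal action on `H ⊕ H`. -/
def diagonal (B : H →L[ℂ] H) : WithLp 2 (H × H) →L[ℂ] WithLp 2 (H × H) :=
  (WithLp.prodContinuousLinearEquiv 2 ℂ H H).symm.toContinuousLinearMap ∘L
    (B.prodMap B) ∘L (WithLp.prodContinuousLinearEquiv 2 ℂ H H).toContinuousLinearMap

theorem inner_diagonal (B : H →L[ℂ] H) (p r : WithLp 2 (H × H)) :
    ⟪diagonal B p, r⟫_ℂ = ⟪p, diagonal (star B) r⟫_ℂ := by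
  simp only [WithLp.prod_inner_apply]
  change ⟪B p.fst, r.fst⟫_ℂ + ⟪B p.snd, r.snd⟫_ℂ
    = ⟪p.fst, star B r.fst⟫_ℂ + ⟪p.snd, star B r.snd⟫_ℂ
  simp [ContinuousLinearMap.star_eq_adjoint, ContinuousLinearMap.adjoint_inner_right]

/-- Write P as a 2 × 2 matrix. Each entry commutes with every C whose diagonal action commutes with
P, so S commutes with all four entries. -/
theorem diagonal_comm_of_entries (P : WithLp 2 (H × H) →L[ℂ] WithLp 2 (H × H)) (S : H →L[ℂ] H)
    (h : ∀ B : H →L[ℂ] H,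
      (∀ C : H →L[ℂ] H, (∀ p, diagonal C (P p) = P (diagonal C p)) → C * B = B * C) →
      S * B = B * S) (p : WithLp 2 (H × H)) : diagonal S (P p) = P (diagonal S p) := by
  let e := (WithLp.prodContinuousLinearEquiv 2 ℂ H H)
  let i₁ : H →L[ℂ] WithLp 2 (H × H) := e.symm.toContinuousLinearMap ∘L ContinuousLinearMap.inl ℂ H H
  let i₂ : H →L[ℂ] WithLp 2 (H × H) := e.symm.toContinuousLinearMap ∘L ContinuousLinearMap.inr ℂ H H
  let p₁ : WithLp 2 (H × H) →L[ℂ] H := ContinuousLinearMap.fst ℂ H H ∘L e.toContinuousLinearMap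
  let p₂ : WithLp 2 (H × H) →L[ℂ] H := ContinuousLinearMap.snd ℂ H H ∘L e.toContinuousLinearMap
  have hi₁ : ∀ (C : H →L[ℂ] H) u, i₁ (C u) = diagonal C (i₁ u) := fun C u => by
    apply e.injective; ext <;> simp [i₁, e, diagonal]
  have hi₂ : ∀ (C : H →L[ℂ] H) u, i₂ (C u) = diagonal C (i₂ u) := fun C u => by
    apply e.injective; ext <;> simp [i₂, e, diagonal]
  have hp₁ : ∀ (C : H →L[ℂ] H) q, p₁ (diagonal C q) = C (p₁ q) := fun C q => rfl
  have hp₂ : ∀ (C : H →L[ℂ] H) q, p₂ (diagonal C q) = C (p₂ q) := fun C q => rfl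
  have hsum : ∀ q, q = i₁ (p₁ q) + i₂ (p₂ q) := fun q => by
    apply e.injective; ext <;> simp [i₁, i₂, p₁, p₂]
  have key : ∀ (i : H →L[ℂ] WithLp 2 (H × H)) (q : WithLp 2 (H × H) →L[ℂ] H),
      (∀ (C : H →L[ℂ] H) u, i (C u) = diagonal C (i u)) →
      (∀ (C : H →L[ℂ] H) r, q (diagonal C r) = C (q r)) →
      ∀ u, S (q (P (i u))) = q (P (i (S u))) := fun i q hi hq u => by
    have := h (q ∘L P ∘L i) fun C hC => by
      ext u
      simp only [mul_apply_eq_comp, ContinuousLinearMap.comp_apply]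
      rw [← hq, hC, hi]
    exact congrArg (fun F : H →L[ℂ] H => F u) this
  have hfin : ∀ q : WithLp 2 (H × H) →L[ℂ] H,
      (∀ (C : H →L[ℂ] H) r, q (diagonal C r) = C (q r)) →
      q (diagonal S (P p)) = q (P (diagonal S p)) := fun q hq => by
    rw [hq]
    conv_lhs => rw [hsum p]
    conv_rhs => rw [hsum (diagonal S p)]
    simp only [map_add]
    rw [key i₁ q hi₁ hq, key i₂ q hi₂ hq, hp₁, hp₂]
  rw [hsum (diagonal S (P p)), hsum (P (diagonal S p)), hfin p₁ hp₁, hfin p₂ hp₂]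

/-- An operator in the bicommutant of a `*`-algebra lies in its weak closure, tested on two pairs
of vectors. -/
theorem inner_add_inner_eq_zero_of_bicommutant (𝓑 : StarSubalgebra ℂ (H →L[ℂ] H))
    {S : H →L[ℂ] H} (hS : ∀ B ∈ Set.centralizer (𝓑 : Set (H →L[ℂ] H)), S * B = B * S)
    {x y x' y' : H} (h : ∀ b ∈ 𝓑, ⟪x', b x⟫_ℂ + ⟪y', b y⟫_ℂ = 0) :
    ⟪x', S x⟫_ℂ + ⟪y', S y⟫_ℂ = 0 := by
  let v : WithLp 2 (H × H) := WithLp.toLp 2 (x, y)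
  let v' : WithLp 2 (H × H) := WithLp.toLp 2 (x', y')
  let V : Submodule ℂ (WithLp 2 (H × H)) :=
    { carrier := {p | ∃ b ∈ 𝓑, p = diagonal b v}
      add_mem' := by
        rintro _ _ ⟨b, hb, rfl⟩ ⟨c, hc, rfl⟩
        exact ⟨b + c, add_mem hb hc, rfl⟩
      zero_mem' := ⟨0, zero_mem _, rfl⟩
      smul_mem' := by
        rintro r _ ⟨b, hb, rfl⟩
        exact ⟨r • b, SMulMemClass.smul_mem r hb, rfl⟩ }
  let W := V.topologicalClosure
  have hDW : ∀ b ∈ 𝓑, ∀ p ∈ W, diagonal b p ∈ W := fun b hb p hp =>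
    map_mem_closure (diagonal b).continuous hp (by
      rintro _ ⟨c, hc, rfl⟩
      exact ⟨b * c, mul_mem hb hc, rfl⟩)
  have hDO : ∀ b ∈ 𝓑, ∀ p ∈ Wᗮ, diagonal b p ∈ Wᗮ := fun b hb p hp => by
    rw [Submodule.mem_orthogonal'] at hp ⊢
    intro q hq
    rw [inner_diagonal]
    exact hp _ (hDW _ (star_mem hb) q hq)
  have : CompleteSpace W := V.isClosed_topologicalClosure.completeSpace_coe
  -- The projection onto the closure of 𝓑(x, y) commutes with the diagonal action of 𝓑, hence with
  -- that of S. So (Sx, Sy) stays in the closure, to which (x', y') is orthogonal.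
  let P := W.starProjection
  have hcomm : ∀ b ∈ 𝓑, ∀ p, diagonal b (P p) = P (diagonal b p) := fun b hb p => by
    symm
    refine Submodule.eq_starProjection_of_mem_of_inner_eq_zero
      (hDW b hb _ (Submodule.starProjection_apply_mem _ _)) fun w hw => ?_
    rw [← map_sub]
    exact (Submodule.mem_orthogonal' _ _).1
      (hDO b hb _ (Submodule.sub_starProjection_mem_orthogonal p)) w hw
  have hSP := diagonal_comm_of_entries P S (fun B hB => hS B fun b hb => hB b (hcomm b hb)) v
  have hvW : v ∈ W := V.le_topologicalClosure ⟨1, one_mem _, rfl⟩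
  have hPv : P v = v := Submodule.starProjection_eq_self_iff.2 hvW
  rw [hPv] at hSP
  have hSv : diagonal S v ∈ W := by
    rw [hSP]; exact Submodule.starProjection_apply_mem _ _
  have hv' : v' ∈ Wᗮ := by
    rw [Submodule.mem_orthogonal']
    intro w hw
    have hcl : IsClosed {w | ⟪v', w⟫_ℂ = 0} := isClosed_eq (by fun_prop) continuous_const
    refine closure_minimal (t := {w | ⟪v', w⟫_ℂ = 0}) ?_ hcl hw
    rintro _ ⟨b, hb, rfl⟩
    simp only [mem_ofPred_eq, WithLp.prod_inner_apply]
    exact h b hb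
  have := (Submodule.mem_orthogonal' _ _).1 hv' _ hSv
  rw [WithLp.prod_inner_apply] at this
  exact this

/-- If `T` is self-adjoint and commutes with the commutant of the `*`-algebra `𝓑`, then `T x` is a
limit of vectors `b x` with `b ∈ 𝓑` self-adjoint. -/
theorem mem_closure_of_commutes_commutant (𝓑 : StarSubalgebra ℂ (H →L[ℂ] H))
    (hT : IsSelfAdjoint T)
    (hcomm : ∀ B ∈ Set.centralizer (𝓑 : Set (H →L[ℂ] H)), ∀ p ∈ T.graph, (B p.1, B p.2) ∈ T.graph)
    {x v : H} (hx : (x, v) ∈ T.graph) :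
    v ∈ closure {w | ∃ b ∈ 𝓑, star b = b ∧ w = b x} := by
  let _ : InnerProductSpace ℝ H := InnerProductSpace.complexToReal
  let V : Submodule ℝ H :=
    { carrier := {w | ∃ b ∈ 𝓑, star b = b ∧ w = b x}
      add_mem' := by
        rintro _ _ ⟨b, hb, hb', rfl⟩ ⟨c, hc, hc', rfl⟩
        exact ⟨b + c, add_mem hb hc, by rw [star_add, hb', hc'], rfl⟩
      zero_mem' := ⟨0, zero_mem _, star_zero _, rfl⟩
      smul_mem' := by
        rintro r _ ⟨b, hb, hb', rfl⟩
        refine ⟨(r : ℂ) • b, SMulMemClass.smul_mem _ hb, by simp [hb'], ?_⟩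
        simp }
  -- Self-adjoint elements form only a real subspace, so closures are computed by orthogonality for
  -- the real part of the inner product.
  suffices hv : v ∈ Vᗮᗮ by
    rw [Submodule.orthogonal_orthogonal_eq_closure] at hv
    exact hv
  rw [Submodule.mem_orthogonal]
  intro y hy
  rw [Submodule.mem_orthogonal'] at hy
  have h1 : ∀ b ∈ 𝓑, star b = b → (⟪y, b x⟫_ℂ).re = 0 := fun b hb hb' => by
    have := hy (b x) ⟨b, hb, hb', rfl⟩
    rwa [real_inner_eq_re_inner ℂ] at this
  have hadj : ∀ (b : H →L[ℂ] H) (u w : H), ⟪u, b w⟫_ℂ = conj ⟪w, star b u⟫_ℂ := fun b u w => by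
    rw [inner_conj_symm, ContinuousLinearMap.star_eq_adjoint,
      ContinuousLinearMap.adjoint_inner_left]
  -- For self-adjoint b, real orthogonality becomes a relation that is complex linear in b. It
  -- therefore extends to all of 𝓑 and then to its bicommutant, where the bounded approximants of T
  -- lie; this is why two pairs of vectors are needed.
  have h2 : ∀ b ∈ 𝓑, star b = b → ⟪y, b x⟫_ℂ + ⟪x, b y⟫_ℂ = 0 := fun b hb hb' => by
    rw [hadj b x y, hb']
    rw [Complex.add_conj, h1 b hb hb']
    simp
  have h3 : ∀ b ∈ 𝓑, ⟪y, b x⟫_ℂ + ⟪x, b y⟫_ℂ = 0 := fun b hb => by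
    have e1 := h2 (b + star b) (add_mem hb (star_mem hb)) (by simp [add_comm])
    have e2 := h2 (I • (b - star b)) (SMulMemClass.smul_mem _ (sub_mem hb (star_mem hb))) (by
      rw [star_smul, star_sub, star_star, Complex.star_def, conj_I, neg_smul, ← smul_neg,
        neg_sub])
    simp only [add_apply, sub_apply, smul_apply, inner_add_right, inner_sub_right,
      inner_smul_right] at e1 e2
    have e3 : I * ((⟪y, b x⟫_ℂ - ⟪y, star b x⟫_ℂ) + (⟪x, b y⟫_ℂ - ⟪x, star b y⟫_ℂ)) = 0 := by
      linear_combination e2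
    have e4 := (mul_eq_zero.1 e3).resolve_left I_ne_zero
    linear_combination (e1 + e4) / 2
  obtain ⟨S, hsym, hSc, hSt⟩ := exists_bounded_approximation hT hx
  have h4 : ∀ n, (⟪y, S n x⟫_ℂ).re = 0 := fun n => by
    have := inner_add_inner_eq_zero_of_bicommutant 𝓑 (S := S n)
      (fun B hB => hSc n B (hcomm B hB)) h3
    rw [← hsym n x y, ← inner_conj_symm (S n x) y, Complex.add_conj] at this
    have h5 := congrArg Complex.re this
    simpa using h5
  rw [real_inner_eq_re_inner ℂ]
  have ht : Tendsto (fun n => (⟪y, S n x⟫_ℂ).re) atTop (𝓝 (⟪y, v⟫_ℂ).re) :=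
    (Complex.continuous_re.tendsto _).comp (Tendsto.inner tendsto_const_nhds hSt)
  simp only [h4] at ht
  exact (tendsto_nhds_unique ht tendsto_const_nhds)

end Affiliated

/-! ### The vectors T Ω of affiliated operators -/

section GNS

variable {A : Type u} [CStarAlgebra A] [PartialOrder A] [StarOrderedRing A]
  {ω : A →ₚ[ℂ] ℂ}

/-- The vector `T Ω_ω` of a self-adjoint operator affiliated to `π_ω(B)''` is a limit of vectors
`π_ω(a) Ω_ω` with `a ∈ B` self-adjoint. -/
theorem mem_closure_of_affiliated {B : StarSubalgebra ℂ A} {T : ω.GNS →ₗ.[ℂ] ω.GNS}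
    (hT : IsSelfAdjoint T) (haff : Affiliated T (gnsClosure ω B))
    (hΩ : gnsVec ω ∈ T.domain) :
    T ⟨gnsVec ω, hΩ⟩ ∈ closure {w | ∃ a ∈ B, star a = a ∧ w = ω.gnsStarAlgHom a (gnsVec ω)} := by
  have h := mem_closure_of_commutes_commutant (B.map ω.gnsStarAlgHom) hT ?_
    (T.mem_graph ⟨gnsVec ω, hΩ⟩)
  · refine closure_mono ?_ h
    rintro _ ⟨_, ⟨a, ha, rfl⟩, hb', rfl⟩
    -- Only π(a) is known to be self-adjoint; passing to the real part of a does not change π(a).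
    refine ⟨(1 / 2 : ℂ) • (a + star a), SMulMemClass.smul_mem _ (add_mem ha (star_mem ha)), ?_, ?_⟩
    · rw [star_smul, star_add, star_star, add_comm]
      simp
    · have hb2 : star (ω.gnsStarAlgHom a) = ω.gnsStarAlgHom a := hb'
      rw [map_smul, map_add, map_star, hb2, ← two_smul ℂ, smul_smul]
      norm_num
  · intro C hC p hp
    obtain ⟨x, hx1, hx2⟩ := (T.mem_graph_iff).1 hp
    obtain ⟨hm, he⟩ := haff.2 C (by
      rw [VonNeumannAlgebra.mem_commutant_iff]
      intro g hg
      have hg' : g ∈ StarSubalgebra.centralizer ℂ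
        (StarSubalgebra.centralizer ℂ (ω.gnsStarAlgHom '' (B : Set A)) :
          Set (ω.GNS →L[ℂ] ω.GNS)) := hg
      refine ((StarSubalgebra.mem_centralizer_iff ℂ).1 hg' C ?_).1.symm
      refine (StarSubalgebra.mem_centralizer_iff ℂ).2 fun b hb => ⟨hC b hb, hC _ ?_⟩
      exact star_mem (S := StarSubalgebra ℂ (ω.GNS →L[ℂ] ω.GNS))
        (s := B.map ω.gnsStarAlgHom) hb) x
    rw [← hx1, ← hx2, ← he]
    exact T.mem_graph ⟨C x, hm⟩

end GNS

end ThermalQFT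

namespace ThermalQFT

open Complex MeasureTheory Filter Set
open scoped ComplexConjugate

/-! ### The Bogoliubov inequality in the GNS representation -/

section Hilbert

variable {H : Type*} [NormedAddCommGroup H] [InnerProductSpace ℂ H] [CompleteSpace H]

theorem inner_intervalIntegral (w : H) {f : ℝ → H} (hf : Continuous f) (a b : ℝ) :
    ⟪w, ∫ t in a..b, f t⟫_ℂ = ∫ t in a..b, ⟪w, f t⟫_ℂ :=
  ((innerSL ℂ w).intervalIntegral_comp_comm (hf.intervalIntegrable a b)).symm

theorem intervalIntegral_inner (w : H) {f : ℝ → H} (hf : Continuous f) (a b : ℝ) :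
    ⟪∫ t in a..b, f t, w⟫_ℂ = ∫ t in a..b, ⟪f t, w⟫_ℂ := by
  have h1 : Continuous fun t => ⟪w, f t⟫_ℂ := by fun_prop
  rw [← inner_conj_symm, inner_intervalIntegral w hf]
  have := (Complex.conjCLE.toContinuousLinearMap).intervalIntegral_comp_comm
    (h1.intervalIntegrable (μ := volume) a b)
  simp only [ContinuousLinearEquiv.coe_coe, Complex.conjCLE_apply, inner_conj_symm] at this
  exact this.symm

end Hilbert

section GNS

variable {A : Type u} [CStarAlgebra A] [PartialOrder A] [StarOrderedRing A] {s : ℕ}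
  {N : LocalNet s A} {ω : A →ₚ[ℂ] ℂ}

theorem gnsStarAlgHom_gnsVec (a : A) :
    ω.gnsStarAlgHom a (gnsVec ω) = ((ω.toPreGNS a : ω.PreGNS) : ω.GNS) := by
  simp [gnsVec]

theorem inner_gnsStarAlgHom_gnsVec (a b : A) :
    ⟪ω.gnsStarAlgHom a (gnsVec ω), ω.gnsStarAlgHom b (gnsVec ω)⟫_ℂ = ω (star a * b) := by
  rw [gnsStarAlgHom_gnsVec, gnsStarAlgHom_gnsVec, UniformSpace.Completion.inner_coe,
    ω.preGNS_inner_def, ω.ofPreGNS_toPreGNS, ω.ofPreGNS_toPreGNS]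

theorem denseRange_gnsStarAlgHom_gnsVec :
    DenseRange fun a : A => ω.gnsStarAlgHom a (gnsVec ω) := by
  have h := (UniformSpace.Completion.denseRange_coe (α := ω.PreGNS))
  rw [DenseRange] at h ⊢
  convert h using 1
  ext x
  constructor
  · rintro ⟨a, rfl⟩
    exact ⟨ω.toPreGNS a, (gnsStarAlgHom_gnsVec a).symm⟩
  · rintro ⟨a, rfl⟩
    exact ⟨ω.ofPreGNS a, gnsStarAlgHom_gnsVec _⟩

/-- The orbit map `a ↦ π_ω(a) Ω_ω` as a continuous linear map. -/
def gnsOrbit (ω : A →ₚ[ℂ] ℂ) : A →L[ℂ] ω.GNS where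
  toFun a := ω.gnsStarAlgHom a (gnsVec ω)
  map_add' a b := by rw [map_add]; rfl
  map_smul' c a := by rw [map_smul]; rfl
  cont := by
    have h : Continuous (ω.gnsStarAlgHom) := map_continuous ω.gnsStarAlgHom
    fun_prop

theorem gnsOrbit_apply (a : A) : gnsOrbit ω a = ω.gnsStarAlgHom a (gnsVec ω) := rfl

/-- `(Ω_ω, [v, a] Ω_ω)` for a vector `v` in place of a self-adjoint operator applied to `Ω_ω`. -/
def vecComm (ω : A →ₚ[ℂ] ℂ) (v : ω.GNS) (a : A) : ℂ :=
  ⟪v, ω.gnsStarAlgHom a (gnsVec ω)⟫_ℂ - ⟪ω.gnsStarAlgHom (star a) (gnsVec ω), v⟫_ℂ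

theorem vecComm_add (v w : ω.GNS) (a : A) :
    vecComm ω (v + w) a = vecComm ω v a + vecComm ω w a := by
  simp only [vecComm, inner_add_left, inner_add_right]
  ring

theorem vecComm_sub (v w : ω.GNS) (a : A) :
    vecComm ω (v - w) a = vecComm ω v a - vecComm ω w a := by
  simp only [vecComm, inner_sub_left, inner_sub_right]
  ring

theorem vecComm_sum_right {ι : Type*} (S : Finset ι) (v : ω.GNS) (f : ι → A) :
    vecComm ω v (∑ i ∈ S, f i) = ∑ i ∈ S, vecComm ω v (f i) := by
  simp only [vecComm, map_sum, star_sum, sum_apply, inner_sum, sum_inner,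
    Finset.sum_sub_distrib]

theorem vecComm_smul_right (c : ℂ) (v : ω.GNS) (a : A) :
    vecComm ω v (c • a) = c * vecComm ω v a := by
  simp only [vecComm, map_smul, star_smul, smul_apply, inner_smul_right, inner_smul_left,
    Complex.star_def, Complex.conj_conj]
  ring

/-- The closure of the vectors `π_ω(a) Ω_ω`, `a ∈ B` self-adjoint. -/
def selfAdjointVectors (ω : A →ₚ[ℂ] ℂ) (B : StarSubalgebra ℂ A) : Set ω.GNS :=
  closure {w | ∃ a ∈ B, star a = a ∧ w = ω.gnsStarAlgHom a (gnsVec ω)}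

theorem selfAdjointVectors_mono {B C : StarSubalgebra ℂ A} (h : B ≤ C) :
    selfAdjointVectors ω B ⊆ selfAdjointVectors ω C :=
  closure_mono fun _ ⟨a, ha, ha', e⟩ => ⟨a, h ha, ha', e⟩

theorem add_mem_selfAdjointVectors {B : StarSubalgebra ℂ A} {v w : ω.GNS}
    (hv : v ∈ selfAdjointVectors ω B) (hw : w ∈ selfAdjointVectors ω B) :
    v + w ∈ selfAdjointVectors ω B := by
  refine map_mem_closure₂ continuous_add hv hw ?_
  rintro _ ⟨a, ha, ha', rfl⟩ _ ⟨b, hb, hb', rfl⟩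
  exact ⟨a + b, add_mem ha hb, by rw [star_add, ha', hb'], by rw [map_add]; rfl⟩

theorem zero_mem_selfAdjointVectors {B : StarSubalgebra ℂ A} :
    (0 : ω.GNS) ∈ selfAdjointVectors ω B :=
  subset_closure ⟨0, zero_mem _, star_zero _, by simp⟩

theorem smul_mem_selfAdjointVectors {B : StarSubalgebra ℂ A} (c : ℝ) {v : ω.GNS}
    (hv : v ∈ selfAdjointVectors ω B) : (c : ℂ) • v ∈ selfAdjointVectors ω B := by
  refine map_mem_closure (continuous_const_smul (c : ℂ)) hv ?_
  rintro _ ⟨a, ha, ha', rfl⟩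
  refine ⟨(c : ℂ) • a, SMulMemClass.smul_mem _ ha, by simp [ha'], ?_⟩
  rw [map_smul]; rfl

theorem sum_mem_selfAdjointVectors {ι : Type*} {B : StarSubalgebra ℂ A} (S : Finset ι)
    {v : ι → ω.GNS} (hv : ∀ i ∈ S, v i ∈ selfAdjointVectors ω B) :
    ∑ i ∈ S, v i ∈ selfAdjointVectors ω B :=
  Finset.sum_induction _ (· ∈ selfAdjointVectors ω B) (fun _ _ => add_mem_selfAdjointVectors)
    zero_mem_selfAdjointVectors hv

variable (hinv : ∀ (x : Spacetime s) (a : A), ω (N.trans x a) = ω a)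

theorem gnsUnitary_add (x y : Spacetime s) (v : ω.GNS) :
    gnsUnitary ω (N.trans (x + y)) (hinv _) v
      = gnsUnitary ω (N.trans x) (hinv _) (gnsUnitary ω (N.trans y) (hinv _) v) := by
  refine denseRange_gnsStarAlgHom_gnsVec.induction_on v
    (isClosed_eq (LinearIsometryEquiv.continuous _)
      ((LinearIsometryEquiv.continuous _).comp (LinearIsometryEquiv.continuous _))) fun a => ?_
  rw [gnsUnitary_apply, gnsUnitary_apply, gnsUnitary_apply, N.trans_add]

theorem gnsUnitary_zero (v : ω.GNS) : gnsUnitary ω (N.trans 0) (hinv _) v = v := by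
  refine denseRange_gnsStarAlgHom_gnsVec.induction_on v
    (isClosed_eq (LinearIsometryEquiv.continuous _) continuous_id) fun a => ?_
  rw [gnsUnitary_apply, N.trans_zero]

theorem gnsUnitary_gnsVec (x : Spacetime s) :
    gnsUnitary ω (N.trans x) (hinv _) (gnsVec ω) = gnsVec ω := by
  have := gnsUnitary_apply ω (N.trans x) (hinv _) 1
  simpa only [map_one, one_apply_eq_self] using this

theorem inner_gnsUnitary_left (x : Spacetime s) (v w : ω.GNS) :
    ⟪gnsUnitary ω (N.trans x) (hinv _) v, w⟫_ℂ
      = ⟪v, gnsUnitary ω (N.trans (-x)) (hinv _) w⟫_ℂ := by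
  rw [← LinearIsometryEquiv.inner_map_map (gnsUnitary ω (N.trans x) (hinv _)) v,
    ← gnsUnitary_add hinv]
  simp only [add_neg_cancel]
  rw [gnsUnitary_zero hinv]

theorem vecComm_gnsUnitary (x : Spacetime s) (v : ω.GNS) (a : A) :
    vecComm ω (gnsUnitary ω (N.trans x) (hinv _) v) (N.trans x a) = vecComm ω v a := by
  simp only [vecComm]
  rw [← map_star, ← gnsUnitary_apply ω _ (hinv x), ← gnsUnitary_apply ω _ (hinv x),
    LinearIsometryEquiv.inner_map_map, LinearIsometryEquiv.inner_map_map]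

theorem continuous_gnsUnitary_time (v : ω.GNS) :
    Continuous fun t : ℝ => gnsUnitary ω (N.trans (t, 0)) (hinv _) v := by
  refine continuous_of_uniform_approx_of_continuous fun u hu => ?_
  obtain ⟨ε, hε, hεu⟩ := Metric.mem_uniformity_dist.1 hu
  obtain ⟨a, ha⟩ := denseRange_gnsStarAlgHom_gnsVec.exists_dist_lt v hε
  refine ⟨fun t => ω.gnsStarAlgHom (N.trans (t, 0) a) (gnsVec ω),
    (gnsOrbit ω).continuous.comp (N.continuous_time a), fun t => hεu ?_⟩
  change dist _ (ω.gnsStarAlgHom (N.trans (t, 0) a) (gnsVec ω)) < ε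
  rw [← gnsUnitary_apply ω _ (hinv (t, 0)), LinearIsometryEquiv.dist_map]
  exact ha

theorem gnsUnitary_mem_selfAdjointVectors (x : Spacetime s) {v : ω.GNS}
    (hv : v ∈ selfAdjointVectors ω ⊤) :
    gnsUnitary ω (N.trans x) (hinv _) v ∈ selfAdjointVectors ω ⊤ := by
  refine map_mem_closure (LinearIsometryEquiv.continuous _) hv ?_
  rintro _ ⟨a, -, ha', rfl⟩
  exact ⟨N.trans x a, trivial, by rw [← map_star, ha'], gnsUnitary_apply ω _ (hinv x) a⟩

/-- The average of `v` over the time translations in the unit interval. -/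
def timeAverage (v : ω.GNS) : ω.GNS :=
  ∫ t in (0 : ℝ)..1, gnsUnitary ω (N.trans (t, 0)) (hinv _) v

theorem continuous_timeAverage : Continuous (timeAverage hinv) := by
  refine LipschitzWith.continuous (K := 1) (LipschitzWith.of_dist_le_mul fun v w => ?_)
  rw [dist_eq_norm, dist_eq_norm, timeAverage, timeAverage,
    ← intervalIntegral.integral_sub ((continuous_gnsUnitary_time hinv v).intervalIntegrable _ _)
      ((continuous_gnsUnitary_time hinv w).intervalIntegrable _ _)]
  refine (intervalIntegral.norm_integral_le_of_norm_le_const (C := ‖v - w‖) fun t _ => ?_).trans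
    (by simp)
  rw [← map_sub, LinearIsometryEquiv.norm_map]

/-- The unit-time average of an arbitrary b is differentiable, with derivative a difference of time
translates. No domain condition on b is needed. -/
theorem hasDerivAt_time_integral (b : A) :
    HasDerivAt (fun t : ℝ => N.time t (∫ r in (0 : ℝ)..1, N.time r b)) (N.time 1 b - b) 0 := by
  have hc := N.continuous_time_apply b
  have h1 : ∀ t : ℝ, N.time t (∫ r in (0 : ℝ)..1, N.time r b)
      = (∫ r in (0 : ℝ)..(t + 1), N.time r b) - ∫ r in (0 : ℝ)..t, N.time r b := fun t => by
    have h2 := (timeCLM N t).intervalIntegral_comp_comm (hc.intervalIntegrable (μ := volume) 0 1)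
    simp only [timeCLM_apply, ← N.time_add] at h2
    rw [← h2, intervalIntegral.integral_comp_add_left (fun r => N.time r b) t, add_zero,
      intervalIntegral.integral_interval_sub_left (hc.intervalIntegrable _ _)
        (hc.intervalIntegrable _ _)]
  simp only [h1]
  have d1 : HasDerivAt (fun t : ℝ => ∫ r in (0 : ℝ)..(t + 1), N.time r b) (N.time 1 b) 0 := by
    have := (hc.integral_hasStrictDerivAt 0 (0 + 1)).hasDerivAt.comp_add_const 0 1
    simpa using this
  have d2 : HasDerivAt (fun t : ℝ => ∫ r in (0 : ℝ)..t, N.time r b) b 0 := by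
    simpa [N.time_zero] using (hc.integral_hasStrictDerivAt 0 0).hasDerivAt
  exact d1.sub d2

theorem timeAverage_gnsOrbit (b : A) :
    timeAverage hinv (ω.gnsStarAlgHom b (gnsVec ω))
      = ω.gnsStarAlgHom (∫ r in (0 : ℝ)..1, N.time r b) (gnsVec ω) := by
  have h2 := (gnsOrbit ω).intervalIntegral_comp_comm
    ((N.continuous_time_apply b).intervalIntegrable (μ := volume) 0 1)
  rw [timeAverage, ← gnsOrbit_apply, ← gnsOrbit_apply, ← h2]
  refine intervalIntegral.integral_congr fun t _ => ?_
  exact gnsUnitary_apply ω _ (hinv _) b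

/-- The Bogoliubov inequality for limits of self-adjoint vectors. -/
theorem bogoliubov_timeAverage {β : ℝ} (hβ : 0 < β) (hK : N.IsKMS ω β) {v : ω.GNS}
    (hv : v ∈ selfAdjointVectors ω ⊤) (a : A) {ε : ℝ} (hε : 0 < ε) :
    ‖vecComm ω (timeAverage hinv v) a‖ ≤
      (ε * β * ((ω (star a * a)).re + (ω (a * star a)).re) + ε⁻¹ * (2 *
        |(⟪timeAverage hinv v, gnsUnitary ω (N.trans (1, 0)) (hinv _) v - v⟫_ℂ).im|)) / 2 := by
  have hc1 : Continuous fun v => ‖vecComm ω (timeAverage hinv v) a‖ := by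
    have := continuous_timeAverage hinv
    simp only [vecComm]
    fun_prop
  have hc2 : Continuous fun v : ω.GNS =>
      (ε * β * ((ω (star a * a)).re + (ω (a * star a)).re) + ε⁻¹ * (2 *
        |(⟪timeAverage hinv v, gnsUnitary ω (N.trans (1, 0)) (hinv _) v - v⟫_ℂ).im|)) / 2 := by
    have := continuous_timeAverage hinv
    fun_prop
  -- Both sides depend continuously on the vector alone, so it is enough to treat v = π(b)Ω with b
  -- self-adjoint.
  refine closure_minimal ?_ (isClosed_le hc1 hc2) hv
  rintro _ ⟨b, -, hb, rfl⟩
  set m := ∫ r in (0 : ℝ)..1, N.time r b with hm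
  have hms : star m = m := by
    have h := ((starL' ℝ : A ≃L[ℝ] A).toContinuousLinearMap).intervalIntegral_comp_comm
      ((N.continuous_time_apply b).intervalIntegrable (μ := volume) 0 1)
    simp only [ContinuousLinearEquiv.coe_coe, starL'_apply, ← map_star, hb] at h
    exact h.symm
  have hd := hasDerivAt_time_integral (N := N) b
  have key := hK.bogoliubov hβ hd (star a) hε
  simp only [star_star, star_sub, ← map_star, hb] at key
  rw [← hm] at key
  simp only [mem_ofPred_eq, timeAverage_gnsOrbit]
  rw [← hm]
  have e1 : vecComm ω (ω.gnsStarAlgHom m (gnsVec ω)) a = ω (m * a) - ω (a * m) := by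
    rw [vecComm, inner_gnsStarAlgHom_gnsVec, inner_gnsStarAlgHom_gnsVec, hms, star_star]
  have e2 : gnsUnitary ω (N.trans (1, 0)) (hinv _) (ω.gnsStarAlgHom b (gnsVec ω))
      - ω.gnsStarAlgHom b (gnsVec ω) = ω.gnsStarAlgHom (N.time 1 b - b) (gnsVec ω) := by
    rw [gnsUnitary_apply, map_sub]; rfl
  -- Both factors are self-adjoint, so the commutator expectation is twice an imaginary part.
  have e3 : ω ((N.time 1 b - b) * m)
      = conj (ω (m * (N.time 1 b - b))) := by
    rw [← Complex.star_def, ← map_star]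
    simp only [star_mul, star_sub, ← map_star, hb, hms]
  rw [e1, e2, inner_gnsStarAlgHom_gnsVec, hms]
  rw [e3, Complex.sub_conj, norm_mul, Complex.norm_I, mul_one, Complex.norm_real,
    Real.norm_eq_abs, abs_mul, abs_two] at key
  rw [add_comm (ω (star a * a)).re]
  exact key

theorem vecComm_timeAverage {v : ω.GNS} {a : A} {c : ℂ}
    (h : ∀ t ∈ Icc (0 : ℝ) 1, vecComm ω (gnsUnitary ω (N.trans (t, 0)) (hinv _) v) a = c) :
    vecComm ω (timeAverage hinv v) a = c := by
  have hc := continuous_gnsUnitary_time hinv v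
  rw [vecComm, timeAverage, inner_intervalIntegral _ hc, intervalIntegral_inner _ hc,
    ← intervalIntegral.integral_sub (Continuous.intervalIntegrable (by fun_prop) _ _)
      (Continuous.intervalIntegrable (by fun_prop) _ _)]
  have : ∀ t ∈ uIcc (0 : ℝ) 1, ⟪gnsUnitary ω (N.trans (t, 0)) (hinv _) v,
      ω.gnsStarAlgHom a (gnsVec ω)⟫_ℂ - ⟪ω.gnsStarAlgHom (star a) (gnsVec ω),
        gnsUnitary ω (N.trans (t, 0)) (hinv _) v⟫_ℂ = c := fun t ht => by
    rw [uIcc_of_le zero_le_one] at ht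
    exact h t ht
  rw [intervalIntegral.integral_congr this]
  simp

/-- By unitarity ⟪U_t v, U_1 v⟫ = ⟪U_{t-1} v, v⟫, so only time differences of absolute value at most
1 occur. -/
theorem abs_im_inner_timeAverage_le {v : ω.GNS} {M : ℝ}
    (h : ∀ t : ℝ, |t| ≤ 1 → |(⟪gnsUnitary ω (N.trans (t, 0)) (hinv _) v, v⟫_ℂ).im| ≤ M) :
    |(⟪timeAverage hinv v, gnsUnitary ω (N.trans (1, 0)) (hinv _) v - v⟫_ℂ).im| ≤ 2 * M := by
  have hc := continuous_gnsUnitary_time hinv v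
  have hci : ∀ w : ω.GNS, Continuous fun t : ℝ =>
      ⟪gnsUnitary ω (N.trans (t, 0)) (hinv _) v, w⟫_ℂ := fun w => by fun_prop
  rw [timeAverage, intervalIntegral_inner _ hc]
  have him := Complex.imCLM.intervalIntegral_comp_comm
    ((hci (gnsUnitary ω (N.trans (1, 0)) (hinv _) v - v)).intervalIntegrable (μ := volume) 0 1)
  simp only [Complex.imCLM_apply] at him
  rw [← him, ← Real.norm_eq_abs]
  refine (intervalIntegral.norm_integral_le_of_norm_le_const (C := 2 * M) fun t ht => ?_).trans
    (by simp)
  rw [uIoc_of_le zero_le_one] at ht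
  rw [inner_sub_right, Complex.sub_im, Real.norm_eq_abs]
  have e1 : ⟪gnsUnitary ω (N.trans (t, 0)) (hinv _) v,
      gnsUnitary ω (N.trans (1, 0)) (hinv _) v⟫_ℂ
      = ⟪gnsUnitary ω (N.trans (t - 1, 0)) (hinv _) v, v⟫_ℂ := by
    have := inner_gnsUnitary_left hinv (1, 0)
      (gnsUnitary ω (N.trans (t - 1, 0)) (hinv _) v) (gnsUnitary ω (N.trans (1, 0)) (hinv _) v)
    rw [← gnsUnitary_add hinv, ← gnsUnitary_add hinv] at this
    simp only [neg_add_cancel, gnsUnitary_zero hinv, Prod.mk_add_mk, add_sub_cancel, add_zero] at this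
    exact this
  rw [e1]
  have h1 := h (t - 1) (by rw [abs_le]; constructor <;> linarith [ht.1, ht.2])
  have h2 := h t (by rw [abs_le]; constructor <;> linarith [ht.1, ht.2])
  have h3 := abs_sub (⟪gnsUnitary ω (N.trans (t - 1, 0)) (hinv _) v, v⟫_ℂ).im
    (⟪gnsUnitary ω (N.trans (t, 0)) (hinv _) v, v⟫_ℂ).im
  linarith

end GNS

end ThermalQFT

namespace ThermalQFT

open MeasureTheory Filter Set

/-! ### Lattice sums -/

section Lattice

variable {s : ℕ}

/-- The points of `ℤ^s` with all coordinates at most `M` in absolute value. -/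
def box (s M : ℕ) : Finset (Fin s → ℤ) := Fintype.piFinset fun _ => Finset.Icc (-(M : ℤ)) M

theorem mem_box {M : ℕ} {n : Fin s → ℤ} : n ∈ box s M ↔ ‖n‖ ≤ M := by
  rw [box, Fintype.mem_piFinset, pi_norm_le_iff_of_nonneg (Nat.cast_nonneg M)]
  refine forall_congr' fun i => ?_
  rw [Finset.mem_Icc, ← abs_le, Int.norm_eq_abs]
  norm_cast

theorem card_box (s M : ℕ) : (box s M).card = (2 * M + 1) ^ s := by
  rw [box, Fintype.card_piFinset]
  simp only [Int.card_Icc, Finset.prod_const, Finset.card_univ, Fintype.card_fin]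
  congr 1
  omega

theorem neg_mem_box {M : ℕ} {n : Fin s → ℤ} (hn : n ∈ box s M) : -n ∈ box s M := by
  rw [mem_box] at hn ⊢
  rwa [norm_neg]

/-- The Lipschitz cutoff on `ℤ^s`, equal to `1` on `box s N` and supported in `box s (2 * N)`. -/
def cutoff (N : ℕ) (n : Fin s → ℤ) : ℝ := max 0 (min 1 (2 - ‖n‖ / N))

theorem cutoff_eq_one {N : ℕ} {n : Fin s → ℤ} (h : ‖n‖ ≤ N) : cutoff N n = 1 := by
  have h1 : ‖n‖ / N ≤ 1 := div_le_one_of_le₀ h (Nat.cast_nonneg N)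
  rw [cutoff, min_eq_left (by linarith), max_eq_right zero_le_one]

theorem cutoff_eq_zero {N : ℕ} (hN : 0 < N) {n : Fin s → ℤ} (h : n ∉ box s (2 * N)) :
    cutoff N n = 0 := by
  rw [mem_box, not_le] at h
  push_cast at h
  have h0 : (0 : ℝ) < N := by exact_mod_cast hN
  have h1 : 2 ≤ ‖n‖ / N := by rw [le_div_iff₀ h0]; exact h.le
  rw [cutoff, max_eq_left]
  exact (min_le_right _ _).trans (by linarith)

theorem abs_cutoff_sub_le (N : ℕ) (n m : Fin s → ℤ) :
    |cutoff N n - cutoff N m| ≤ ‖n - m‖ / N := by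
  rw [cutoff, cutoff]
  refine (abs_max_sub_max_le_max _ _ _ _).trans (max_le (by simp; positivity) ?_)
  refine (abs_min_sub_min_le_max _ _ _ _).trans (max_le (by simp; positivity) ?_)
  have : 2 - ‖n‖ / N - (2 - ‖m‖ / N) = (‖m‖ - ‖n‖) / N := by ring
  rw [this, abs_div, Nat.abs_cast, norm_sub_rev]
  gcongr
  exact abs_norm_sub_norm_le _ _

theorem summable_of_eq_zero_off_box {f : (Fin s → ℤ) → ℝ} (M : ℕ)
    (h : ∀ n ∉ box s M, f n = 0) : Summable f := summable_of_ne_finset_zero h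

/-- The quadratic form of a kernel of finite range and vanishing total mass gains two powers of
`N` on the Lipschitz cutoffs. -/
theorem abs_sum_cutoff_kernel_le {K : (Fin s → ℤ) → ℝ} {C : ℝ} {r N : ℕ} (hN : 0 < N)
    (hr : r ≤ N) (hK : ∀ n, |K n| ≤ C) (hK0 : ∀ n ∉ box s r, K n = 0)
    (hsum : ∑ n ∈ box s r, K n = 0) :
    |∑ n ∈ box s (2 * N), ∑ m ∈ box s (2 * N), cutoff N n * cutoff N m * K (n - m)| ≤
      (7 ^ s * (2 * r + 1) ^ s * r ^ 2 * C) * ((N : ℝ) ^ s / N ^ 2) := by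
  have hN0 : (0 : ℝ) < N := by exact_mod_cast hN
  have hC : 0 ≤ C := (abs_nonneg _).trans (hK 0)
  set w : (Fin s → ℤ) → ℝ := cutoff N with hw
  have hw0 : ∀ n ∉ box s (2 * N), w n = 0 := fun n hn => cutoff_eq_zero hN hn
  set a : (Fin s → ℤ) → ℝ := fun k => ∑ n ∈ box s (2 * N), w n * w (n - k) with ha
  have hconv : ∀ n, ∑ m ∈ box s (2 * N), w n * w m * K (n - m)
      = ∑ k ∈ box s r, w n * w (n - k) * K k := fun n => by
    have e1 : ∑' m, w n * w m * K (n - m) = ∑ m ∈ box s (2 * N), w n * w m * K (n - m) :=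
      tsum_eq_sum fun m hm => by rw [hw0 m hm]; ring
    have e2 : ∑' k, w n * w (n - k) * K k = ∑ k ∈ box s r, w n * w (n - k) * K k :=
      tsum_eq_sum fun k hk => by rw [hK0 k hk]; ring
    rw [← e1, ← e2, ← (Equiv.subLeft n).tsum_eq]
    simp
  -- Since K has no mass, the autocorrelation a k of the cutoff may be replaced by a k - a 0.
  have hS : ∑ n ∈ box s (2 * N), ∑ m ∈ box s (2 * N), w n * w m * K (n - m)
      = ∑ k ∈ box s r, (a k - a 0) * K k := by
    simp only [hconv]
    rw [Finset.sum_comm]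
    simp only [sub_mul, Finset.sum_sub_distrib, ← Finset.mul_sum, hsum, mul_zero, sub_zero]
    refine Finset.sum_congr rfl fun k _ => ?_
    rw [ha, Finset.sum_mul]
  have hak : ∀ k ∈ box s r, |a k - a 0| ≤ 7 ^ s * r ^ 2 * ((N : ℝ) ^ s / N ^ 2) := fun k hk => by
    have hkr := mem_box.1 hk
    have h1 : ∀ j, a j = ∑' n, w n * w (n - j) := fun j =>
      (tsum_eq_sum fun n hn => by rw [hw0 n hn]; ring).symm
    have s0 : Summable fun n => w n * w n := summable_of_eq_zero_off_box (2 * N)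
      fun n hn => by rw [hw0 n hn]; ring
    have sk : Summable fun n => w n * w (n - k) := summable_of_eq_zero_off_box (2 * N)
      fun n hn => by rw [hw0 n hn]; ring
    have s1 : Summable fun n => w (n - k) * w (n - k) :=
      (Equiv.subRight k).summable_iff.2 s0
    have h2 : ∑' n, w (n - k) * w (n - k) = ∑' n, w n * w n :=
      (Equiv.subRight k).tsum_eq fun n => w n * w n
    -- Polarization makes the deficit quadratic in the increments of w, so a Lipschitz cutoff
    -- already gains (r/N)².
    have h3 : a 0 - a k = (∑' n, (w n - w (n - k)) ^ 2) / 2 := by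
      have h4 : ∀ n, (w n - w (n - k)) ^ 2
          = w n * w n + w (n - k) * w (n - k) - 2 * (w n * w (n - k)) := fun n => by ring
      rw [tsum_congr h4, (s0.add s1).tsum_sub (sk.mul_left 2), s0.tsum_add s1, h2, tsum_mul_left,
        h1, h1]
      simp only [sub_zero]
      ring
    have hoff : ∀ n ∉ box s (2 * N + r), (w n - w (n - k)) ^ 2 = 0 := fun n hn => by
      rw [mem_box, not_le] at hn
      push_cast at hn
      have g1 : n ∉ box s (2 * N) := by
        rw [mem_box, not_le]; push_cast; linarith [(Nat.cast_nonneg r : (0 : ℝ) ≤ r)]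
      have g2 : n - k ∉ box s (2 * N) := by
        rw [mem_box, not_le]; push_cast
        linarith [norm_sub_norm_le n k]
      rw [hw0 n g1, hw0 _ g2]; ring
    rw [abs_sub_comm, h3, tsum_eq_sum hoff]
    -- The box has side 2(2N + r) + 1 ≤ 6N + 1 ≤ 7N.
    have h5 : ∑ n ∈ box s (2 * N + r), (w n - w (n - k)) ^ 2
        ≤ (7 * N : ℝ) ^ s * (r / N) ^ 2 := by
      refine (Finset.sum_le_card_nsmul _ _ ((r / N : ℝ) ^ 2) fun n _ => ?_).trans ?_
      · rw [← sq_abs]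
        have := abs_cutoff_sub_le N n (n - k)
        rw [sub_sub_cancel] at this
        have h6 : |w n - w (n - k)| ≤ r / N := this.trans (by gcongr)
        gcongr
      · rw [card_box, nsmul_eq_mul]
        push_cast
        gcongr
        have : (r : ℝ) ≤ N := by exact_mod_cast hr
        have : (1 : ℝ) ≤ N := by exact_mod_cast hN
        linarith
    rw [abs_of_nonneg (div_nonneg (Finset.sum_nonneg fun _ _ => sq_nonneg _) zero_le_two)]
    calc (∑ n ∈ box s (2 * N + r), (w n - w (n - k)) ^ 2) / 2
        ≤ ((7 * N : ℝ) ^ s * (r / N) ^ 2) / 2 := by gcongr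
      _ ≤ (7 * N : ℝ) ^ s * (r / N) ^ 2 := half_le_self (by positivity)
      _ = _ := by rw [mul_pow, div_pow]; ring
  rw [hS]
  refine (Finset.abs_sum_le_sum_abs _ _).trans ?_
  refine (Finset.sum_le_card_nsmul _ _ (7 ^ s * r ^ 2 * ((N : ℝ) ^ s / N ^ 2) * C)
    fun k hk => ?_).trans (le_of_eq ?_)
  · rw [abs_mul]
    exact mul_le_mul (hak k hk) (hK k) (abs_nonneg _) (by positivity)
  · rw [card_box, nsmul_eq_mul]
    push_cast
    ring

/-- Induction on M: the two new terms add 2 x^(-p), and Bernoulli's inequality for the exponent 1 -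
p shows that the right side grows by at least as much. -/
theorem sum_Icc_one_add_abs_rpow_le {p : ℝ} (hp : 0 < p) (hp1 : p < 1) (M : ℕ) :
    ∑ j ∈ Finset.Icc (-(M : ℤ)) M, (1 + |(j : ℝ)|) ^ (-p)
      ≤ 2 / (1 - p) * ((M : ℝ) + 1) ^ (1 - p) := by
  have hq : 0 < 1 - p := by linarith
  induction M with
  | zero =>
    simp only [Nat.cast_zero, neg_zero, Finset.Icc_self, Finset.sum_singleton, Int.cast_zero,
      abs_zero, add_zero, zero_add, Real.one_rpow, mul_one]
    rw [le_div_iff₀ hq]; linarith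
  | succ M ih =>
    have hI : Finset.Icc (-((M + 1 : ℕ) : ℤ)) ((M + 1 : ℕ) : ℤ)
        = insert (-((M : ℤ) + 1)) (insert ((M : ℤ) + 1) (Finset.Icc (-(M : ℤ)) M)) := by
      ext j
      simp only [Finset.mem_Icc, Finset.mem_insert]
      push_cast
      omega
    rw [hI, Finset.sum_insert (by simp; omega), Finset.sum_insert (by simp)]
    have h0 : (0 : ℝ) < (M : ℝ) + 1 + 1 := by positivity
    have e1 : (1 + |((-((M : ℤ) + 1) : ℤ) : ℝ)|) = (M : ℝ) + 1 + 1 := by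
      push_cast; rw [abs_neg, abs_of_nonneg (by positivity)]; ring
    have e2 : (1 + |(((M : ℤ) + 1 : ℤ) : ℝ)|) = (M : ℝ) + 1 + 1 := by
      push_cast; rw [abs_of_nonneg (by positivity)]; ring
    rw [e1, e2]
    push_cast
    set x : ℝ := (M : ℝ) + 1 + 1 with hx
    have hx1 : (M : ℝ) + 1 = x * (1 + -(1 / x)) := by field_simp; rw [hx]; ring
    have hb : (1 + -(1 / x)) ^ (1 - p) ≤ 1 + (1 - p) * -(1 / x) :=
      rpow_one_add_le_one_add_mul_self (by
        rw [neg_le_neg_iff, div_le_one h0, hx]; linarith [(Nat.cast_nonneg M : (0 : ℝ) ≤ M)])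
        hq.le (by linarith)
    have hpos : 0 ≤ 1 + -(1 / x) := by
      have : 1 / x ≤ 1 := by rw [div_le_one h0, hx]; linarith [(Nat.cast_nonneg M : (0 : ℝ) ≤ M)]
      linarith
    have key : ((M : ℝ) + 1) ^ (1 - p) ≤ x ^ (1 - p) - (1 - p) * x ^ (-p) := by
      rw [hx1, Real.mul_rpow h0.le hpos]
      have hxp : x ^ (1 - p) * (1 / x) = x ^ (-p) := by
        rw [mul_one_div, ← Real.rpow_sub_one h0.ne']; congr 1; ring
      calc x ^ (1 - p) * (1 + -(1 / x)) ^ (1 - p)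
          ≤ x ^ (1 - p) * (1 + (1 - p) * -(1 / x)) := by gcongr
        _ = x ^ (1 - p) - (1 - p) * (x ^ (1 - p) * (1 / x)) := by ring
        _ = _ := by rw [hxp]
    have h3 : 2 / (1 - p) * ((M : ℝ) + 1) ^ (1 - p)
        ≤ 2 / (1 - p) * (x ^ (1 - p) - (1 - p) * x ^ (-p)) := by gcongr
    have h4 : 2 / (1 - p) * (x ^ (1 - p) - (1 - p) * x ^ (-p))
        = 2 / (1 - p) * x ^ (1 - p) - 2 * x ^ (-p) := by field_simp
    linarith

/-- The sup norm dominates every coordinate, so the radial weight is at most a product of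
one-dimensional weights and the sum factorizes. -/
theorem sum_box_one_add_norm_rpow_le {p : ℝ} (hp : 0 < p) (hp1 : p < 1) (M : ℕ) :
    ∑ n ∈ box s M, (1 + ‖n‖) ^ (-(p * s)) ≤ (2 / (1 - p) * ((M : ℝ) + 1) ^ (1 - p)) ^ s := by
  calc ∑ n ∈ box s M, (1 + ‖n‖) ^ (-(p * s))
      ≤ ∑ n ∈ box s M, ∏ i, (1 + |(n i : ℝ)|) ^ (-p) := by
        refine Finset.sum_le_sum fun n _ => ?_
        have h1 : (1 + ‖n‖) ^ (-(p * s)) = ∏ _i : Fin s, (1 + ‖n‖) ^ (-p) := by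
          rw [Finset.prod_const, Finset.card_univ, Fintype.card_fin, ← Real.rpow_natCast,
            ← Real.rpow_mul (by positivity)]
          congr 1; ring
        rw [h1]
        refine Finset.prod_le_prod (fun _ _ => by positivity) fun i _ => ?_
        refine Real.rpow_le_rpow_of_nonpos (by positivity) ?_ (by linarith)
        have := norm_le_pi_norm n i
        rw [Int.norm_eq_abs] at this
        linarith
    _ = ∏ _i : Fin s, ∑ j ∈ Finset.Icc (-(M : ℤ)) M, (1 + |(j : ℝ)|) ^ (-p) := by
        rw [Finset.prod_univ_sum]; rfl
    _ ≤ _ := by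
        rw [Finset.prod_const, Finset.card_univ, Fintype.card_fin]
        gcongr
        exact sum_Icc_one_add_abs_rpow_le hp hp1 M

/-- Averaging over a box a kernel with decay rate `p * s`, `0 < p < 1`, preserves the rate. -/
theorem sum_box_sum_box_le {p : ℝ} (hp : 0 < p) (hp1 : p < 1) {N : ℕ} (hN : 0 < N)
    {G : (Fin s → ℤ) → ℝ} {C : ℝ} (hC : 0 ≤ C) (hG : ∀ n, G n ≤ C * (1 + ‖n‖) ^ (-(p * s))) :
    (((2 * N + 1 : ℕ) : ℝ) ^ s)⁻¹ ^ 2 * ∑ n ∈ box s N, ∑ m ∈ box s N, G (m - n) ≤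
      C * (2 / (1 - p) * 3) ^ s * (N : ℝ) ^ (-(p * s)) := by
  have hN0 : (0 : ℝ) < N := by exact_mod_cast hN
  have hN1 : (1 : ℝ) ≤ N := by exact_mod_cast hN
  have hq : 0 < 1 - p := by linarith
  set D := C * (2 / (1 - p) * ((2 * N : ℕ) + 1 : ℝ) ^ (1 - p)) ^ s with hD
  -- Differences of points of the box lie in the doubled box, which gives a bound uniform in n.
  have h1 : ∀ n ∈ box s N, ∑ m ∈ box s N, G (m - n) ≤ D := fun n hn => by
    calc ∑ m ∈ box s N, G (m - n) ≤ ∑ m ∈ box s N, C * (1 + ‖m - n‖) ^ (-(p * s)) :=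
          Finset.sum_le_sum fun m _ => hG _
      _ = ∑ k ∈ (box s N).map (Equiv.subRight n).toEmbedding, C * (1 + ‖k‖) ^ (-(p * s)) := by
          rw [Finset.sum_map]; rfl
      _ ≤ ∑ k ∈ box s (2 * N), C * (1 + ‖k‖) ^ (-(p * s)) := by
          refine Finset.sum_le_sum_of_subset_of_nonneg ?_ fun _ _ _ => by positivity
          intro k hk
          obtain ⟨m, hm, rfl⟩ := Finset.mem_map.1 hk
          rw [mem_box] at hm hn ⊢
          push_cast
          exact (norm_sub_le m n).trans (by linarith)
      _ ≤ D := by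
          rw [← Finset.mul_sum, hD]
          gcongr
          exact_mod_cast sum_box_one_add_norm_rpow_le hp hp1 (2 * N)
  have h2 : ∑ n ∈ box s N, ∑ m ∈ box s N, G (m - n) ≤ ((2 * N + 1 : ℕ) : ℝ) ^ s * D := by
    refine (Finset.sum_le_card_nsmul _ _ D h1).trans (le_of_eq ?_)
    rw [card_box, nsmul_eq_mul]
    push_cast
    ring
  have hV : (0 : ℝ) < ((2 * N + 1 : ℕ) : ℝ) ^ s := by positivity
  calc (((2 * N + 1 : ℕ) : ℝ) ^ s)⁻¹ ^ 2 * ∑ n ∈ box s N, ∑ m ∈ box s N, G (m - n)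
      ≤ (((2 * N + 1 : ℕ) : ℝ) ^ s)⁻¹ ^ 2 * (((2 * N + 1 : ℕ) : ℝ) ^ s * D) := by gcongr
    _ = (((2 * N + 1 : ℕ) : ℝ) ^ s)⁻¹ * D := by field_simp
    _ ≤ ((N : ℝ) ^ s)⁻¹ * (C * (2 / (1 - p) * (3 * (N : ℝ) ^ (1 - p))) ^ s) := by
        rw [hD]
        gcongr
        · linarith
        · calc ((2 * N : ℕ) + 1 : ℝ) ^ (1 - p) ≤ (3 * N : ℝ) ^ (1 - p) := by
                refine Real.rpow_le_rpow (by positivity) ?_ hq.le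
                push_cast; linarith
            _ = 3 ^ (1 - p) * (N : ℝ) ^ (1 - p) := Real.mul_rpow (by norm_num) hN0.le
            _ ≤ 3 * (N : ℝ) ^ (1 - p) := by
                gcongr
                calc (3 : ℝ) ^ (1 - p) ≤ 3 ^ (1 : ℝ) :=
                      Real.rpow_le_rpow_of_exponent_le (by norm_num) (by linarith)
                  _ = 3 := Real.rpow_one 3
    _ = C * (2 / (1 - p) * 3) ^ s * (((N : ℝ) ^ (1 - p)) ^ s / (N : ℝ) ^ s) := by
        rw [← mul_assoc (2 / (1 - p)), mul_pow]; ring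
    _ = _ := by
        congr 1
        rw [← Real.rpow_natCast, ← Real.rpow_mul hN0.le, ← Real.rpow_natCast,
          ← Real.rpow_sub hN0]
        congr 1; ring

/-- Optimizing the parameter of a Bogoliubov-type bound. -/
theorem nonpos_of_forall_le_rpow {c D E a b : ℝ} (hab : a < b) {N₀ : ℕ}
    (h : ∀ N : ℕ, N₀ ≤ N → ∀ ε : ℝ, 0 < ε →
      c ≤ ε * (D * (N : ℝ) ^ (-b)) + ε⁻¹ * (E * (N : ℝ) ^ a)) : c ≤ 0 := by
  have hlim : Tendsto (fun N : ℕ => (D + E) * (N : ℝ) ^ (-((b - a) / 2))) atTop (𝓝 0) := by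
    have := ((tendsto_rpow_neg_atTop (y := (b - a) / 2) (by linarith)).comp
      tendsto_natCast_atTop_atTop).const_mul (D + E)
    simpa using this
  refine ge_of_tendsto hlim ?_
  filter_upwards [eventually_ge_atTop N₀, eventually_gt_atTop 0] with N hN hN0
  have hN1 : (0 : ℝ) < N := by exact_mod_cast hN0
  -- This ε balances the terms: both become multiples of N^(-(b - a)/2).
  refine (h N hN ((N : ℝ) ^ ((a + b) / 2)) (by positivity)).trans (le_of_eq ?_)
  rw [← Real.rpow_neg hN1.le]
  have e1 : (N : ℝ) ^ ((a + b) / 2) * (N : ℝ) ^ (-b) = (N : ℝ) ^ (-((b - a) / 2)) := by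
    rw [← Real.rpow_add hN1]; congr 1; ring
  have e2 : (N : ℝ) ^ (-((a + b) / 2)) * (N : ℝ) ^ a = (N : ℝ) ^ (-((b - a) / 2)) := by
    rw [← Real.rpow_add hN1]; congr 1; ring
  linear_combination D * e1 + E * e2

end Lattice

end ThermalQFT

namespace ThermalQFT

open MeasureTheory Filter Set

/-! ### Test functions -/

section TestFunctions

variable {s : ℕ}

/-- A smooth function supported in `[-1, 1]` whose integer translates sum up to `1`. -/
def stepBump (x : ℝ) : ℝ := Real.smoothTransition (x + 1) - Real.smoothTransition x

theorem contDiff_stepBump {n : ℕ∞} : ContDiff ℝ n stepBump :=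
  (Real.smoothTransition.contDiff.comp (contDiff_id.add contDiff_const)).sub
    Real.smoothTransition.contDiff

theorem stepBump_eq_zero {x : ℝ} (hx : 1 ≤ |x|) : stepBump x = 0 := by
  rw [stepBump]
  rcases le_abs.1 hx with h | h
  · rw [Real.smoothTransition.one_of_one_le h, Real.smoothTransition.one_of_one_le (by linarith),
      sub_self]
  · rw [Real.smoothTransition.zero_of_nonpos (by linarith : x + 1 ≤ 0),
      Real.smoothTransition.zero_of_nonpos (by linarith), sub_self]

theorem sum_Icc_stepBump (M : ℕ) (x : ℝ) :
    ∑ j ∈ Finset.Icc (-(M : ℤ)) M, stepBump (x - j)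
      = Real.smoothTransition (x + M + 1) - Real.smoothTransition (x - M) := by
  induction M with
  | zero => simp [stepBump]
  | succ M ih =>
    have hI : Finset.Icc (-((M + 1 : ℕ) : ℤ)) ((M + 1 : ℕ) : ℤ)
        = insert (-((M : ℤ) + 1)) (insert ((M : ℤ) + 1) (Finset.Icc (-(M : ℤ)) M)) := by
      ext j
      simp only [Finset.mem_Icc, Finset.mem_insert]
      push_cast
      omega
    rw [hI, Finset.sum_insert (by simp; omega), Finset.sum_insert (by simp), ih, stepBump, stepBump]
    push_cast
    rw [show x - -((M : ℝ) + 1) + 1 = x + (M + 1) + 1 by ring,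
      show x - -((M : ℝ) + 1) = x + M + 1 by ring,
      show x - ((M : ℝ) + 1) + 1 = x - M by ring]
    ring

/-- The point of `ℝ^s` with integer coordinates `n`. -/
def lattice (n : Fin s → ℤ) : Space s := WithLp.toLp 2 fun i => (n i : ℝ)

theorem lattice_apply (n : Fin s → ℤ) (i : Fin s) : lattice n i = n i := rfl

theorem lattice_sub (n m : Fin s → ℤ) : lattice (n - m) = lattice n - lattice m := by
  ext i; simp [lattice_apply]

theorem lattice_neg (n : Fin s → ℤ) : lattice (-n) = -lattice n := by
  ext i; simp [lattice_apply]

theorem norm_le_norm_lattice (n : Fin s → ℤ) : ‖n‖ ≤ ‖lattice n‖ := by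
  rw [pi_norm_le_iff_of_nonneg (norm_nonneg _)]
  intro i
  have := PiLp.norm_apply_le (lattice n) i
  rwa [lattice_apply, Int.norm_cast_real] at this

theorem norm_le_of_forall_abs_lt {x : Space s} (h : ∀ i, |x i| < 1) : ‖x‖ ≤ s := by
  rw [EuclideanSpace.norm_eq, Real.sqrt_le_left (Nat.cast_nonneg s)]
  calc ∑ i, ‖x i‖ ^ 2 ≤ ∑ _i : Fin s, (1 : ℝ) := Finset.sum_le_sum fun i _ => by
        have := h i
        rw [Real.norm_eq_abs]
        exact pow_le_one₀ (abs_nonneg _) this.le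
    _ = s := by simp
    _ ≤ (s : ℝ) ^ 2 := by exact_mod_cast Nat.le_self_pow two_ne_zero s

theorem prod_stepBump_eq_zero {x : Space s} {i : Fin s} (hi : 1 ≤ |x i|) :
    ∏ i, stepBump (x i) = 0 :=
  Finset.prod_eq_zero (Finset.mem_univ i) (stepBump_eq_zero hi)

/-- A test function on `ℝ^s` whose translates by `ℤ^s` form a partition of unity. -/
def cellBump (s : ℕ) : TestFn (Space s) where
  toFun x := ∏ i, stepBump (x i)
  contDiff' := contDiff_prod fun i _ =>
    contDiff_stepBump.comp (EuclideanSpace.proj (𝕜 := ℝ) i).contDiff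
  hasCompactSupport' := by
    refine HasCompactSupport.intro (isCompact_closedBall (0 : Space s) s) fun x hx => ?_
    rw [mem_closedBall_zero_iff] at hx
    by_contra h
    refine hx (norm_le_of_forall_abs_lt fun i => ?_)
    by_contra hi
    exact h (prod_stepBump_eq_zero (not_lt.1 hi))
  tsupport_subset' := fun _ _ => trivial

theorem cellBump_apply (x : Space s) : cellBump s x = ∏ i, stepBump (x i) := rfl

theorem abs_lt_one_of_cellBump_ne_zero {x : Space s} (h : cellBump s x ≠ 0) (i : Fin s) :
    |x i| < 1 := by
  by_contra hi
  exact h (prod_stepBump_eq_zero (not_lt.1 hi))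

theorem cellBump_eq_zero {x : Space s} (h : s < ‖x‖) : cellBump s x = 0 := by
  by_contra h0
  exact absurd (norm_le_of_forall_abs_lt (abs_lt_one_of_cellBump_ne_zero h0)) (not_le.2 h)

theorem sum_box_cellBump {M : ℕ} {x : Space s} (hx : ‖x‖ ≤ M) :
    ∑ n ∈ box s M, cellBump s (x - lattice n) = 1 := by
  simp only [cellBump_apply, PiLp.sub_apply, lattice_apply]
  have h1 : ∏ i : Fin s, ∑ j ∈ Finset.Icc (-(M : ℤ)) M, stepBump (x i - j)
      = ∑ n ∈ box s M, ∏ i, stepBump (x i - n i) := Finset.prod_univ_sum _ _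
  rw [← h1]
  refine Finset.prod_eq_one fun i _ => ?_
  have hxi : |x i| ≤ M := (PiLp.norm_apply_le x i).trans hx
  rw [abs_le] at hxi
  rw [sum_Icc_stepBump, Real.smoothTransition.one_of_one_le (by linarith),
    Real.smoothTransition.zero_of_nonpos (by linarith), sub_zero]

/-- A weighted sum of translates of `cellBump` is `1` where all the relevant weights are `1`. -/
theorem sum_mul_cellBump_eq_one {S : Finset (Fin s → ℤ)} {w : (Fin s → ℤ) → ℝ} {y : Space s}
    (h : ∀ n, (∀ i, |y i - n i| < 1) → n ∈ S ∧ w n = 1) :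
    ∑ n ∈ S, w n * cellBump s (y - lattice n) = 1 := by
  classical
  obtain ⟨M, hM⟩ := exists_nat_ge ‖y‖
  rw [← sum_box_cellBump hM]
  have hne : ∀ n, cellBump s (y - lattice n) ≠ 0 → ∀ i, |y i - n i| < 1 := fun n hn i =>
    abs_lt_one_of_cellBump_ne_zero hn i
  have e1 : ∑ n ∈ S, w n * cellBump s (y - lattice n)
      = ∑ n ∈ S ∪ box s M, cellBump s (y - lattice n) := by
    rw [← Finset.sum_subset (Finset.subset_union_left (s₁ := S) (s₂ := box s M))]
    · refine Finset.sum_congr rfl fun n _ => ?_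
      by_cases h0 : cellBump s (y - lattice n) = 0
      · rw [h0, mul_zero]
      · rw [(h n (hne n h0)).2, one_mul]
    · intro n _ hn
      by_contra h0
      exact hn (h n (hne n h0)).1
  have e2 : ∑ n ∈ box s M, cellBump s (y - lattice n)
      = ∑ n ∈ S ∪ box s M, cellBump s (y - lattice n) := by
    refine Finset.sum_subset Finset.subset_union_right fun n _ hn => ?_
    by_contra h0
    refine hn (Fintype.mem_piFinset.2 fun i => ?_)
    have h1 := hne n h0 i
    have h2 : |y i| ≤ M := (PiLp.norm_apply_le y i).trans hM
    rw [abs_lt] at h1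
    rw [abs_le] at h2
    rw [Finset.mem_Icc]
    constructor
    · have : (-(M : ℤ) - 1 : ℝ) < n i := by push_cast; linarith
      have h3 : -(M : ℤ) - 1 < n i := by exact_mod_cast this
      omega
    · have : (n i : ℝ) < (M : ℤ) + 1 := by push_cast; linarith
      have h3 : n i < (M : ℤ) + 1 := by exact_mod_cast this
      omega
  rw [e1, e2]

theorem tensor_apply (f : TestFn ℝ) (g : TestFn (Space s)) (x : Spacetime s) :
    tensor f g x = f x.1 * g x.2 := rfl

theorem translate_apply {E : Type*} [NormedAddCommGroup E] [NormedSpace ℝ E] (a : E)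
    (f : TestFn E) (x : E) : translate a f x = f (x - a) := rfl

theorem translate_tensor (f : TestFn ℝ) (g : TestFn (Space s)) (t : ℝ) (y : Space s) :
    translate (t, y) (tensor f g) = tensor (translate t f) (translate y g) := rfl

/-- `tensor f` as a linear map. -/
def tensorₗ (f : TestFn ℝ) : TestFn (Space s) →ₗ[ℝ] TestFn (Spacetime s) where
  toFun := tensor f
  map_add' g h := by ext x; simp [tensor_apply, mul_add]
  map_smul' c g := by ext x; simp [tensor_apply, mul_left_comm]

/-- Evaluation of test functions at a point as a linear map. -/
def evalₗ {E : Type*} [NormedAddCommGroup E] [NormedSpace ℝ E] (x : E) : TestFn E →ₗ[ℝ] ℝ where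
  toFun f := f x
  map_add' _ _ := rfl
  map_smul' _ _ := rfl

/-- The weighted sum of translates of `cellBump` by the lattice points `n - m`, `n ∈ S`. -/
def latticeSum (S : Finset (Fin s → ℤ)) (w : (Fin s → ℤ) → ℝ) (m : Fin s → ℤ) :
    TestFn (Space s) := ∑ n ∈ S, w n • translate (lattice (n - m)) (cellBump s)

theorem latticeSum_apply (S : Finset (Fin s → ℤ)) (w : (Fin s → ℤ) → ℝ) (m : Fin s → ℤ)
    (x : Space s) :
    latticeSum S w m x = ∑ n ∈ S, w n * cellBump s (x + lattice m - lattice n) := by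
  change evalₗ x (latticeSum S w m) = _
  rw [latticeSum, map_sum]
  refine Finset.sum_congr rfl fun n _ => ?_
  rw [map_smul, smul_eq_mul]
  congr 1
  change cellBump s (x - lattice (n - m)) = _
  rw [lattice_sub]
  congr 1
  abel

/-- A bump that does not vanish at x has its centre within 1 of x in every coordinate; this is the
extra 1 in the hypothesis. -/
theorem latticeSum_eq_one {S : Finset (Fin s → ℤ)} {w : (Fin s → ℤ) → ℝ} {m : Fin s → ℤ}
    {ρ : ℝ} (h : ∀ n, ‖n - m‖ ≤ ρ + 1 → n ∈ S ∧ w n = 1) {x : Space s} (hx : ‖x‖ < ρ) :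
    latticeSum S w m x = 1 := by
  rw [latticeSum_apply]
  refine sum_mul_cellBump_eq_one fun n hn => h n ?_
  have hρ : 0 ≤ ρ := (norm_nonneg x).trans hx.le
  rw [pi_norm_le_iff_of_nonneg (by linarith)]
  intro i
  have h1 := hn i
  have h2 : |x i| ≤ ‖x‖ := PiLp.norm_apply_le x i
  rw [PiLp.add_apply, lattice_apply, abs_lt] at h1
  rw [abs_le] at h2
  rw [Pi.sub_apply, Int.norm_eq_abs, abs_le]
  push_cast
  constructor <;> linarith

/-- The primitive `x ↦ ∫_{x-t}^x f` of `f - f_t`. -/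
def shiftPrimitive (f : TestFn ℝ) (t : ℝ) : TestFn ℝ where
  toFun x := ∫ u in (x - t)..x, f u
  contDiff' := by
    have h0 : ContDiff ℝ (⊤ : ℕ∞) fun x : ℝ => ∫ u in (0 : ℝ)..x, f u := by
      have hd : ∀ x, HasDerivAt (fun x : ℝ => ∫ u in (0 : ℝ)..x, f u) (f x) x := fun x =>
        (f.continuous.integral_hasStrictDerivAt 0 x).hasDerivAt
      rw [contDiff_infty_iff_deriv]
      refine ⟨fun x => (hd x).differentiableAt, ?_⟩
      rw [funext fun x => (hd x).deriv]
      exact f.contDiff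
    have h1 : (fun x : ℝ => ∫ u in (x - t)..x, f u)
        = fun x => (∫ u in (0 : ℝ)..x, f u) - ∫ u in (0 : ℝ)..(x - t), f u := by
      funext x
      rw [intervalIntegral.integral_interval_sub_left (f.continuous.intervalIntegrable _ _)
        (f.continuous.intervalIntegrable _ _)]
    rw [h1]
    exact h0.sub (h0.comp (contDiff_id.sub contDiff_const))
  hasCompactSupport' := by
    obtain ⟨R, hR⟩ := f.hasCompactSupport.isCompact.isBounded.subset_closedBall 0
    refine HasCompactSupport.intro (isCompact_closedBall (0 : ℝ) (R + |t|)) fun x hx => ?_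
    rw [mem_closedBall_zero_iff, not_le, Real.norm_eq_abs] at hx
    rw [intervalIntegral.integral_congr (g := fun _ => 0) fun u hu => ?_]
    · simp
    · refine image_eq_zero_of_notMem_tsupport fun hu' => ?_
      have h1 := hR hu'
      rw [mem_closedBall_zero_iff, Real.norm_eq_abs] at h1
      have h2 : |x - u| ≤ |t| := by
        have := abs_sub_right_of_mem_uIcc hu
        simpa using this
      have := abs_sub_abs_le_abs_sub x u
      linarith
  tsupport_subset' := fun _ _ => trivial

theorem shiftPrimitive_apply (f : TestFn ℝ) (t x : ℝ) :
    shiftPrimitive f t x = ∫ u in (x - t)..x, f u := rfl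

theorem hasDerivAt_shiftPrimitive (f : TestFn ℝ) (t x : ℝ) :
    HasDerivAt (shiftPrimitive f t) (f x - translate t f x) x := by
  have hd : ∀ x, HasDerivAt (fun x : ℝ => ∫ u in (0 : ℝ)..x, f u) (f x) x := fun x =>
    (f.continuous.integral_hasStrictDerivAt 0 x).hasDerivAt
  refine ((hd x).sub ((hd (x - t)).comp_sub_const x t)).congr_of_eventuallyEq
    (.of_forall fun y => ?_)
  rw [shiftPrimitive_apply, Pi.sub_apply,
    intervalIntegral.integral_interval_sub_left (f.continuous.intervalIntegrable _ _)
    (f.continuous.intervalIntegrable _ _)]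

theorem shiftPrimitive_eq_zero {f : TestFn ℝ} {d : ℝ} (hf : ∀ x, d ≤ |x| → f x = 0) {t x : ℝ}
    (hx : d + |t| < |x|) : shiftPrimitive f t x = 0 := by
  rw [shiftPrimitive_apply, intervalIntegral.integral_congr (g := fun _ => 0) fun u hu => ?_]
  · simp
  · refine hf u ?_
    have h2 : |x - u| ≤ |t| := by
      have := abs_sub_right_of_mem_uIcc hu
      simpa using this
    have := abs_sub_abs_le_abs_sub x u
    linarith

theorem lineDeriv_apply (F : TestFn (Spacetime s)) (v x : Spacetime s) :
    (∂_{v} F : TestFn (Spacetime s)) x = deriv (fun r : ℝ => F (x + r • v)) 0 := by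
  rw [TestFunction.lineDerivOp_eq_lineDerivCLM ℝ, TestFunction.lineDerivCLM_apply]
  simp [lineDeriv]

/-- Through this, current conservation compares the charge at two times. -/
theorem lineDeriv_time_tensor (f : TestFn ℝ) (t : ℝ) (h : TestFn (Space s)) :
    (∂_{(coordVec 0 : Spacetime s)} (tensor (shiftPrimitive f t) h) : TestFn (Spacetime s))
      = tensor f h - tensor (translate t f) h := by
  ext x
  rw [lineDeriv_apply]
  have h1 : HasDerivAt (fun r : ℝ => shiftPrimitive f t (x.1 + r)) (f x.1 - translate t f x.1) 0 := by
    have := (hasDerivAt_shiftPrimitive f t (x.1 + 0)).comp_const_add x.1 0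
    simpa using this
  have h2 : (fun r : ℝ => tensor (shiftPrimitive f t) h (x + r • coordVec 0))
      = fun r => shiftPrimitive f t (x.1 + r) * h x.2 := by
    funext r
    simp [tensor_apply, coordVec]
  rw [h2, (h1.mul_const _).deriv]
  simp [tensor_apply, sub_mul]

/-- Gradients of the cutoff live only where h has left the value 1, in a slab bounded in time: far
out, and so space-like to bounded sets. -/
theorem lineDeriv_space_tensor_eq_zero {f : TestFn ℝ} {d : ℝ} (hf : ∀ x, d ≤ |x| → f x = 0)
    (t : ℝ) {h : TestFn (Space s)} {ρ : ℝ} (hh : ∀ x, ‖x‖ < ρ → h x = 1) (k : Fin s)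
    {x : Spacetime s} (hx : d + |t| < |x.1| ∨ ‖x.2‖ < ρ) :
    (∂_{(coordVec k.succ : Spacetime s)} (tensor (shiftPrimitive f t) h) :
      TestFn (Spacetime s)) x = 0 := by
  rw [lineDeriv_apply]
  have h2 : (fun r : ℝ => tensor (shiftPrimitive f t) h (x + r • coordVec k.succ))
      = fun r => shiftPrimitive f t x.1 * h (x.2 + r • EuclideanSpace.single k 1) := by
    funext r
    simp [tensor_apply, coordVec]
  rw [h2]
  rcases hx with hx | hx
  · rw [shiftPrimitive_eq_zero hf hx]
    simp
  · have hc : Continuous fun r : ℝ => ‖x.2 + r • EuclideanSpace.single k (1 : ℝ)‖ := by fun_prop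
    have hev : ∀ᶠ r : ℝ in 𝓝 0, ‖x.2 + r • EuclideanSpace.single k (1 : ℝ)‖ < ρ :=
      (hc.tendsto 0).eventually_lt_const (by simpa using hx)
    have he : (fun r : ℝ => shiftPrimitive f t x.1 * h (x.2 + r • EuclideanSpace.single k 1))
        =ᶠ[𝓝 0] fun _ => shiftPrimitive f t x.1 := by
      filter_upwards [hev] with r hr
      rw [hh _ hr, mul_one]
    rw [he.deriv_eq, deriv_const]

/-- Sets in a slab around time zero far out in space are space-like to bounded sets. -/
theorem totallySpacelike_of_bounds {X Y : Set (Spacetime s)} {d ρ r : ℝ} (hρ : d + 2 * r < ρ)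
    (hX : ∀ x ∈ X, |x.1| ≤ d ∧ ρ ≤ ‖x.2‖) (hY : ∀ y ∈ Y, |y.1| ≤ r ∧ ‖y.2‖ ≤ r) :
    TotallySpacelike X Y := by
  intro x hx y hy
  have h1 := hX x hx
  have h2 := hY y hy
  have h3 := abs_sub x.1 y.1
  have h4 := norm_sub_norm_le x.2 y.2
  linarith [h1.1, h1.2, h2.1, h2.2]

theorem TotallySpacelike.symm {X Y : Set (Spacetime s)} (h : TotallySpacelike X Y) :
    TotallySpacelike Y X := fun y hy x hx => by
  rw [abs_sub_comm, norm_sub_rev]; exact h x hx y hy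

theorem tsupport_bounds {F : TestFn (Spacetime s)} {d ρ : ℝ}
    (hF : ∀ x : Spacetime s, d < |x.1| ∨ ‖x.2‖ < ρ → F x = 0) :
    ∀ x ∈ tsupport F, |x.1| ≤ d ∧ ρ ≤ ‖x.2‖ := by
  have hcl : IsClosed {x : Spacetime s | |x.1| ≤ d ∧ ρ ≤ ‖x.2‖} := by
    have h1 : IsClosed {x : Spacetime s | |x.1| ≤ d} :=
      isClosed_le (by fun_prop) continuous_const
    have h2 : IsClosed {x : Spacetime s | ρ ≤ ‖x.2‖} :=
      isClosed_le continuous_const (by fun_prop)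
    convert h1.inter h2 using 1
    ext x
    simp
  refine closure_minimal (fun x hx => ?_) hcl
  by_contra h
  refine hx (hF x ?_)
  rcases not_and_or.1 h with h | h
  · exact Or.inl (not_le.1 h)
  · exact Or.inr (not_le.1 h)

theorem exists_radius {X : Set (Spacetime s)} (hX : Bornology.IsBounded X) :
    ∃ r : ℝ, 0 ≤ r ∧ ∀ y ∈ X, |y.1| ≤ r ∧ ‖y.2‖ ≤ r := by
  obtain ⟨r, hr⟩ := hX.subset_closedBall 0
  refine ⟨max r 0, le_max_right _ _, fun y hy => ?_⟩
  have h1 := hr hy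
  rw [mem_closedBall_zero_iff] at h1
  exact ⟨((norm_fst_le y).trans h1).trans (le_max_left _ _),
    ((norm_snd_le y).trans h1).trans (le_max_left _ _)⟩

theorem dilate_apply {R : ℝ} (hR : R ≠ 0) (g : TestFn (Space s)) (x : Space s) :
    dilate R g x = g (R⁻¹ • x) := by
  rw [dilate, dif_neg hR]
  rfl

theorem dilate_eq_one {R : ℝ} (hR : 0 < R) {g : TestFn (Space s)} (hg : ∀ x, ‖x‖ ≤ 1 → g x = 1)
    {x : Space s} (hx : ‖x‖ ≤ R) : dilate R g x = 1 := by
  rw [dilate_apply hR.ne']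
  refine hg _ ?_
  rw [norm_smul, norm_inv, Real.norm_of_nonneg hR.le, inv_mul_le_iff₀ hR, mul_one]
  exact hx

end TestFunctions

end ThermalQFT

namespace ThermalQFT

open MeasureTheory Filter Set

/-! ### Currents -/

section Currents

variable {A : Type u} [CStarAlgebra A] [PartialOrder A] [StarOrderedRing A] {s : ℕ}
  {N : LocalNet s A} {ω : A →ₚ[ℂ] ℂ} {J : Current s ω}

theorem Current.comm_eq_vecComm (μ : Fin (s + 1)) (f : TestFn (Spacetime s)) (a : A) :
    J.comm μ f a = vecComm ω (J.vec μ f) a := rfl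

namespace Current.IsLocallyConserved

theorem vec_zero (hJ : J.IsLocallyConserved N) (μ : Fin (s + 1)) : J.vec μ 0 = 0 := by
  have := hJ.linear μ 1 0 0
  simpa using this

theorem vec_add (hJ : J.IsLocallyConserved N) (μ : Fin (s + 1)) (f g : TestFn (Spacetime s)) :
    J.vec μ (f + g) = J.vec μ f + J.vec μ g := by
  have := hJ.linear μ 1 f g
  simpa using this

theorem vec_smul (hJ : J.IsLocallyConserved N) (μ : Fin (s + 1)) (c : ℝ)
    (f : TestFn (Spacetime s)) : J.vec μ (c • f) = (c : ℂ) • J.vec μ f := by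
  have := hJ.linear μ c f 0
  rwa [add_zero, hJ.vec_zero, add_zero] at this

theorem vec_sub (hJ : J.IsLocallyConserved N) (μ : Fin (s + 1)) (f g : TestFn (Spacetime s)) :
    J.vec μ (f - g) = J.vec μ f - J.vec μ g := by
  rw [eq_sub_iff_add_eq, ← hJ.vec_add, sub_add_cancel]

theorem vec_sum (hJ : J.IsLocallyConserved N) (μ : Fin (s + 1)) {ι : Type*} (S : Finset ι)
    (f : ι → TestFn (Spacetime s)) : J.vec μ (∑ i ∈ S, f i) = ∑ i ∈ S, J.vec μ (f i) :=
  map_sum (AddMonoidHom.mk' (J.vec μ) (hJ.vec_add μ)) f S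

/-- Covariance on graphs combined with the invariance of Ω. -/
theorem gnsUnitary_vec (hJ : J.IsLocallyConserved N)
    (hinv : ∀ (x : Spacetime s) (a : A), ω (N.trans x a) = ω a) (x : Spacetime s)
    (μ : Fin (s + 1)) (f : TestFn (Spacetime s)) :
    gnsUnitary ω (N.trans x) (hinv x) (J.vec μ f) = J.vec μ (translate x f) := by
  have h1 := (hJ.covariant x (hinv x) μ f (gnsVec ω) (J.vec μ f)).1
    ((J.op μ f).mem_graph ⟨gnsVec ω, J.vec_mem μ f⟩)
  rw [gnsUnitary_gnsVec hinv] at h1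
  obtain ⟨y, hy1, hy2⟩ := ((J.op μ (translate x f)).mem_graph_iff).1 h1
  have hy : y = ⟨gnsVec ω, J.vec_mem μ (translate x f)⟩ := Subtype.ext hy1
  rw [hy] at hy2
  exact hy2.symm

theorem exists_mem_selfAdjointVectors (hJ : J.IsLocallyConserved N)
    (f : TestFn (Spacetime s)) : ∃ O : Region s, J.vec 0 f ∈ selfAdjointVectors ω (N.alg O) := by
  obtain ⟨O, -, hO⟩ := hJ.affiliated f
  exact ⟨O, mem_closure_of_affiliated (J.selfAdjoint 0 f) hO (J.vec_mem 0 f)⟩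

/-- Local conservation of the charge: moving the charge in time produces a surface term. -/
theorem vec_tensor_translate_sub (hJ : J.IsLocallyConserved N) (f : TestFn ℝ) (t : ℝ)
    (h : TestFn (Space s)) :
    J.vec 0 (tensor (translate t f) h) - J.vec 0 (tensor f h)
      = ∑ k : Fin s, J.vec k.succ
          (∂_{(coordVec k.succ : Spacetime s)} (tensor (shiftPrimitive f t) h)) := by
  have h1 := hJ.conserved (tensor (shiftPrimitive f t) h) (gnsVec ω) fun μ => J.vec_mem μ _
  change ∑ μ, J.vec μ (∂_{(coordVec μ : Spacetime s)} (tensor (shiftPrimitive f t) h)) = 0 at h1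
  rw [Fin.sum_univ_succ, lineDeriv_time_tensor, hJ.vec_sub] at h1
  rw [← sub_eq_zero, ← neg_eq_zero, ← h1]
  abel

theorem vecComm_eq_zero (hJ : J.IsLocallyConserved N) {O : Region s} {a : A} (ha : a ∈ N.alg O)
    {r : ℝ} (hO : ∀ y ∈ O.carrier, |y.1| ≤ r ∧ ‖y.2‖ ≤ r) {d ρ : ℝ} (hρ : d + 2 * r < ρ)
    (μ : Fin (s + 1)) {F : TestFn (Spacetime s)}
    (hF : ∀ x : Spacetime s, d < |x.1| ∨ ‖x.2‖ < ρ → F x = 0) :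
    vecComm ω (J.vec μ F) a = 0 :=
  hJ.local_alg μ F O (totallySpacelike_of_bounds hρ (tsupport_bounds hF) hO) a ha

/-- A time shift changes the charge by surface currents, which are space-like to O. -/
theorem vecComm_tensor_translate (hJ : J.IsLocallyConserved N) {O : Region s} {a : A}
    (ha : a ∈ N.alg O) {r : ℝ} (hO : ∀ y ∈ O.carrier, |y.1| ≤ r ∧ ‖y.2‖ ≤ r)
    {f : TestFn ℝ} {d : ℝ} (hf : ∀ x, d ≤ |x| → f x = 0) {t ρ : ℝ} (hρ : d + |t| + 2 * r < ρ)
    {h : TestFn (Space s)} (hh : ∀ x, ‖x‖ < ρ → h x = 1) :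
    vecComm ω (J.vec 0 (tensor (translate t f) h)) a = vecComm ω (J.vec 0 (tensor f h)) a := by
  rw [← sub_eq_zero, ← vecComm_sub, hJ.vec_tensor_translate_sub]
  have h1 : ∀ S : Finset (Fin s), vecComm ω (∑ k ∈ S, J.vec k.succ
      (∂_{(coordVec k.succ : Spacetime s)} (tensor (shiftPrimitive f t) h))) a = 0 := fun S => by
    refine Finset.sum_induction _ (fun v => vecComm ω v a = 0) (fun v w hv hw => ?_) ?_ ?_
    · rw [vecComm_add, hv, hw, add_zero]
    · simp [vecComm]
    · exact fun k _ => hJ.vecComm_eq_zero ha hO hρ k.succ fun x hx =>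
        lineDeriv_space_tensor_eq_zero hf t hh k hx
  exact h1 Finset.univ

/-- The expectation value of the commutator with the charge does not depend on the cutoff. -/
theorem vecComm_tensor_eq (hJ : J.IsLocallyConserved N) {O : Region s} {a : A}
    (ha : a ∈ N.alg O) {r : ℝ} (hO : ∀ y ∈ O.carrier, |y.1| ≤ r ∧ ‖y.2‖ ≤ r)
    {f : TestFn ℝ} {d : ℝ} (hf : ∀ x, d ≤ |x| → f x = 0) {g : TestFn (Space s)}
    (hg : ∀ x, ‖x‖ ≤ 1 → g x = 1) {c : ℂ}
    (hlim : Tendsto (fun R : ℝ => J.comm 0 (tensor f (dilate R g)) a) atTop (𝓝 c)) {ρ : ℝ}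
    (hρ : d + 2 * r < ρ) {h : TestFn (Space s)} (hh : ∀ x, ‖x‖ < ρ → h x = 1) :
    vecComm ω (J.vec 0 (tensor f h)) a = c := by
  refine tendsto_nhds_unique (tendsto_const_nhds.congr' ?_) hlim
  -- Both cutoffs are 1 within radius ρ, so their difference is space-like to O and the commutator
  -- is constant in R.
  filter_upwards [eventually_ge_atTop ρ, eventually_gt_atTop 0] with R hR hR0
  rw [Current.comm_eq_vecComm, ← sub_eq_zero, ← vecComm_sub, ← hJ.vec_sub]
  refine hJ.vecComm_eq_zero ha hO hρ 0 fun x hx => ?_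
  change tensor f h x - tensor f (dilate R g) x = 0
  rw [tensor_apply, tensor_apply]
  rcases hx with hx | hx
  · rw [hf _ hx.le]; ring
  · rw [hh _ hx, dilate_eq_one hR0 hg (hx.le.trans hR), sub_self]

/-- The vector of a lattice sum of translated charge densities. -/
theorem vec_tensor_latticeSum (hJ : J.IsLocallyConserved N)
    (hinv : ∀ (x : Spacetime s) (a : A), ω (N.trans x a) = ω a) (f : TestFn ℝ) (t : ℝ)
    (S : Finset (Fin s → ℤ)) (w : (Fin s → ℤ) → ℝ) (m : Fin s → ℤ) :
    J.vec 0 (tensor (translate t f) (latticeSum S w m))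
      = ∑ n ∈ S, (w n : ℂ) • gnsUnitary ω (N.trans (t, lattice (n - m))) (hinv _)
          (J.vec 0 (tensor f (cellBump s))) := by
  change J.vec 0 (tensorₗ (translate t f) (latticeSum S w m)) = _
  rw [latticeSum, map_sum, hJ.vec_sum]
  refine Finset.sum_congr rfl fun n _ => ?_
  rw [map_smul, hJ.vec_smul, hJ.gnsUnitary_vec hinv, translate_tensor]
  rfl

/-- A vanishing commutator with a self-adjoint a says that ⟪v, aΩ⟫ is real, which survives limits.
Locality of charge densities among themselves is obtained in this way from locality relative to
observables. -/
theorem im_inner_eq_zero_of_mem_selfAdjointVectors {B : StarSubalgebra ℂ A} {v q : ω.GNS}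
    (hq : q ∈ selfAdjointVectors ω B) (hv : ∀ a ∈ B, vecComm ω v a = 0) :
    (⟪v, q⟫_ℂ).im = 0 := by
  have hcl : IsClosed {q : ω.GNS | (⟪v, q⟫_ℂ).im = 0} :=
    isClosed_eq (by fun_prop) continuous_const
  refine closure_minimal (t := {q : ω.GNS | (⟪v, q⟫_ℂ).im = 0}) ?_ hcl hq
  rintro _ ⟨a, ha, ha', rfl⟩
  have h1 := hv a ha
  rw [vecComm, ha', sub_eq_zero, ← inner_conj_symm] at h1
  have h2 := Complex.conj_eq_iff_im.1 h1
  rw [mem_ofPred_eq, ← inner_conj_symm, Complex.conj_im, h2, neg_zero]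

end Current.IsLocallyConserved

end Currents

end ThermalQFT

namespace ThermalQFT

open MeasureTheory Filter Set

/-! ### The charge on the lattice, fluctuation bounds and the conclusion -/

section Main

variable {A : Type u} [CStarAlgebra A] [PartialOrder A] [StarOrderedRing A] {s : ℕ}
  {N : LocalNet s A} {ω : A →ₚ[ℂ] ℂ} {J : Current s ω}

/-- The commutator function of the charge density on the lattice has finite range and vanishing
total mass, uniformly for bounded times. -/
theorem Current.IsLocallyConserved.exists_range (hJ : J.IsLocallyConserved N)
    (hinv : ∀ (x : Spacetime s) (a : A), ω (N.trans x a) = ω a) {f : TestFn ℝ} {d : ℝ}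
    (hf : ∀ x, d ≤ |x| → f x = 0) {q : ω.GNS} (hq : q = J.vec 0 (tensor f (cellBump s))) :
    ∃ r : ℕ, ∀ t : ℝ, |t| ≤ 1 →
      (∀ n ∉ box s r, (⟪gnsUnitary ω (N.trans (t, lattice n)) (hinv _) q, q⟫_ℂ).im = 0) ∧
      ∑ n ∈ box s r, (⟪gnsUnitary ω (N.trans (t, lattice n)) (hinv _) q, q⟫_ℂ).im = 0 := by
  obtain ⟨O, hO⟩ := hJ.exists_mem_selfAdjointVectors (tensor f (cellBump s))
  obtain ⟨r₀, hr₀, hOr⟩ := exists_radius O.isBounded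
  obtain ⟨r₁, hr₁, hG⟩ := exists_radius
    (tensor f (cellBump s)).hasCompactSupport.isCompact.isBounded
  -- One radius serves both claims: r₀ bounds the region of q, r₁ the support of its density, s the
  -- support of a cell bump, and the 3 covers |t| ≤ 1 and the lattice margin.
  obtain ⟨r, hr⟩ := exists_nat_gt (|d| + 3 + 2 * r₀ + 2 * r₁ + s)
  have hd := le_abs_self d
  have hd0 := abs_nonneg d
  have hs0 : (0 : ℝ) ≤ s := Nat.cast_nonneg s
  refine ⟨r, fun t ht => ⟨fun n hn => ?_, ?_⟩⟩
  · rw [mem_box, not_le] at hn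
    rw [hq, hJ.gnsUnitary_vec hinv]
    refine im_inner_eq_zero_of_mem_selfAdjointVectors hO fun a ha => ?_
    refine hJ.vecComm_eq_zero ha hOr (d := d + 1) (ρ := ‖n‖ - s) (by linarith) 0 fun x hx => ?_
    rw [translate_tensor, tensor_apply, translate_apply, translate_apply]
    rcases hx with hx | hx
    · rw [hf, zero_mul]
      have := abs_sub_abs_le_abs_sub x.1 t
      linarith
    · rw [cellBump_eq_zero, mul_zero]
      have h1 := norm_sub_norm_le (lattice n) x.2
      rw [norm_sub_rev] at h1
      linarith [norm_le_norm_lattice n]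
  · set h := latticeSum (box s r) (fun _ => 1) 0 with hh
    have hh1 : ∀ x, ‖x‖ < (r : ℝ) - 1 → h x = 1 := fun x hx =>
      latticeSum_eq_one (fun n hn => ⟨by
        rw [sub_zero, sub_add_cancel] at hn
        exact mem_box.2 hn, rfl⟩) hx
    have hsum : ∀ u : ℝ, ∑ n ∈ box s r,
        (⟪gnsUnitary ω (N.trans (u, lattice n)) (hinv _) q, q⟫_ℂ).im
          = (⟪J.vec 0 (tensor (translate u f) h), q⟫_ℂ).im := fun u => by
      rw [hh, hJ.vec_tensor_latticeSum hinv, sum_inner, Complex.im_sum]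
      refine Finset.sum_congr rfl fun n _ => ?_
      rw [Complex.ofReal_one, one_smul, sub_zero, ← hq]
    -- The total mass does not depend on time: by conservation the change is a surface current, and
    -- its commutator with the density of q vanishes by locality.
    have htime : ∀ u : ℝ, |u| ≤ 1 → (⟪J.vec 0 (tensor (translate u f) h), q⟫_ℂ).im
        = (⟪J.vec 0 (tensor f h), q⟫_ℂ).im := fun u hu => by
      rw [← sub_eq_zero, ← Complex.sub_im, ← inner_sub_left, hJ.vec_tensor_translate_sub,
        sum_inner, Complex.im_sum]
      refine Finset.sum_eq_zero fun k _ => ?_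
      have h1 := hJ.local_current k (tensor f (cellBump s))
        (∂_{(coordVec k.succ : Spacetime s)} (tensor (shiftPrimitive f u) h))
        (totallySpacelike_of_bounds (d := d + |u|) (ρ := r - 1) (r := r₁) (by linarith)
          (tsupport_bounds fun x hx => lineDeriv_space_tensor_eq_zero hf u hh1 k hx) hG).symm
      rw [Current.commCurrent, sub_eq_zero, ← hq, ← inner_conj_symm] at h1
      exact Complex.conj_eq_iff_im.1 h1
    rw [hsum, htime t ht, ← htime 0 (by simp), ← hsum]
    -- At time zero reflection exchanges the two arguments of the inner product, so the kernel is
    -- odd and its sum over a symmetric box is zero.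
    have hanti : ∀ n, (⟪gnsUnitary ω (N.trans (0, lattice (-n))) (hinv _) q, q⟫_ℂ).im
        = -(⟪gnsUnitary ω (N.trans (0, lattice n)) (hinv _) q, q⟫_ℂ).im := fun n => by
      rw [inner_gnsUnitary_left, ← inner_conj_symm, Complex.conj_im]
      simp only [Prod.neg_mk, neg_zero, lattice_neg, neg_neg]
    have hneg : ∑ n ∈ box s r, (⟪gnsUnitary ω (N.trans (0, lattice n)) (hinv _) q, q⟫_ℂ).im
        = ∑ n ∈ box s r, (⟪gnsUnitary ω (N.trans (0, lattice (-n))) (hinv _) q, q⟫_ℂ).im :=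
      Finset.sum_nbij' (fun n => -n) (fun n => -n) (fun _ => neg_mem_box) (fun _ => neg_mem_box)
        (fun _ _ => neg_neg _) (fun _ _ => neg_neg _) (fun n _ => by rw [neg_neg])
    simp only [hanti, Finset.sum_neg_distrib] at hneg
    linarith

theorem im_inner_latticeSum (hinv : ∀ (x : Spacetime s) (a : A), ω (N.trans x a) = ω a)
    (q : ω.GNS) (S : Finset (Fin s → ℤ)) (w : (Fin s → ℤ) → ℝ) (t : ℝ) :
    (⟪gnsUnitary ω (N.trans (t, 0)) (hinv _)
        (∑ n ∈ S, (w n : ℂ) • gnsUnitary ω (N.trans (0, lattice n)) (hinv _) q),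
      ∑ n ∈ S, (w n : ℂ) • gnsUnitary ω (N.trans (0, lattice n)) (hinv _) q⟫_ℂ).im
      = ∑ n ∈ S, ∑ m ∈ S, w n * w m *
        (⟪gnsUnitary ω (N.trans (t, lattice (n - m))) (hinv _) q, q⟫_ℂ).im := by
  rw [map_sum, sum_inner, Complex.im_sum]
  refine Finset.sum_congr rfl fun n _ => ?_
  rw [inner_sum, Complex.im_sum]
  refine Finset.sum_congr rfl fun m _ => ?_
  rw [map_smul, inner_smul_left, inner_smul_right, Complex.conj_ofReal, Complex.im_ofReal_mul,
    Complex.im_ofReal_mul, mul_assoc, ← gnsUnitary_add hinv]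
  congr 3
  have h1 := inner_gnsUnitary_left hinv (0, lattice m)
    (gnsUnitary ω (N.trans (t, lattice (n - m))) (hinv _) q)
    (gnsUnitary ω (N.trans (0, lattice m)) (hinv _) q)
  rw [← gnsUnitary_add hinv, ← gnsUnitary_add hinv] at h1
  simp only [neg_add_cancel, gnsUnitary_zero hinv, Prod.mk_add_mk, zero_add, lattice_sub,
    add_sub_cancel] at h1
  simp only [Prod.mk_add_mk, zero_add, add_zero, lattice_sub]
  rw [h1]

theorem vecComm_one {v : ω.GNS} (hv : v ∈ selfAdjointVectors ω ⊤) : vecComm ω v 1 = 0 := by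
  have hcl : IsClosed {v : ω.GNS | vecComm ω v 1 = 0} := by
    simp only [vecComm]
    exact isClosed_eq (by fun_prop) continuous_const
  refine closure_minimal (t := {v : ω.GNS | vecComm ω v 1 = 0}) ?_ hcl hv
  rintro _ ⟨a, -, ha, rfl⟩
  rw [mem_ofPred_eq, vecComm, inner_gnsStarAlgHom_gnsVec, inner_gnsStarAlgHom_gnsVec, ha]
  simp

theorem vecComm_sub_right (v : ω.GNS) (a b : A) :
    vecComm ω v (a - b) = vecComm ω v a - vecComm ω v b := by
  simp only [vecComm, map_sub, star_sub, sub_apply, inner_sub_left, inner_sub_right]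
  ring

/-- Space-like clustering restricted to lattice translations. -/
theorem LocalNet.ClustersWithRate.exists_lattice_bound {δ γ : ℝ} (hδ : N.ClustersWithRate ω δ)
    (hγ : 0 ≤ γ) (hγδ : γ ≤ δ) {a b : A} (ha : a ∈ N.localAlg) (hb : b ∈ N.localAlg)
    (hb0 : ω b = 0) :
    ∃ C : ℝ, 0 ≤ C ∧ ∀ n : Fin s → ℤ,
      ‖ω (a * N.space (lattice n) b)‖ ≤ C * (1 + ‖n‖) ^ (-γ) := by
  obtain ⟨C, hC, hCb⟩ := (hδ a ha b hb).exists_pos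
  have hev := hCb.bound
  rw [hb0] at hev
  simp only [mul_zero, sub_zero] at hev
  obtain ⟨R, -, hR⟩ := (hasBasis_cobounded_norm (E := Space s)).eventually_iff.1 hev
  obtain ⟨K, hK⟩ := ω.exists_norm_apply_le
  -- Beyond R' clustering applies and, norms being at least 1, the rate can be lowered from δ to γ;
  -- inside, the operator norm bound is enough.
  set R' := max R 1 with hR'
  have hR0 : 0 < 1 + R' := by have := le_max_right R 1; linarith
  set B : ℝ := K * (‖a‖ * ‖b‖) with hB
  have hB0 : 0 ≤ B := by positivity
  refine ⟨C * 2 ^ γ + B * (1 + R') ^ γ, by positivity, fun n => ?_⟩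
  have hn : (0 : ℝ) < 1 + ‖n‖ := by positivity
  have hnl := norm_le_norm_lattice n
  rw [add_mul]
  by_cases hc : R' ≤ ‖lattice n‖
  · have h1 : 1 ≤ ‖lattice n‖ := (le_max_right _ _).trans hc
    have h2 := hR (x := lattice n) ((le_max_left _ _).trans hc)
    rw [Real.norm_of_nonneg (by positivity)] at h2
    have h3 : ‖lattice n‖ ^ (-δ) ≤ ‖lattice n‖ ^ (-γ) :=
      Real.rpow_le_rpow_of_exponent_le h1 (by linarith)
    have h4 : ‖lattice n‖ ^ (-γ) ≤ ((1 + ‖n‖) / 2) ^ (-γ) :=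
      Real.rpow_le_rpow_of_nonpos (by positivity) (by linarith) (by linarith)
    have h5 : ((1 + ‖n‖) / 2) ^ (-γ) = 2 ^ γ * (1 + ‖n‖) ^ (-γ) := by
      rw [Real.div_rpow hn.le zero_le_two, Real.rpow_neg zero_le_two γ, div_inv_eq_mul, mul_comm]
    have h6 : 0 ≤ B * (1 + R') ^ γ * (1 + ‖n‖) ^ (-γ) := by positivity
    calc _ ≤ C * ‖lattice n‖ ^ (-δ) := h2
      _ ≤ C * (2 ^ γ * (1 + ‖n‖) ^ (-γ)) := by
          gcongr; exact h3.trans (h4.trans h5.le)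
      _ ≤ _ := by linarith
  · have h1 : ‖ω (a * N.space (lattice n) b)‖ ≤ B := by
      refine (hK _).trans ?_
      rw [hB]
      gcongr
      refine (norm_mul_le _ _).trans ?_
      gcongr
      exact (StarAlgEquiv.norm_map (N.space (lattice n)) b).le
    have h2 : (1 + R') ^ (-γ) ≤ (1 + ‖n‖) ^ (-γ) :=
      Real.rpow_le_rpow_of_nonpos hn (by linarith) (by linarith)
    have h3 : (1 + R') ^ γ * (1 + R') ^ (-γ) = 1 := by
      rw [← Real.rpow_add hR0, add_neg_cancel, Real.rpow_zero]
    have h6 : 0 ≤ C * 2 ^ γ * (1 + ‖n‖) ^ (-γ) := by positivity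
    calc _ ≤ B * ((1 + R') ^ γ * (1 + R') ^ (-γ)) := by rw [h3, mul_one]; exact h1
      _ ≤ B * ((1 + R') ^ γ * (1 + ‖n‖) ^ (-γ)) := by gcongr
      _ ≤ _ := by linarith

/-- The average of the translates of `a` by the lattice points of a box. -/
def boxAverage (N : LocalNet s A) (M : ℕ) (a : A) : A :=
  ((((2 * M + 1 : ℕ) : ℝ) ^ s)⁻¹ : ℝ) • ∑ m ∈ box s M, N.space (lattice m) a

theorem star_boxAverage (M : ℕ) (a : A) :
    star (boxAverage N M a) = boxAverage N M (star a) := by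
  simp [boxAverage, star_smul, star_sum, map_star]

/-- Translation invariance reduces the fluctuation to a double sum over differences of lattice
points, so a decay rate below s survives the averaging. -/
theorem re_apply_star_boxAverage_mul_le
    (hspace : ∀ (x : Space s) (a : A), ω (N.space x a) = ω a) {p C : ℝ} (hp : 0 < p)
    (hp1 : p < 1) {M : ℕ} (hM : 0 < M) {a : A} (hC : 0 ≤ C)
    (h : ∀ n : Fin s → ℤ,
      ‖ω (star a * N.space (lattice n) a)‖ ≤ C * (1 + ‖n‖) ^ (-(p * s))) :
    (ω (star (boxAverage N M a) * boxAverage N M a)).re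
      ≤ C * (2 / (1 - p) * 3) ^ s * (M : ℝ) ^ (-(p * s)) := by
  refine le_trans (le_of_eq ?_) (sum_box_sum_box_le hp hp1 hM hC
    (G := fun n => (ω (star a * N.space (lattice n) a)).re)
    fun n => (Complex.re_le_norm _).trans (h n))
  set V : ℝ := (((2 * M + 1 : ℕ) : ℝ) ^ s)⁻¹
  have hpair : ∀ n m : Fin s → ℤ, ω (star (N.space (lattice n) a) * N.space (lattice m) a)
      = ω (star a * N.space (lattice (m - n)) a) := fun n m => by
    have h1 := N.trans_add (0, lattice n) (0, lattice (m - n)) a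
    simp only [Prod.mk_add_mk, add_zero, lattice_sub, add_sub_cancel] at h1
    have h2 : star (N.space (lattice n) a) * N.space (lattice m) a
        = N.space (lattice n) (star a * N.space (lattice (m - n)) a) := by
      rw [map_mul, map_star, lattice_sub]
      exact congrArg _ h1
    rw [h2, hspace]
  rw [boxAverage, star_smul, star_trivial, smul_mul_smul_comm, star_sum, Finset.sum_mul_sum]
  rw [← Complex.coe_smul, map_smul, smul_eq_mul, Complex.re_ofReal_mul, map_sum, Complex.re_sum,
    ← pow_two]
  congr 1
  refine Finset.sum_congr rfl fun n _ => ?_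
  rw [map_sum, Complex.re_sum]
  exact Finset.sum_congr rfl fun m _ => by rw [hpair]

theorem two_mul_pow_div_sq_le (s : ℕ) {n : ℕ} (hn : 0 < n) :
    ((2 * n : ℕ) : ℝ) ^ s / ((2 * n : ℕ) : ℝ) ^ 2 ≤ 2 ^ s * (n : ℝ) ^ ((s : ℝ) - 2) := by
  have hn' : (0 : ℝ) < n := by exact_mod_cast hn
  rw [Real.rpow_sub hn', Real.rpow_natCast, Real.rpow_two]
  push_cast
  rw [mul_pow, mul_pow, ← mul_div_assoc]
  gcongr
  nlinarith [sq_nonneg (n : ℝ)]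

/-- The commutator of a smeared charge with the translates of a local observable by the lattice
points of a large box is the order parameter. -/
theorem Current.IsLocallyConserved.vecComm_timeAverage_boxAverage (hJ : J.IsLocallyConserved N)
    (hinv : ∀ (x : Spacetime s) (a : A), ω (N.trans x a) = ω a)
    {f : TestFn ℝ} {d : ℝ} (hf : ∀ x, d ≤ |x| → f x = 0) {g : TestFn (Space s)}
    (hg : ∀ x, ‖x‖ ≤ 1 → g x = 1) {O : Region s} {a : A} (ha : a ∈ N.alg O) {c : ℂ}
    (hlim : Tendsto (fun R : ℝ => J.comm 0 (tensor f (dilate R g)) a) atTop (𝓝 c))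
    {r₀ : ℝ} (hO : ∀ y ∈ O.carrier, |y.1| ≤ r₀ ∧ ‖y.2‖ ≤ r₀) {M n : ℕ} (hM : d + 1 + 2 * r₀ + 1 + 1 ≤ M) (hnM : M ≤ n)
    {q : ω.GNS} (hq : q = J.vec 0 (tensor f (cellBump s))) :
    vecComm ω (timeAverage hinv (∑ k ∈ box s (2 * (2 * n)), (cutoff (2 * n) k : ℂ) •
      gnsUnitary ω (N.trans (0, lattice k)) (hinv _) q)) (boxAverage N n a) = c := by
  set w : (Fin s → ℤ) → ℝ := cutoff (2 * n) with hw
  -- One unit is for the times |t| ≤ 1, the other for the strict inequality.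
  set ρ : ℝ := d + 1 + 2 * r₀ + 1 with hρ
  refine vecComm_timeAverage hinv fun t ht => ?_
  have habs : |t| ≤ 1 := by rw [abs_of_nonneg ht.1]; exact ht.2
  have hcomm : ∀ m ∈ box s n, vecComm ω (gnsUnitary ω (N.trans (t, 0)) (hinv _)
      (∑ k ∈ box s (2 * (2 * n)), (w k : ℂ) •
        gnsUnitary ω (N.trans (0, lattice k)) (hinv _) q)) (N.space (lattice m) a) = c :=
    fun m hm => by
    -- Instead of the observable, the charge is translated, by -m. As ‖m‖ ≤ n and ρ + 1 ≤ M ≤ n, all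
    -- weights involved lie within 2n, where the cutoff is 1.
    have hone : ∀ x, ‖x‖ < ρ → latticeSum (box s (2 * (2 * n))) w m x = 1 := fun x hx =>
      latticeSum_eq_one (fun k hk => by
        have h1 : ‖k‖ ≤ ((2 * n : ℕ) : ℝ) := by
          have h2 := norm_sub_norm_le k m
          have h3 := mem_box.1 hm
          have h4 : (M : ℝ) ≤ n := by exact_mod_cast hnM
          push_cast
          linarith
        refine ⟨mem_box.2 (h1.trans ?_), cutoff_eq_one h1⟩
        push_cast; linarith) hx
    have h1 : vecComm ω
        (J.vec 0 (tensor (translate t f) (latticeSum (box s (2 * (2 * n))) w m))) a = c := by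
      rw [hJ.vecComm_tensor_translate ha hO hf (by rw [hρ]; linarith) hone]
      exact hJ.vecComm_tensor_eq ha hO hf hg hlim (by rw [hρ]; linarith) hone
    rw [hJ.vec_tensor_latticeSum hinv, ← hq,
      ← vecComm_gnsUnitary hinv (0, lattice m)] at h1
    rw [LocalNet.space, ← h1, map_sum, map_sum]
    congr 1
    refine Finset.sum_congr rfl fun k _ => ?_
    rw [map_smul, map_smul, ← gnsUnitary_add hinv, ← gnsUnitary_add hinv]
    simp only [Prod.mk_add_mk, add_zero, zero_add, lattice_sub, add_sub_cancel]
  rw [boxAverage, ← Complex.coe_smul, vecComm_smul_right, vecComm_sum_right,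
    Finset.sum_congr rfl hcomm, Finset.sum_const, card_box, nsmul_eq_mul, ← mul_assoc]
  have hV : ((((2 * n + 1) ^ s : ℕ) : ℂ)) = ((((2 * n + 1 : ℕ) : ℝ) ^ s : ℝ) : ℂ) := by
    push_cast; rfl
  rw [hV, ← Complex.ofReal_mul, inv_mul_cancel₀ (by positivity), Complex.ofReal_one, one_mul]

theorem abs_im_inner_sum_cutoff_le (hinv : ∀ (x : Spacetime s) (a : A), ω (N.trans x a) = ω a)
    {q : ω.GNS} {r n : ℕ} (hn : 0 < n) (hrn : r ≤ n) {t : ℝ}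
    (h0 : ∀ k ∉ box s r, (⟪gnsUnitary ω (N.trans (t, lattice k)) (hinv _) q, q⟫_ℂ).im = 0)
    (hsum : ∑ k ∈ box s r, (⟪gnsUnitary ω (N.trans (t, lattice k)) (hinv _) q, q⟫_ℂ).im = 0) :
    |(⟪gnsUnitary ω (N.trans (t, 0)) (hinv _) (∑ k ∈ box s (2 * n), (cutoff n k : ℂ) •
        gnsUnitary ω (N.trans (0, lattice k)) (hinv _) q),
      ∑ k ∈ box s (2 * n), (cutoff n k : ℂ) •
        gnsUnitary ω (N.trans (0, lattice k)) (hinv _) q⟫_ℂ).im|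
      ≤ (7 ^ s * (2 * r + 1) ^ s * r ^ 2 * (‖q‖ * ‖q‖)) * ((n : ℝ) ^ s / n ^ 2) := by
  rw [im_inner_latticeSum hinv]
  refine abs_sum_cutoff_kernel_le
    (K := fun k => (⟪gnsUnitary ω (N.trans (t, lattice k)) (hinv _) q, q⟫_ℂ).im)
    hn hrn (fun k => ?_) h0 hsum
  refine (Complex.abs_im_le_norm _).trans ((norm_inner_le_norm _ _).trans ?_)
  rw [LinearIsometryEquiv.norm_map]

/-- If the charge density does not commute with a local observable of mean zero, space-like
clustering is at most as fast as `|x|^{-(s - 2)}`. -/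
theorem clustering_bound_of_broken (hs : 3 ≤ s) {β : ℝ} (hβ : 0 < β) (hK : N.IsKMS ω β)
    (hspace : ∀ (x : Space s) (a : A), ω (N.space x a) = ω a) (hJ : J.IsLocallyConserved N)
    {f : TestFn ℝ} {d : ℝ} (hf : ∀ x, d ≤ |x| → f x = 0) {g : TestFn (Space s)}
    (hg : ∀ x, ‖x‖ ≤ 1 → g x = 1) {O : Region s} {a : A} (ha : a ∈ N.alg O) (ha0 : ω a = 0)
    {c : ℂ} (hc : c ≠ 0)
    (hlim : Tendsto (fun R : ℝ => J.comm 0 (tensor f (dilate R g)) a) atTop (𝓝 c))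
    {δ : ℝ} (hδ : N.ClustersWithRate ω δ) : δ ≤ (s : ℝ) - 2 := by
  by_contra hlt
  rw [not_le] at hlt
  have hinv : ∀ (x : Spacetime s) (b : A), ω (N.trans x b) = ω b := fun x b => by
    have h1 := N.trans_add (x.1, 0) (0, x.2) b
    simp only [Prod.mk_add_mk, add_zero, zero_add, Prod.mk.eta] at h1
    rw [h1]
    exact (hK.apply_time hβ _ _).trans (hspace _ _)
  have hs3 : (3 : ℝ) ≤ s := by exact_mod_cast hs
  set γ := min δ ((s : ℝ) - 1) with hγ
  have hγ1 : (s : ℝ) - 2 < γ := lt_min hlt (by linarith)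
  have hγδ : γ ≤ δ := min_le_left _ _
  have hγs : γ ≤ (s : ℝ) - 1 := min_le_right _ _
  set p := γ / s with hp
  have hps : p * s = γ := div_mul_cancel₀ _ (by linarith)
  have hp0 : 0 < p := div_pos (by linarith) (by linarith)
  have hp1 : p < 1 := by rw [hp, div_lt_one (by linarith)]; linarith
  have hmem : a ∈ N.localAlg := mem_iUnion.2 ⟨O, ha⟩
  have hmem' : star a ∈ N.localAlg := mem_iUnion.2 ⟨O, star_mem ha⟩
  have ha0' : ω (star a) = 0 := by rw [map_star, ha0, star_zero]
  obtain ⟨C₁, hC₁, hb₁⟩ := hδ.exists_lattice_bound (by linarith) hγδ hmem' hmem ha0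
  obtain ⟨C₂, hC₂, hb₂⟩ := hδ.exists_lattice_bound (by linarith) hγδ hmem hmem' ha0'
  rw [← hps] at hb₁ hb₂
  set q := J.vec 0 (tensor f (cellBump s)) with hq
  obtain ⟨r, hr⟩ := hJ.exists_range hinv hf hq
  obtain ⟨r₀, hr₀, hO⟩ := exists_radius O.isBounded
  set ρ : ℝ := d + 1 + 2 * r₀ + 1 with hρ
  obtain ⟨M, hM⟩ := exists_nat_ge (ρ + 1)
  set E := 7 ^ s * (2 * r + 1) ^ s * r ^ 2 * (‖q‖ * ‖q‖) with hE
  have hqsa : q ∈ selfAdjointVectors ω ⊤ := by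
    obtain ⟨O', hO'⟩ := hJ.exists_mem_selfAdjointVectors (tensor f (cellBump s))
    exact selfAdjointVectors_mono le_top hO'
  -- D collects the two fluctuation bounds, for a and for a*; the factor 2^s in E comes from the
  -- cutoff scale 2n.
  refine hc (norm_le_zero_iff.1 (nonpos_of_forall_le_rpow (a := (s : ℝ) - 2) (b := γ)
    (D := β * ((C₁ + C₂) * (2 / (1 - p) * 3) ^ s) / 2) (E := 2 * (E * 2 ^ s)) hγ1
    (N₀ := max (max M r) 1) fun n hn ε hε => ?_))
  have hnM : M ≤ n := (le_max_left M r).trans ((le_max_left _ _).trans hn)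
  have hnr : r ≤ n := (le_max_right M r).trans ((le_max_left _ _).trans hn)
  have hn0 : 0 < n := (le_max_right _ _).trans hn
  have hn0' : (0 : ℝ) < n := by exact_mod_cast hn0
  set S := box s (2 * (2 * n)) with hS
  set w : (Fin s → ℤ) → ℝ := cutoff (2 * n) with hw
  set Q : ω.GNS := ∑ k ∈ S, (w k : ℂ) • gnsUnitary ω (N.trans (0, lattice k)) (hinv _) q with hQ
  have hQsa : Q ∈ selfAdjointVectors ω ⊤ := sum_mem_selfAdjointVectors _ fun k _ =>
    smul_mem_selfAdjointVectors _ (gnsUnitary_mem_selfAdjointVectors hinv _ hqsa)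
  have hX : vecComm ω (timeAverage hinv Q) (boxAverage N n a) = c :=
    hJ.vecComm_timeAverage_boxAverage hinv hf hg ha hlim hO (by exact_mod_cast hM) hnM hq
  have hform : ∀ t : ℝ, |t| ≤ 1 → |(⟪gnsUnitary ω (N.trans (t, 0)) (hinv _) Q, Q⟫_ℂ).im|
      ≤ E * (((2 * n : ℕ) : ℝ) ^ s / ((2 * n : ℕ) : ℝ) ^ 2) := fun t ht => by
    exact abs_im_inner_sum_cutoff_le hinv (by omega) (by omega) (hr t ht).1 (hr t ht).2
  have hbog := bogoliubov_timeAverage hinv hβ hK hQsa (boxAverage N n a) hε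
  rw [hX] at hbog
  have h1 := re_apply_star_boxAverage_mul_le hspace hp0 hp1 hn0 hC₁ hb₁
  have h2 := re_apply_star_boxAverage_mul_le hspace hp0 hp1 hn0 hC₂ (a := star a)
    (by simpa using hb₂)
  rw [← star_boxAverage, star_star] at h2
  have h3 := abs_im_inner_timeAverage_le hinv hform
  rw [hps] at h1 h2
  have hpow := two_mul_pow_div_sq_le s hn0
  have hE0 : 0 ≤ E := by positivity
  have hεi : 0 < ε⁻¹ := inv_pos.2 hε
  have h4 : ε * β * ((ω (star (boxAverage N n a) * boxAverage N n a)).re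
      + (ω (boxAverage N n a * star (boxAverage N n a))).re)
      ≤ ε * β * ((C₁ + C₂) * (2 / (1 - p) * 3) ^ s * (n : ℝ) ^ (-γ)) := by
    gcongr
    linarith
  have h5 : ε⁻¹ * (2 * |(⟪timeAverage hinv Q, gnsUnitary ω (N.trans (1, 0)) (hinv _) Q - Q⟫_ℂ).im|)
      ≤ ε⁻¹ * (2 * (2 * (E * (2 ^ s * (n : ℝ) ^ ((s : ℝ) - 2))))) := by
    gcongr
    refine h3.trans ?_
    gcongr
  refine hbog.trans ?_
  have h6 := add_le_add h4 h5
  refine (div_le_div_of_nonneg_right h6 zero_le_two).trans (le_of_eq ?_)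
  ring

end Main

end ThermalQFT

end

open ThermalQFT in
theorem theorem1 {A : Type u} [CStarAlgebra A] [PartialOrder A] [StarOrderedRing A]
    {s : ℕ} (hs : 3 ≤ s)
    (N : LocalNet s A) (hW : N.HasLocalWStar)
    (ω : A →ₚ[ℂ] ℂ) (hω : ω ∈ N.physical)
    (hfactor : IsFactorState ω)
    {β : ℝ} (hβ : 0 < β) (hKMS : N.IsKMS ω β)
    (hspace : ∀ (x : Space s) (a : A), ω (N.space x a) = ω a)
    (J : Current s ω) (hJ : J.IsLocallyConserved N)
    (hbroken : J.IsBroken N)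
    (δ : ℝ) (hδ : N.ClustersWithRate ω δ) :
    δ ≤ (s : ℝ) - 2 := by
  obtain ⟨d, ε, f, g, -, -, -, hf, hg, -, a₀, ha₀, c, hc, hlim⟩ := hbroken
  obtain ⟨O, hO⟩ := Set.mem_iUnion.1 ha₀
  have h1 : ω 1 = 1 := N.physical_one ω hω
  -- Subtracting the mean turns clustering into plain decay and leaves the order parameter
  -- unchanged, as multiples of the unit have vanishing commutator with the charge.
  refine clustering_bound_of_broken hs hβ hKMS hspace hJ hf hg (O := O) (a := a₀ - ω a₀ • 1)
    (sub_mem hO (SMulMemClass.smul_mem _ (one_mem _))) ?_ hc (hlim.congr fun R => ?_) hδ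
  · rw [map_sub, map_smul, h1, smul_eq_mul, mul_one, sub_self]
  · obtain ⟨O', hO'⟩ := hJ.exists_mem_selfAdjointVectors (tensor f (dilate R g))
    rw [Current.comm_eq_vecComm, Current.comm_eq_vecComm, vecComm_sub_right, vecComm_smul_right,
      vecComm_one (selfAdjointVectors_mono le_top hO'), mul_zero, sub_zero]
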